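/- **Spectral dualities.** *Diers contexts.* Let $U:\mathcal A\to\mathcal B$ be a functor between locally small categories which is right multi-adjoint: for each object $b$ of $\mathcal B$ there is a small family of morphisms $x:b\to U(A_x)$, $x\in X_b$ (the local units under $b$), such that every morphism $b\to U(A)$ factors as $U(u)\circ x$ for a unique pair $(x\in X_b,\ u:A_x\to A)$. A morphism of $\mathcal B$ is diagonally universal if it is left orthogonal (with unique fillers) to all $U(u)$; $\mathcal D_b$ is the full subcategory of $b\downarrow\mathcal B$ on the pushouts $n:b\to\mathrm{cod}(n)$ of diagonally universal morphisms between finitely presentable objects. For a local unit $x$ under $b$ write $n\le x$ if $x$ factors through $n$, and let $V_x$ be the full subcategory of $\mathcal D_b$ on the $n\le x$. $(U,\mathcal A,\mathcal B)$ is a *Diers context* if moreover $\mathcal B$ is locally finitely presentable and, for every $b$ and $x\in X_b$, $V_x$ is filtered and $x$ is its colimit in $b\downarrow\mathcal B$. The 2-category $\mathfrak{Diers}$ has Diers contexts as 0-cells; as 1-cells $(U_1,\mathcal A_1,\mathcal B_1)\to(U_2,\mathcal A_2,\mathcal B_2)$ the triples $(F,G,\theta)$ with functors $F:\mathcal A_1\to\mathcal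 A_2$, $G:\mathcal B_1\to\mathcal B_2$, where $G$ preserves filtered colimits and has a left adjoint, and $\theta:GU_1\cong U_2F$; as 2-cells $(F,G,\theta)\Rightarrow(F',G',\theta')$ the pairs $\alpha:F\Rightarrow F'$, $\beta:G\Rightarrow G'$ with $U_2(\alpha_A)\,\theta_A=\theta'_A\,\beta_{U_1A}$ for all $A$. *Spectral dualities.* Regard a functor to $\mathrm{Top}^{op}$ as a fibration (opfibration) over $\mathrm{Top}$ if the opposite functor to $\mathrm{Top}$ is one. The 2-category $\mathfrak{Dual}$ has as 0-cells the functors $\iota:\mathfrak A\to\mathfrak B$ over $\mathrm{Top}^{op}$ with a left adjoint $\mathfrak S\dashv\iota$, where $\mathfrak A,\mathfrak B$ are fibrations over $\mathrm{Top}$, $\mathfrak B$ is also an opfibration, and $\iota$ is a strict morphism of fibrations (it commutes strictly with the projections and preserves cartesian arrows); as 1-cells the triples $(\mathbb F,\mathbb G,\theta)$ with strict morphisms of fibrations $\mathbb F:\mathfrak A_1\to\mathfrak A_2$, $\mathbb G:\mathfrak B_1\to\mathfrak B_2$ and $\theta:\mathbb G\iota_1\cong\iota_2\mathbb F$; as 2-cells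 the pairs of natural transformations whose whiskerings agree through $\theta,\theta'$. *Spaces.* A $\mathcal B$-space is a topological space $X$ with a sheaf $\mathbb B$ of objects of $\mathcal B$; a morphism $(X,\mathbb B)\to(Y,\mathbb C)$ is a continuous map $f:Y\to X$ with a morphism of sheaves $\mathbb B\to f_*\mathbb C$. A $U$-space is a $\mathcal B$-space $(X,\mathbb A)$ with objects $A_x$ of $\mathcal A$ and isomorphisms $\mathbb A|_x\cong U(A_x)$ for $x\in X$; a morphism $(X,\mathbb A,A)\to(Y,\mathbb A',A')$ is a morphism $(f,\phi)$ of $\mathcal B$-spaces with morphisms $u_y:A_{f(y)}\to A'_y$, $y\in Y$, such that $U(u_y)$ is the map induced by $\phi$ on stalks at $y$. Let $\iota_U$ be the forgetful functor from $U$-spaces to $\mathcal B$-spaces. **Theorem.** 1. For every Diers context, the $U$-spaces and the $\mathcal B$-spaces form fibrations over $\mathrm{Top}$, the $\mathcal B$-spaces also form an opfibration, $\iota_U$ is a strict morphism of fibrations, and $\iota_U$ has a left adjoint $\mathrm{Spec}_U$. Moreover $\mathrm{Spec}_U(X,\mathbb B)$ is, up to isomorphism, the following $U$-space. Its points are the pairs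 $(x,\xi)$ with $x\in X$ and $\xi$ a local unit under $\mathbb B|_x$; its topology is generated by the sets $D_{(u,n)}$, for $u\subseteq X$ open and $n\in\mathcal D_{\mathbb B(u)}$, of the $(x,\xi)$ such that $x\in u$ and $\xi$ factors through the pushout of $n$ along $\mathbb B(u)\to\mathbb B|_x$; its sheaf is the sheafification of the left Kan extension of $(u,n)\mapsto\mathrm{cod}(n)$ along $(u,n)\mapsto D_{(u,n)}$; its stalk at $(x,\xi)$ is $U(A_\xi)$, by an isomorphism under which the composites $\mathbb B(u)\xrightarrow{n}\mathrm{cod}(n)\to U(A_\xi)$ are the composites $\mathbb B(u)\to\mathbb B|_x\xrightarrow{\xi}U(A_\xi)$. The unit of the adjunction is the projection $(x,\xi)\mapsto x$ with the canonical morphism of sheaves given by the $(u,1_{\mathbb B(u)})$. 2. For every 1-cell $(F,G,\theta)$ of $\mathfrak{Diers}$, the functors $\mathbb G:(X,\mathbb B)\mapsto(X,G\mathbb B)$ and $\mathbb F:(X,\mathbb A,(A_x))\mapsto(X,G\mathbb A,(F(A_x)))$ (with the stalk isomorphisms $(G\mathbb A)|_x\cong G(\mathbb A|_x)\cong GU_1(A_x)\cong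 U_2F(A_x)$) are strict morphisms of fibrations, and $\mathbb G\iota_{U_1}=\iota_{U_2}\mathbb F$. 3. Sending $(U,\mathcal A,\mathcal B)$ to the adjunction $\mathrm{Spec}_U\dashv\iota_U$, $(F,G,\theta)$ to $(\mathbb F,\mathbb G,\mathrm{id})$, and $(\alpha,\beta)$ to the pair of transformations which are the identity on the underlying spaces, $\beta$ on the values of the sheaves and $\alpha$ on the objects $A_x$, defines a strict 2-functor $\mathfrak{Spec}:\mathfrak{Diers}\to\mathfrak{Dual}$. -/

import Mathlib

open CategoryTheory CategoryTheory.Limits Opposite TopologicalSpace AlgebraicGeometry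

universe v u₁ u₂ u₁' u₂' u₁'' u₂'' u₁''' u₂'''

noncomputable section

namespace SpectralDualities

/-! ### Squares of functors commuting up to an invertible 2-cell -/

section Squares

variable {A : Type u₁} [Category.{v} A] {B : Type u₂} [Category.{v} B]
  {A' : Type u₁'} [Category.{v} A'] {B' : Type u₂'} [Category.{v} B']
  {A'' : Type u₁''} [Category.{v} A''] {B'' : Type u₂''} [Category.{v} B'']
  {A''' : Type u₁'''} [Category.{v} A'''] {B''' : Type u₂'''} [Category.{v} B''']

/-- A triple `(F, G, θ)` with `θ : G U ≅ U' F`. -/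
structure Square (U : A ⥤ B) (U' : A' ⥤ B') where
  /-- the functor between the domains -/
  F : A ⥤ A'
  /-- the functor between the codomains -/
  G : B ⥤ B'
  /-- the invertible 2-cell -/
  θ : U ⋙ G ≅ F ⋙ U'

namespace Square

variable {U : A ⥤ B} {U' : A' ⥤ B'} {U'' : A'' ⥤ B''} {U''' : A''' ⥤ B'''}

/-- Pairs `(α, β)` of natural transformations whose whiskerings agree through `θ` and `θ'`
(the equality of the whiskerings is written componentwise). -/
@[ext]
structure Hom (s t : Square U U') where
  /-- the component between the domains -/
  α : s.F ⟶ t.F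
  /-- the component between the codomains -/
  β : s.G ⟶ t.G
  /-- equality of the whiskerings -/
  w : ∀ a : A, s.θ.hom.app a ≫ U'.map (α.app a) = β.app (U.obj a) ≫ t.θ.hom.app a

/-- Identity 2-cell. -/
@[simps]
def Hom.id (s : Square U U') : Hom s s where
  α := 𝟙 _
  β := 𝟙 _
  w a := by simp

/-- Vertical composition of 2-cells. -/
@[simps]
def Hom.comp {s t r : Square U U'} (η : Hom s t) (ξ : Hom t r) : Hom s r where
  α := η.α ≫ ξ.α
  β := η.β ≫ ξ.β
  w a := by
    simp only [NatTrans.comp_app, Functor.map_comp, Category.assoc]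
    rw [← ξ.w a, ← Category.assoc, η.w a, Category.assoc]

/-- The identity square. -/
def id (U : A ⥤ B) : Square U U where
  F := 𝟭 A
  G := 𝟭 B
  θ := NatIso.ofComponents (fun a ↦ Iso.refl (U.obj a)) (fun f ↦ by
    change U.map f ≫ 𝟙 _ = 𝟙 _ ≫ U.map f
    rw [Category.comp_id, Category.id_comp])

lemma comp_aux {x y z w y' x' : B''} {f : x ⟶ y} {g : y ⟶ z} {h : z ⟶ w} {k : y ⟶ y'}
    {l : y' ⟶ w} {m : x ⟶ x'} {n : x' ⟶ y'} (h₁ : g ≫ h = k ≫ l) (h₂ : f ≫ k = m ≫ n) :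
    (f ≫ g) ≫ h = m ≫ n ≫ l := by
  rw [Category.assoc, h₁, ← Category.assoc, h₂, Category.assoc]

/-- Pasting of squares. -/
def comp (s : Square U U') (t : Square U' U'') : Square U U'' where
  F := s.F ⋙ t.F
  G := s.G ⋙ t.G
  θ := NatIso.ofComponents (fun a ↦ t.G.mapIso (s.θ.app a) ≪≫ t.θ.app (s.F.obj a))
    (fun {a b} f ↦ by
      have h₁ := t.θ.hom.naturality (s.F.map f)
      have h₂ := congrArg t.G.map (s.θ.hom.naturality f)
      rw [Functor.map_comp, Functor.map_comp] at h₂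
      exact (comp_aux h₁.symm h₂.symm).symm)

/-- Left whiskering of a 2-cell. -/
def whiskerLeft (s : Square U U') {t t' : Square U' U''} (η : Hom t t') :
    Hom (s.comp t) (s.comp t') where
  α := Functor.whiskerLeft s.F η.α
  β := Functor.whiskerLeft s.G η.β
  w a := comp_aux (η.w (s.F.obj a)) (η.β.naturality (s.θ.hom.app a))

/-- Right whiskering of a 2-cell. -/
def whiskerRight {s s' : Square U U'} (η : Hom s s') (t : Square U' U'') :
    Hom (s.comp t) (s'.comp t) where
  α := Functor.whiskerRight η.α t.F
  β := Functor.whiskerRight η.β t.G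
  w a := by
    have h := congrArg t.G.map (η.w a)
    rw [Functor.map_comp, Functor.map_comp] at h
    exact comp_aux (t.θ.hom.naturality (η.α.app a)).symm h

lemma ext_of {s t : Square U U'} (hF : s.F = t.F) (hG : s.G = t.G)
    (h : s.θ.hom ≍ t.θ.hom) : s = t := by
  obtain ⟨F, G, θ⟩ := s
  obtain ⟨F', G', θ'⟩ := t
  obtain rfl : F = F' := hF
  obtain rfl : G = G' := hG
  obtain rfl : θ = θ' := by ext1; exact eq_of_heq h
  rfl

lemma id_comp (s : Square U U') : (Square.id U).comp s = s :=
  ext_of rfl rfl (heq_of_eq (NatTrans.ext (funext fun a ↦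
    (congrArg (· ≫ s.θ.hom.app a) (s.G.map_id (U.obj a))).trans (Category.id_comp _))))

lemma comp_id (s : Square U U') : s.comp (Square.id U') = s :=
  ext_of rfl rfl (heq_of_eq (NatTrans.ext (funext fun _ ↦ Category.comp_id _)))

lemma assoc (s : Square U U') (t : Square U' U'') (r : Square U'' U''') :
    (s.comp t).comp r = s.comp (t.comp r) :=
  ext_of rfl rfl (heq_of_eq (NatTrans.ext (funext fun a ↦
    (congrArg (· ≫ r.θ.hom.app (t.F.obj (s.F.obj a)))
      (r.G.map_comp (t.G.map (s.θ.hom.app a)) (t.θ.hom.app (s.F.obj a)))).trans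
        (Category.assoc _ _ _))))

/-- The 2-cell between equal squares whose two components are identities. -/
def homOfEq {s t : Square U U'} (h : s = t) : Hom s t where
  α := eqToHom (congrArg F h)
  β := eqToHom (congrArg G h)
  w a := by subst h; simp

lemma homOfEq_trans {s t r : Square U U'} (h : s = t) (h' : t = r) :
    (homOfEq h).comp (homOfEq h') = homOfEq (h.trans h') := by
  subst h h'
  exact Hom.ext (Category.id_comp _) (Category.id_comp _)

lemma homOfEq_comp_self {s t : Square U U'} (h : s = t) (h' : t = s) :
    (homOfEq h).comp (homOfEq h') = Hom.id s := homOfEq_trans h h'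

lemma whiskerLeft_homOfEq (s : Square U U') {t t' : Square U' U''} (h : t = t') :
    whiskerLeft s (homOfEq h) = homOfEq (congrArg (s.comp ·) h) := by
  subst h; exact Hom.ext rfl rfl

lemma whiskerRight_homOfEq {s s' : Square U U'} (h : s = s') (t : Square U' U'') :
    whiskerRight (homOfEq h) t = homOfEq (congrArg (·.comp t) h) := by
  subst h
  exact Hom.ext (NatTrans.ext (funext fun _ ↦ t.F.map_id _))
    (NatTrans.ext (funext fun _ ↦ t.G.map_id _))

lemma conj_ext {f f' g g' : Square U U'} (hf : f = f') (hg : g' = g)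
    (η : Hom f g) (ξ : Hom f' g') (hα : η.α ≍ ξ.α) (hβ : η.β ≍ ξ.β) :
    η = (homOfEq hf).comp (ξ.comp (homOfEq hg)) := by
  subst hf hg
  obtain rfl : η = ξ := Hom.ext (eq_of_heq hα) (eq_of_heq hβ)
  exact Hom.ext ((Category.comp_id _).symm.trans (Category.id_comp _).symm)
    ((Category.comp_id _).symm.trans (Category.id_comp _).symm)

lemma id_whiskerLeft {f g : Square U U'} (η : Hom f g) :
    whiskerLeft (Square.id U) η =
      (homOfEq (id_comp f)).comp (η.comp (homOfEq (id_comp g).symm)) :=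
  conj_ext _ _ _ _ HEq.rfl HEq.rfl

lemma whiskerRight_id {f g : Square U U'} (η : Hom f g) :
    whiskerRight η (Square.id U') =
      (homOfEq (comp_id f)).comp (η.comp (homOfEq (comp_id g).symm)) :=
  conj_ext _ _ _ _ HEq.rfl HEq.rfl

lemma comp_whiskerLeft (f : Square U U') (g : Square U' U'') {h h' : Square U'' U'''}
    (η : Hom h h') : whiskerLeft (f.comp g) η = (homOfEq (assoc f g h)).comp
      ((whiskerLeft f (whiskerLeft g η)).comp (homOfEq (assoc f g h').symm)) :=
  conj_ext _ _ _ _ HEq.rfl HEq.rfl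

lemma whiskerRight_comp {f f' : Square U U'} (η : Hom f f') (g : Square U' U'')
    (h : Square U'' U''') : whiskerRight η (g.comp h) = (homOfEq (assoc f g h).symm).comp
      ((whiskerRight (whiskerRight η g) h).comp (homOfEq (assoc f' g h))) :=
  conj_ext _ _ _ _ HEq.rfl HEq.rfl

lemma whisker_assoc (f : Square U U') {g g' : Square U' U''} (η : Hom g g')
    (h : Square U'' U''') : whiskerRight (whiskerLeft f η) h = (homOfEq (assoc f g h)).comp
      ((whiskerLeft f (whiskerRight η h)).comp (homOfEq (assoc f g' h).symm)) :=
  conj_ext _ _ _ _ HEq.rfl HEq.rfl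

lemma whisker_exchange {f g : Square U U'} {h i : Square U' U''} (η : Hom f g) (ξ : Hom h i) :
    (whiskerLeft f ξ).comp (whiskerRight η i) = (whiskerRight η h).comp (whiskerLeft g ξ) :=
  Hom.ext (NatTrans.ext (funext fun _ ↦ (ξ.α.naturality _).symm))
    (NatTrans.ext (funext fun _ ↦ (ξ.β.naturality _).symm))

lemma pentagon {A₄ : Type*} [Category.{v} A₄] {B₄ : Type*} [Category.{v} B₄] {U₄ : A₄ ⥤ B₄}
    (f : Square U U') (g : Square U' U'') (h : Square U'' U''') (i : Square U''' U₄) :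
    (whiskerRight (homOfEq (assoc f g h)) i).comp ((homOfEq (assoc f (g.comp h) i)).comp
      (whiskerLeft f (homOfEq (assoc g h i)))) =
      (homOfEq (assoc (f.comp g) h i)).comp (homOfEq (assoc f g (h.comp i))) := by
  rw [whiskerRight_homOfEq, whiskerLeft_homOfEq, homOfEq_trans, homOfEq_trans, homOfEq_trans]

lemma triangle (f : Square U U') (g : Square U' U'') :
    (homOfEq (assoc f (Square.id U') g)).comp (whiskerLeft f (homOfEq (id_comp g))) =
      whiskerRight (homOfEq (comp_id f)) g := by
  rw [whiskerRight_homOfEq, whiskerLeft_homOfEq, homOfEq_trans]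

end Square

end Squares

/-! ### Diers contexts -/

section Conditions

variable {A : Type u₁} [Category.{v} A] {B : Type u₂} [Category.{v} B] (U : A ⥤ B)

/-- `U` is right multi-adjoint: each comma category `b ↓ U` has a small multi-initial family, i.e.
a small family of objects such that every object of `b ↓ U` receives exactly one morphism
from exactly one member of the family. -/
def IsRightMultiAdjoint : Prop :=
  ∀ b : B, ∃ (I : Type v) (x : I → StructuredArrow b U),
    ∀ s : StructuredArrow b U, Nonempty (Unique (Σ i, (x i ⟶ s)))

variable {U} in
/-- The set `X_b` of local units under `b`. -/
def LocalUnits (h : IsRightMultiAdjoint U) (b : B) : Type v := (h b).choose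

variable {U} in
/-- The local unit `b ⟶ U(A_x)` with index `x`, as an object of `b ↓ U`; the object `A_x` is
`(localUnit h b x).right` and the morphism is `(localUnit h b x).hom`. -/
def localUnit (h : IsRightMultiAdjoint U) (b : B) : LocalUnits h b → StructuredArrow b U :=
  (h b).choose_spec.choose

/-- Diagonally universal morphisms: those left orthogonal (with unique fillers) to all the
morphisms `U(u)`. -/
def DiagonallyUniversal {b c : B} (n : b ⟶ c) : Prop :=
  ∀ ⦃a a' : A⦄ (u : a ⟶ a') (f : b ⟶ U.obj a) (g : c ⟶ U.obj a'), f ≫ U.map u = n ≫ g →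
    ∃! d : c ⟶ U.obj a, n ≫ d = f ∧ d ≫ U.map u = g

/-- The diagonally universal morphisms of finite presentation, i.e. the objects of `𝒟_b`:
pushouts of diagonally universal morphisms between finitely presentable objects. -/
def FinDiag {b c : B} (n : b ⟶ c) : Prop :=
  ∃ (k k' : B) (l : k ⟶ k') (f : k ⟶ b) (f' : k' ⟶ c),
    IsFinitelyPresentable.{v} k ∧ IsFinitelyPresentable.{v} k' ∧
      DiagonallyUniversal U l ∧ IsPushout f l n f'

/-- The set `V_x` of the `n` in `𝒟_b` with `n ≤ x`, i.e. such that `x` factorizes through `n`. As a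
category it is the full subcategory of `𝒟_b`, hence of the category of objects under `b`. -/
def BelowUnit {b : B} (x : StructuredArrow b U) : ObjectProperty (Under b) :=
  fun n ↦ FinDiag U n.hom ∧ ∃ m : n.right ⟶ U.obj x.right, n.hom ≫ m = x.hom

/-- Every local unit `x` is the filtered colimit, among the objects under `b`, of the
`n ∈ 𝒟_b` with `n ≤ x`. -/
def DiersCondition (h : IsRightMultiAdjoint U) : Prop :=
  ∀ (b : B) (x : LocalUnits h b),
    IsFiltered (BelowUnit U (localUnit h b x)).FullSubcategory ∧
    ∃ c : (BelowUnit U (localUnit h b x)).ι ⟶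
        (Functor.const _).obj (Under.mk (localUnit h b x).hom),
      Nonempty (IsColimit (Cocone.mk _ c))

end Conditions

/-- Diers contexts `(U, 𝒜, ℬ)`. -/
structure DiersContext where
  /-- the category of local objects -/
  𝒜 : Type u₁
  [cat𝒜 : Category.{v} 𝒜]
  /-- the category of ambient objects -/
  ℬ : Type u₂
  [catℬ : Category.{v} ℬ]
  /-- the right multi-adjoint -/
  U : 𝒜 ⥤ ℬ
  lfp : IsLocallyFinitelyPresentable.{v} ℬ
  multi : IsRightMultiAdjoint U
  diers : DiersCondition U multi

namespace DiersContext

attribute [instance] cat𝒜 catℬ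

/-- Morphisms of Diers contexts: squares whose component `G` is a morphism of locally finitely
presentable categories, i.e. preserves filtered colimits and has a left adjoint. -/
structure Hom (C D : DiersContext.{v, u₁, u₂}) extends Square C.U D.U where
  finitary : PreservesFilteredColimits G
  isRightAdjoint : G.IsRightAdjoint

lemma Hom.ext_of {C D : DiersContext.{v, u₁, u₂}} {f g : Hom C D}
    (h : f.toSquare = g.toSquare) : f = g := by
  obtain ⟨f, _, _⟩ := f
  obtain ⟨g, _, _⟩ := g
  obtain rfl : f = g := h
  rfl

instance : CategoryStruct DiersContext.{v, u₁, u₂} where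
  Hom := Hom
  id C :=
    { Square.id C.U with
      finitary := inferInstanceAs (PreservesFilteredColimits (𝟭 C.ℬ))
      isRightAdjoint := inferInstanceAs (𝟭 C.ℬ).IsRightAdjoint }
  comp f g :=
    { f.toSquare.comp g.toSquare with
      finitary :=
        haveI := f.finitary
        haveI := g.finitary
        inferInstanceAs (PreservesFilteredColimits (f.G ⋙ g.G))
      isRightAdjoint :=
        haveI := f.isRightAdjoint
        haveI := g.isRightAdjoint
        inferInstanceAs (f.G ⋙ g.G).IsRightAdjoint }

instance (C D : DiersContext.{v, u₁, u₂}) : Category (C ⟶ D) where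
  Hom f g := Square.Hom f.toSquare g.toSquare
  id f := Square.Hom.id f.toSquare
  comp η ξ := Square.Hom.comp η ξ
  id_comp _ := Square.Hom.ext (Category.id_comp _) (Category.id_comp _)
  comp_id _ := Square.Hom.ext (Category.comp_id _) (Category.comp_id _)
  assoc _ _ _ := Square.Hom.ext (Category.assoc _ _ _) (Category.assoc _ _ _)

lemma id_comp {C D : DiersContext.{v, u₁, u₂}} (f : C ⟶ D) : 𝟙 C ≫ f = f :=
  Hom.ext_of (Square.id_comp f.toSquare)

lemma comp_id {C D : DiersContext.{v, u₁, u₂}} (f : C ⟶ D) : f ≫ 𝟙 D = f :=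
  Hom.ext_of (Square.comp_id f.toSquare)

lemma assoc {C D E E' : DiersContext.{v, u₁, u₂}} (f : C ⟶ D) (g : D ⟶ E) (h : E ⟶ E') :
    (f ≫ g) ≫ h = f ≫ g ≫ h :=
  Hom.ext_of (Square.assoc f.toSquare g.toSquare h.toSquare)

/-- The invertible 2-cell with identity components between equal 1-cells. -/
def isoOfEq {C D : DiersContext.{v, u₁, u₂}} {f g : C ⟶ D} (h : f.toSquare = g.toSquare) :
    f ≅ g where
  hom := Square.homOfEq h
  inv := Square.homOfEq h.symm
  hom_inv_id := Square.homOfEq_comp_self _ _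
  inv_hom_id := Square.homOfEq_comp_self _ _

lemma isoOfEq_eq {C D : DiersContext.{v, u₁, u₂}} {f g : C ⟶ D} (h : f = g) :
    isoOfEq (congrArg Hom.toSquare h) = eqToIso h := by
  subst h; rfl

/-- The 2-category of Diers contexts. -/
instance : Bicategory DiersContext.{v, u₁, u₂} where
  whiskerLeft f _ _ η := Square.whiskerLeft f.toSquare η
  whiskerRight η h := Square.whiskerRight η h.toSquare
  associator f g h := isoOfEq (Square.assoc f.toSquare g.toSquare h.toSquare)
  leftUnitor f := isoOfEq (Square.id_comp f.toSquare)
  rightUnitor f := isoOfEq (Square.comp_id f.toSquare)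
  whiskerLeft_id _ _ := Square.Hom.ext rfl rfl
  whiskerLeft_comp _ _ _ _ _ _ := Square.Hom.ext rfl rfl
  id_whiskerLeft η := Square.id_whiskerLeft η
  comp_whiskerLeft f g _ _ η := Square.comp_whiskerLeft f.toSquare g.toSquare η
  id_whiskerRight f g := Square.whiskerRight_homOfEq (s := f.toSquare) rfl g.toSquare
  comp_whiskerRight _ _ i := Square.Hom.ext
    (NatTrans.ext (funext fun _ ↦ i.F.map_comp _ _))
    (NatTrans.ext (funext fun _ ↦ i.G.map_comp _ _))
  whiskerRight_id η := Square.whiskerRight_id η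
  whiskerRight_comp η g h := Square.whiskerRight_comp η g.toSquare h.toSquare
  whisker_assoc f _ _ η h := Square.whisker_assoc f.toSquare η h.toSquare
  whisker_exchange η θ := Square.whisker_exchange η θ
  pentagon f g h i := Square.pentagon f.toSquare g.toSquare h.toSquare i.toSquare
  triangle f g := Square.triangle f.toSquare g.toSquare

instance : Bicategory.Strict DiersContext.{v, u₁, u₂} where
  id_comp := id_comp
  comp_id := comp_id
  assoc := assoc
  leftUnitor_eqToIso f := isoOfEq_eq (id_comp f)
  rightUnitor_eqToIso f := isoOfEq_eq (comp_id f)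
  associator_eqToIso f g h := isoOfEq_eq (assoc f g h)

end DiersContext

/-! ### Spectral dualities

A functor to `TopCatᵒᵖ` is regarded as a (op)fibration over the category of topological spaces
through the functor it induces from the opposite category to `TopCat`. -/

section Fibrations

variable {X : Type u₁} [Category.{v} X] {Y : Type u₂} [Category.{v} Y] {Z : Type u₁'}
  [Category.{v} Z] {S : Type u₂'} [Category.{v} S]

/-- Opfibrations: functors with a cocartesian lift of every morphism out of the image of
an object. -/
def IsOpfibered {S : Type*} [Category* S] (p : X ⥤ S) : Prop :=
  ∀ (a : X) (s : S) (f : p.obj a ⟶ s), ∃ (b : X) (φ : a ⟶ b), p.IsStronglyCocartesian f φ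

/-- Morphisms of fibrations over topological spaces: functors commuting strictly with the
projections and preserving cartesian arrows. -/
structure IsFibMorphism (p : X ⥤ TopCat.{v}ᵒᵖ) (q : Y ⥤ TopCat.{v}ᵒᵖ) (F : X ⥤ Y) : Prop where
  comm : F ⋙ q = p
  preserves : ∀ ⦃s t : TopCat.{v}⦄ (f : s ⟶ t) ⦃a b : Xᵒᵖ⦄ (φ : a ⟶ b),
    p.leftOp.IsStronglyCartesian f φ → q.leftOp.IsStronglyCartesian f (F.op.map φ)

lemma IsFibMorphism.id (p : X ⥤ TopCat.{v}ᵒᵖ) : IsFibMorphism p p (𝟭 X) where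
  comm := rfl
  preserves _ _ _ _ _ _ h := h

lemma IsFibMorphism.comp {p : X ⥤ TopCat.{v}ᵒᵖ} {q : Y ⥤ TopCat.{v}ᵒᵖ} {r : Z ⥤ TopCat.{v}ᵒᵖ}
    {F : X ⥤ Y} {G : Y ⥤ Z} (hF : IsFibMorphism p q F) (hG : IsFibMorphism q r G) :
    IsFibMorphism p r (F ⋙ G) where
  comm := (congrArg (F ⋙ ·) hG.comm).trans hF.comm
  preserves _ _ f _ _ φ h := hG.preserves f (F.op.map φ) (hF.preserves f φ h)

/-- What makes a functor `ι : 𝔄 ⥤ 𝔅` between categories over `TopCatᵒᵖ` a spectral duality: `𝔄` and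
`𝔅` are fibered, `𝔅` is also opfibered, `ι` is a strict morphism of fibrations, and `ι` comes with
a left adjoint `𝔖`. -/
structure DualityStructure {𝔄 : Type u₁} [Category.{v} 𝔄] {𝔅 : Type u₂} [Category.{v} 𝔅]
    (p : 𝔄 ⥤ TopCat.{v}ᵒᵖ) (q : 𝔅 ⥤ TopCat.{v}ᵒᵖ) (ι : 𝔄 ⥤ 𝔅) where
  fibered_p : p.leftOp.IsFibered
  fibered_q : q.leftOp.IsFibered
  opfibered_q : IsOpfibered q.leftOp
  isFibMorphism : IsFibMorphism p q ι
  /-- the left adjoint -/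
  𝔖 : 𝔅 ⥤ 𝔄
  /-- the adjunction -/
  adj : 𝔖 ⊣ ι

end Fibrations

/-- Spectral dualities `(𝔄, 𝔅, ι, 𝔖)`. -/
structure SpectralDuality where
  /-- the domain of `ι` -/
  𝔄 : Type u₁
  [cat𝔄 : Category.{v} 𝔄]
  /-- the codomain of `ι` -/
  𝔅 : Type u₂
  [cat𝔅 : Category.{v} 𝔅]
  /-- the projection of `𝔄` -/
  p : 𝔄 ⥤ TopCat.{v}ᵒᵖ
  /-- the projection of `𝔅` -/
  q : 𝔅 ⥤ TopCat.{v}ᵒᵖ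
  /-- the morphism of fibrations -/
  ι : 𝔄 ⥤ 𝔅
  /-- the fibration properties and the adjunction -/
  str : DualityStructure p q ι

namespace SpectralDuality

attribute [instance] cat𝔄 cat𝔅

/-- Morphisms of spectral dualities: squares `(𝔽, 𝔾, θ)` of morphisms of fibrations. -/
structure Hom (C D : SpectralDuality.{v, u₁, u₂}) extends Square C.ι D.ι where
  isFibMorphism_F : IsFibMorphism C.p D.p F
  isFibMorphism_G : IsFibMorphism C.q D.q G

lemma Hom.ext_of {C D : SpectralDuality.{v, u₁, u₂}} {f g : Hom C D}
    (h : f.toSquare = g.toSquare) : f = g := by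
  obtain ⟨f, _, _⟩ := f
  obtain ⟨g, _, _⟩ := g
  obtain rfl : f = g := h
  rfl

instance : CategoryStruct SpectralDuality.{v, u₁, u₂} where
  Hom := Hom
  id C :=
    { Square.id C.ι with
      isFibMorphism_F := IsFibMorphism.id C.p
      isFibMorphism_G := IsFibMorphism.id C.q }
  comp f g :=
    { f.toSquare.comp g.toSquare with
      isFibMorphism_F := f.isFibMorphism_F.comp g.isFibMorphism_F
      isFibMorphism_G := f.isFibMorphism_G.comp g.isFibMorphism_G }

instance (C D : SpectralDuality.{v, u₁, u₂}) : Category (C ⟶ D) where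
  Hom f g := Square.Hom f.toSquare g.toSquare
  id f := Square.Hom.id f.toSquare
  comp η ξ := Square.Hom.comp η ξ
  id_comp _ := Square.Hom.ext (Category.id_comp _) (Category.id_comp _)
  comp_id _ := Square.Hom.ext (Category.comp_id _) (Category.comp_id _)
  assoc _ _ _ := Square.Hom.ext (Category.assoc _ _ _) (Category.assoc _ _ _)

lemma id_comp {C D : SpectralDuality.{v, u₁, u₂}} (f : C ⟶ D) : 𝟙 C ≫ f = f :=
  Hom.ext_of (Square.id_comp f.toSquare)

lemma comp_id {C D : SpectralDuality.{v, u₁, u₂}} (f : C ⟶ D) : f ≫ 𝟙 D = f :=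
  Hom.ext_of (Square.comp_id f.toSquare)

lemma assoc {C D E E' : SpectralDuality.{v, u₁, u₂}} (f : C ⟶ D) (g : D ⟶ E) (h : E ⟶ E') :
    (f ≫ g) ≫ h = f ≫ g ≫ h :=
  Hom.ext_of (Square.assoc f.toSquare g.toSquare h.toSquare)

/-- The invertible 2-cell with identity components between equal 1-cells. -/
def isoOfEq {C D : SpectralDuality.{v, u₁, u₂}} {f g : C ⟶ D} (h : f.toSquare = g.toSquare) :
    f ≅ g where
  hom := Square.homOfEq h
  inv := Square.homOfEq h.symm
  hom_inv_id := Square.homOfEq_comp_self _ _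
  inv_hom_id := Square.homOfEq_comp_self _ _

lemma isoOfEq_eq {C D : SpectralDuality.{v, u₁, u₂}} {f g : C ⟶ D} (h : f = g) :
    isoOfEq (congrArg Hom.toSquare h) = eqToIso h := by
  subst h; rfl

/-- The 2-category of spectral dualities. -/
instance : Bicategory SpectralDuality.{v, u₁, u₂} where
  whiskerLeft f _ _ η := Square.whiskerLeft f.toSquare η
  whiskerRight η h := Square.whiskerRight η h.toSquare
  associator f g h := isoOfEq (Square.assoc f.toSquare g.toSquare h.toSquare)
  leftUnitor f := isoOfEq (Square.id_comp f.toSquare)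
  rightUnitor f := isoOfEq (Square.comp_id f.toSquare)
  whiskerLeft_id _ _ := Square.Hom.ext rfl rfl
  whiskerLeft_comp _ _ _ _ _ _ := Square.Hom.ext rfl rfl
  id_whiskerLeft η := Square.id_whiskerLeft η
  comp_whiskerLeft f g _ _ η := Square.comp_whiskerLeft f.toSquare g.toSquare η
  id_whiskerRight f g := Square.whiskerRight_homOfEq (s := f.toSquare) rfl g.toSquare
  comp_whiskerRight _ _ i := Square.Hom.ext
    (NatTrans.ext (funext fun _ ↦ i.F.map_comp _ _))
    (NatTrans.ext (funext fun _ ↦ i.G.map_comp _ _))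
  whiskerRight_id η := Square.whiskerRight_id η
  whiskerRight_comp η g h := Square.whiskerRight_comp η g.toSquare h.toSquare
  whisker_assoc f _ _ η h := Square.whisker_assoc f.toSquare η h.toSquare
  whisker_exchange η θ := Square.whisker_exchange η θ
  pentagon f g h i := Square.pentagon f.toSquare g.toSquare h.toSquare i.toSquare
  triangle f g := Square.triangle f.toSquare g.toSquare

instance : Bicategory.Strict SpectralDuality.{v, u₁, u₂} where
  id_comp := id_comp
  comp_id := comp_id
  assoc := assoc
  leftUnitor_eqToIso f := isoOfEq_eq (id_comp f)
  rightUnitor_eqToIso f := isoOfEq_eq (comp_id f)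
  associator_eqToIso f g h := isoOfEq_eq (assoc f g h)

end SpectralDuality

section Auxiliary

variable {B : Type u₂} [Category.{v} B]

lemma comm_aux {b₁ b₂ b₃ c₁ c₂ c₃ : B} {f : b₁ ⟶ b₂} {g : b₂ ⟶ b₃} {k : b₃ ⟶ c₃} {k' : b₂ ⟶ c₂}
    {l : c₂ ⟶ c₃} {k'' : b₁ ⟶ c₁} {l' : c₁ ⟶ c₂} {m : c₁ ⟶ c₃} {h : b₁ ⟶ b₃} (hh : h = f ≫ g)
    (hm : m = l' ≫ l) (h₁ : g ≫ k = k' ≫ l) (h₂ : f ≫ k' = k'' ≫ l') : h ≫ k = k'' ≫ m := by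
  rw [hh, hm, Category.assoc, h₁, ← Category.assoc, h₂, Category.assoc]

lemma push_aux {a b c d a' b' c' d' : B} {f : a ⟶ b} {g : b ⟶ c} {h : c ⟶ d} {f' : a' ⟶ b'}
    {g' : b' ⟶ c'} {h' : c' ⟶ d'} {i : a ⟶ a'} {j : b ⟶ b'} {k : c ⟶ c'} {l : d ⟶ d'}
    (h₁ : i ≫ f' = f ≫ j) (h₂ : j ≫ g' = g ≫ k) (h₃ : k ≫ h' = h ≫ l) :
    i ≫ f' ≫ g' ≫ h' = (f ≫ g ≫ h) ≫ l := by
  rw [Category.assoc, Category.assoc, ← h₃, ← Category.assoc g, ← h₂, Category.assoc,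
    ← Category.assoc f, ← h₁, Category.assoc]

lemma hom_comp_aux {x y z x' y' z' : B} {f : x ⟶ y} {g : y ⟶ z} {f' : x' ⟶ y'} {g' : y' ⟶ z'}
    {i : x ⟶ x'} {j : y ⟶ y'} {k : z ⟶ z'} {fg : x ⟶ z} (h : fg = f ≫ g) (h₁ : i ≫ f' = f ≫ j)
    (h₂ : j ≫ g' = g ≫ k) : i ≫ f' ≫ g' = fg ≫ k := by
  rw [h, Category.assoc, ← h₂, ← Category.assoc i, h₁, Category.assoc]

lemma opens_aux {x y x' y' z s : B} {i : x ⟶ x'} {f' : x' ⟶ y'} {f : x ⟶ y} {j : y ⟶ y'}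
    {m : y' ⟶ z} {k : y ⟶ s} {l : s ⟶ z} {fk : x ⟶ s} (h : f ≫ k = fk) (h₁ : i ≫ f' = f ≫ j)
    (h₂ : j ≫ m = k ≫ l) : i ≫ f' ≫ m = fk ≫ l := by
  rw [← h, Category.assoc, ← h₂, ← Category.assoc i, h₁, Category.assoc]

end Auxiliary

/-! ### Structured spaces -/

section Spaces

variable {A : Type u₁} [Category.{v} A] {B : Type u₂} [Category.{v} B]

/-- The category of `B`-spaces: spaces with a sheaf of objects of `B`, a morphism
`(X, 𝔹) ⟶ (Y, ℂ)` being a continuous map `f : Y → X` with a morphism of sheaves `𝔹 ⟶ f_* ℂ`. -/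
abbrev BSpace (B : Type u₂) [Category.{v} B] := (SheafedSpace.{u₂, v, v} B)ᵒᵖ

/-- The projection of `B`-spaces to topological spaces. -/
def BSpace.proj (B : Type u₂) [Category.{v} B] : BSpace B ⥤ TopCat.{v}ᵒᵖ :=
  (SheafedSpace.forget B).op

/-- `U`-spaces: spaces with a sheaf of objects of `B` whose stalk at each point `x` is (identified
with) `U(A_x)` for a given object `A_x` of `A`. -/
structure USpace (U : A ⥤ B) [HasColimits B] extends SheafedSpace.{u₂, v, v} B where
  /-- the objects `A_x` -/
  loc : carrier → A
  /-- the identification of the stalk at `x` with `U(A_x)` -/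
  stalkIso : ∀ x, presheaf.stalk x ≅ U.obj (loc x)

namespace USpace

variable {U : A ⥤ B} [HasColimits B]

/-- Morphisms of `U`-spaces `S ⟶ T`: a morphism of `B`-spaces, with underlying continuous map
`f : T → S`, together with, for each point `x` of `T`, a morphism
`u_x : A_{f x} ⟶ A_x` such that the morphism between the stalks is `U(u_x)`. -/
@[ext]
structure Hom (S T : USpace U) where
  /-- the underlying morphism of spaces with a sheaf, in the direction of the continuous map -/
  toHom : T.toSheafedSpace ⟶ S.toSheafedSpace
  /-- the morphisms `u_x` -/
  loc : ∀ x : T.carrier, S.loc (toHom.hom.base x) ⟶ T.loc x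
  comm : ∀ x : T.carrier, toHom.hom.stalkMap x ≫ (T.stalkIso x).hom =
    (S.stalkIso (toHom.hom.base x)).hom ≫ U.map (loc x)

instance : Category (USpace U) where
  Hom := Hom
  id S :=
    { toHom := 𝟙 S.toSheafedSpace
      loc := fun x ↦ 𝟙 (S.loc x)
      comm := fun x ↦
        (congrArg (· ≫ (S.stalkIso x).hom)
            (PresheafedSpace.stalkMap.id S.toPresheafedSpace x)).trans
          ((Category.id_comp _).trans ((Category.comp_id _).symm.trans
            (congrArg ((S.stalkIso x).hom ≫ ·) (U.map_id (S.loc x)).symm))) }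
  comp f g :=
    { toHom := g.toHom ≫ f.toHom
      loc := fun x ↦ f.loc (g.toHom.hom.base x) ≫ g.loc x
      comm := fun x ↦ comm_aux (PresheafedSpace.stalkMap.comp g.toHom.hom f.toHom.hom x)
        (U.map_comp _ _) (g.comm x) (f.comm (g.toHom.hom.base x)) }
  id_comp f := Hom.ext (Category.comp_id f.toHom)
    (heq_of_eq (funext fun _ ↦ Category.id_comp _))
  comp_id f := Hom.ext (Category.id_comp f.toHom)
    (heq_of_eq (funext fun _ ↦ Category.comp_id _))
  assoc f g h := Hom.ext (Category.assoc h.toHom g.toHom f.toHom).symm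
    (heq_of_eq (funext fun _ ↦ Category.assoc _ _ _))

variable (U)

/-- The forgetful functor from `U`-spaces to `B`-spaces. -/
def ι : USpace U ⥤ BSpace B where
  obj S := op S.toSheafedSpace
  map f := f.toHom.op

/-- The projection of `U`-spaces to topological spaces. -/
def proj : USpace U ⥤ TopCat.{v}ᵒᵖ := ι U ⋙ BSpace.proj B

end USpace

end Spaces

/-! ### Postcomposition of sheaves -/

section Postcomposition

variable {A : Type u₁} [Category.{v} A] {B : Type u₂} [Category.{v} B]
  {A' : Type u₁'} [Category.{v} A'] {B' : Type u₂'} [Category.{v} B']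

/-- Postcomposition of a sheaf with a right adjoint. -/
def pushSpace (G : B ⥤ B') (hG : G.IsRightAdjoint) (X : SheafedSpace.{u₂, v, v} B) :
    SheafedSpace.{u₂', v, v} B' where
  toPresheafedSpace := G.mapPresheaf.obj X.toPresheafedSpace
  IsSheaf :=
    haveI := (Adjunction.ofIsRightAdjoint G).rightAdjoint_preservesLimits
    GrothendieckTopology.HasSheafCompose.isSheaf (F := G) _ X.IsSheaf

/-- The functor between categories of spaces which postcomposes the sheaves with `G`. -/
def pushB (G : B ⥤ B') (hG : G.IsRightAdjoint) : BSpace B ⥤ BSpace B' where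
  obj X := op (pushSpace G hG X.unop)
  map f := (InducedCategory.homMk (G.mapPresheaf.map f.unop.hom) :
    pushSpace G hG _ ⟶ pushSpace G hG _).op
  map_id X := congrArg Quiver.Hom.op (InducedCategory.hom_ext
    (G.mapPresheaf.map_id X.unop.toPresheafedSpace))
  map_comp f g := congrArg Quiver.Hom.op (InducedCategory.hom_ext
    (G.mapPresheaf.map_comp g.unop.hom f.unop.hom))

/-- The transformation between postcomposition functors induced by `β : G ⟶ G'`: the continuous
maps are identities and the morphisms of sheaves are the components of `β`. -/
def pushBHom {G G' : B ⥤ B'} (β : G ⟶ G') (X : PresheafedSpace.{_, _, v} B) :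
    G'.mapPresheaf.obj X ⟶ G.mapPresheaf.obj X where
  base := 𝟙 X.carrier
  c :=
    { app := fun V ↦ β.app (X.presheaf.obj V)
      naturality := fun _ _ i ↦ β.naturality (X.presheaf.map i) }

lemma pushBHom_naturality {G G' : B ⥤ B'} (β : G ⟶ G') {X Y : PresheafedSpace.{_, _, v} B}
    (φ : X ⟶ Y) : pushBHom β X ≫ G.mapPresheaf.map φ = G'.mapPresheaf.map φ ≫ pushBHom β Y :=
  PresheafedSpace.hext _ _ rfl (heq_of_eq (NatTrans.ext (funext fun V ↦
    (β.naturality (φ.c.app V)))))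

/-- The action of a 2-cell on categories of `B`-spaces. -/
def pushBTrans {G G' : B ⥤ B'} (hG : G.IsRightAdjoint) (hG' : G'.IsRightAdjoint) (β : G ⟶ G') :
    pushB G hG ⟶ pushB G' hG' where
  app X := (InducedCategory.homMk (pushBHom β X.unop.toPresheafedSpace) :
    pushSpace G' hG' X.unop ⟶ pushSpace G hG X.unop).op
  naturality _ _ f := congrArg Quiver.Hom.op (InducedCategory.hom_ext
    (pushBHom_naturality β f.unop.hom))

variable [HasColimits B] [HasColimits B']

/-- Stalks commute with functors preserving filtered colimits. -/
def stalkCompIso (G : B ⥤ B') (hG : PreservesFilteredColimits G) {X : TopCat.{v}}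
    (P : X.Presheaf B) (x : X) :
    TopCat.Presheaf.stalk (P ⋙ G : X.Presheaf B') x ≅ G.obj (P.stalk x) :=
  haveI := hG
  (preservesColimitIso G ((OpenNhds.inclusion x).op ⋙ P)).symm

lemma germ_stalkCompIso (G : B ⥤ B') (hG : PreservesFilteredColimits G) {X : TopCat.{v}}
    (P : X.Presheaf B) (V : Opens X) (x : X) (hx : x ∈ V) :
    TopCat.Presheaf.germ (P ⋙ G : X.Presheaf B') V x hx ≫ (stalkCompIso G hG P x).hom =
      G.map (P.germ V x hx) :=
  haveI := hG
  ι_preservesColimitIso_inv G ((OpenNhds.inclusion x).op ⋙ P) _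


lemma stalkMap_stalkCompIso (G : B ⥤ B') (hG : PreservesFilteredColimits G)
    {X Y : PresheafedSpace.{_, _, v} B} (φ : X ⟶ Y) (x : X) :
    (G.mapPresheaf.map φ).stalkMap x ≫ (stalkCompIso G hG X.presheaf x).hom =
      (stalkCompIso G hG Y.presheaf (φ.base x)).hom ≫ G.map (φ.stalkMap x) := by
  refine TopCat.Presheaf.stalk_hom_ext _ fun V hV ↦ ?_
  have h₁ := PresheafedSpace.stalkMap_germ_assoc (G.mapPresheaf.map φ) V x hV
    (stalkCompIso G hG X.presheaf x).hom
  have h₂ := germ_stalkCompIso G hG X.presheaf ((Opens.map φ.base).obj V) x hV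
  have h₃ := congrArg (· ≫ G.map (φ.stalkMap x))
    (germ_stalkCompIso G hG Y.presheaf V (φ.base x) hV)
  have h₄ := congrArg G.map (PresheafedSpace.stalkMap_germ φ V x hV)
  rw [Functor.map_comp, Functor.map_comp] at h₄
  exact h₁.trans ((congrArg (G.map (φ.c.app (op V)) ≫ ·) h₂).trans
    (h₄.symm.trans (h₃.symm.trans (Category.assoc _ _ _))))

variable {U : A ⥤ B} {U' : A' ⥤ B'}

/-- The functor between categories of structured spaces which postcomposes the sheaves with `G`
and applies `F` to the objects `A_x`; the stalk at `x` is `G` of the former stalk, identified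
with `G(U(A_x))`, hence with `U'(F(A_x))` through `θ`. -/
def pushU (s : Square U U') (hG : s.G.IsRightAdjoint) (hG' : PreservesFilteredColimits s.G) :
    USpace U ⥤ USpace U' where
  obj S :=
    { toSheafedSpace := pushSpace s.G hG S.toSheafedSpace
      loc := fun x ↦ s.F.obj (S.loc x)
      stalkIso := fun x ↦ stalkCompIso s.G hG' S.presheaf x ≪≫
        s.G.mapIso (S.stalkIso x) ≪≫ s.θ.app (S.loc x) }
  map {S T} f :=
    { toHom := InducedCategory.homMk (s.G.mapPresheaf.map f.toHom.hom)
      loc := fun x ↦ s.F.map (f.loc x)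
      comm := fun x ↦ by
        have h := congrArg s.G.map (f.comm x)
        rw [Functor.map_comp, Functor.map_comp] at h
        exact push_aux (stalkMap_stalkCompIso s.G hG' f.toHom.hom x) h
          (s.θ.hom.naturality (f.loc x)) }
  map_id S := USpace.Hom.ext (InducedCategory.hom_ext
      (s.G.mapPresheaf.map_id S.toPresheafedSpace))
    (heq_of_eq (funext fun _ ↦ s.F.map_id _))
  map_comp f g := USpace.Hom.ext (InducedCategory.hom_ext
      (s.G.mapPresheaf.map_comp g.toHom.hom f.toHom.hom))
    (heq_of_eq (funext fun _ ↦ s.F.map_comp _ _))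

lemma stalkMap_pushBHom {G G' : B ⥤ B'} (hG : PreservesFilteredColimits G)
    (hG' : PreservesFilteredColimits G') (β : G ⟶ G') (X : PresheafedSpace.{_, _, v} B) (x : X) :
    (pushBHom β X).stalkMap x ≫ (stalkCompIso G' hG' X.presheaf x).hom =
      (stalkCompIso G hG X.presheaf x).hom ≫ β.app (X.presheaf.stalk x) := by
  refine TopCat.Presheaf.stalk_hom_ext _ fun V hV ↦ ?_
  have h₁ := PresheafedSpace.stalkMap_germ_assoc (pushBHom β X) V x hV
    (stalkCompIso G' hG' X.presheaf x).hom
  have h₂ := germ_stalkCompIso G' hG' X.presheaf V x hV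
  have h₃ := congrArg (· ≫ β.app (X.presheaf.stalk x)) (germ_stalkCompIso G hG X.presheaf V x hV)
  have h₄ := β.naturality (X.presheaf.germ V x hV)
  exact h₁.trans ((congrArg (β.app (X.presheaf.obj (op V)) ≫ ·) h₂).trans
    (h₄.symm.trans (h₃.symm.trans (Category.assoc _ _ _))))

/-- The action of a 2-cell on categories of structured spaces. -/
def pushUTrans {s t : Square U U'} (hs : s.G.IsRightAdjoint) (hs' : PreservesFilteredColimits s.G)
    (ht : t.G.IsRightAdjoint) (ht' : PreservesFilteredColimits t.G) (η : Square.Hom s t) :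
    pushU s hs hs' ⟶ pushU t ht ht' where
  app S :=
    { toHom := InducedCategory.homMk (pushBHom η.β S.toPresheafedSpace)
      loc := fun x ↦ η.α.app (S.loc x)
      comm := fun x ↦ push_aux (stalkMap_pushBHom hs' ht' η.β S.toPresheafedSpace x)
        (η.β.naturality (S.stalkIso x).hom).symm (η.w (S.loc x)).symm }
  naturality _ _ f := USpace.Hom.ext
    (InducedCategory.hom_ext (pushBHom_naturality η.β f.toHom.hom))
    (heq_of_eq (funext fun x ↦ η.α.naturality (f.loc x)))

/-- The square formed by the two postcomposition functors; it commutes strictly. -/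
def pushSquare (s : Square U U') (hG : s.G.IsRightAdjoint)
    (hG' : PreservesFilteredColimits s.G) : Square (USpace.ι U) (USpace.ι U') where
  F := pushU s hG hG'
  G := pushB s.G hG
  θ := NatIso.ofComponents (fun _ ↦ Iso.refl _)
    (fun _ ↦ (Category.comp_id _).trans (Category.id_comp _).symm)

end Postcomposition

/-! ### The spectrum of a `B`-space -/

section Spectrum

variable {A : Type u₁} [Category.{v} A] {B : Type u₂} [Category.{v} B]

lemma isFinitelyPresentable_initial [HasInitial B] : IsFinitelyPresentable.{v} (⊥_ B) := by
  have : Fact Cardinal.aleph0.{v}.IsRegular := Cardinal.fact_isRegular_aleph0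
  have : IsEmpty (Arrow (Discrete PEmpty.{1})) := ⟨fun f ↦ f.left.as.elim⟩
  have (k : Discrete PEmpty.{1}) :
      IsCardinalPresentable ((Functor.empty.{0} B).obj k) Cardinal.aleph0.{v} := k.as.elim
  exact isCardinalPresentable_of_isColimit _ initialIsInitial Cardinal.aleph0.{v}
    ((hasCardinalLT_aleph0_iff _).2 inferInstance)

lemma finDiag_id (U : A ⥤ B) [HasInitial B] (b : B) : FinDiag U (𝟙 b) := by
  refine ⟨⊥_ B, ⊥_ B, 𝟙 _, initial.to b, initial.to b, isFinitelyPresentable_initial,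
    isFinitelyPresentable_initial, ?_, IsPushout.of_vert_isIso
      ⟨by rw [Category.id_comp, Category.comp_id]⟩⟩
  intro a a' u f g w
  exact ⟨f, ⟨Category.id_comp f, w.trans (Category.id_comp g)⟩,
    fun d hd ↦ (Category.id_comp d).symm.trans hd.1⟩

variable (U : A ⥤ B) (X : SheafedSpace.{u₂, v, v} B)

/-- The indices `(V, n)` of the basic open sets: an open set `V` of `X` and an object `n` of `𝒟_b`
for `b` the value of the sheaf at `V`. -/
structure BasicOpen where
  /-- the open set -/
  V : Opens X.carrier
  /-- the diagonally universal morphism of finite presentation -/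
  n : Under (X.presheaf.obj (op V))
  finDiag : FinDiag U n.hom

namespace BasicOpen

variable {U X}

/-- Morphisms `(V, n) ⟶ (V', n')`: an inclusion `V' ⊆ V` with a morphism between the codomains
of `n` and `n'` compatible with the restriction. -/
@[ext]
structure Hom (a b : BasicOpen U X) where
  le : b.V ≤ a.V
  /-- the morphism between the codomains -/
  hom : a.n.right ⟶ b.n.right
  w : a.n.hom ≫ hom = X.presheaf.map (homOfLE le).op ≫ b.n.hom

instance : Category (BasicOpen U X) where
  Hom := Hom
  id a :=
    { le := le_rfl
      hom := 𝟙 _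
      w := (Category.comp_id _).trans ((congrArg (· ≫ a.n.hom)
        (X.presheaf.map_id (op a.V))).trans (Category.id_comp _)).symm }
  comp f g :=
    { le := g.le.trans f.le
      hom := f.hom ≫ g.hom
      w := hom_comp_aux (X.presheaf.map_comp (homOfLE f.le).op (homOfLE g.le).op) f.w g.w }
  id_comp _ := Hom.ext (Category.id_comp _)
  comp_id _ := Hom.ext (Category.comp_id _)
  assoc _ _ _ := Hom.ext (Category.assoc _ _ _)

variable (U X)

/-- The functor sending `(V, n)` to the codomain of `n`. -/
def cod : BasicOpen U X ⥤ B where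
  obj a := a.n.right
  map f := f.hom

/-- The index `(V, 𝟙)`. -/
def ofOpens [HasInitial B] (V : Opens X.carrier) : BasicOpen U X where
  V := V
  n := Under.mk (𝟙 (X.presheaf.obj (op V)))
  finDiag := finDiag_id U _

/-- The morphism `(V, 𝟙) ⟶ (V', 𝟙)` given by the restriction, for `V' ⊆ V`. -/
def ofOpensHom [HasInitial B] {V V' : Opens X.carrier} (h : V' ≤ V) :
    ofOpens U X V ⟶ ofOpens U X V' where
  le := h
  hom := X.presheaf.map (homOfLE h).op
  w := (Category.id_comp _).trans (Category.comp_id _).symm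

end BasicOpen

variable {U} [HasColimits B] (hU : IsRightMultiAdjoint U)

/-- The points of the Diers space: pairs of a point `x` of `X` and a local unit under the
stalk at `x`. -/
def DiersPoint : Type v := Σ x : X.carrier, LocalUnits hU (X.presheaf.stalk x)

variable {X} in
/-- The local unit of a point of the Diers space. -/
def DiersPoint.localUnit {hU : IsRightMultiAdjoint U} (p : DiersPoint X hU) :
    StructuredArrow (X.presheaf.stalk p.1) U :=
  SpectralDualities.localUnit hU (X.presheaf.stalk p.1) p.2

variable {X} in
/-- The set `D_(V,n)` of the points `(x, ξ)` such that `x ∈ V` and `ξ` factorizes through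
the pushout of `n` along the germ morphism at `x`. -/
def BasicOpen.points (a : BasicOpen U X) : Set (DiersPoint X hU) :=
  {p | ∃ (hx : p.1 ∈ a.V) (m : a.n.right ⟶ U.obj p.localUnit.right),
    a.n.hom ≫ m = X.presheaf.germ a.V p.1 hx ≫ p.localUnit.hom}

instance : TopologicalSpace (DiersPoint X hU) :=
  TopologicalSpace.generateFrom (Set.range (BasicOpen.points hU))

/-- The Diers space. -/
def diersSpace : TopCat.{v} := TopCat.of (DiersPoint X hU)

variable {X} in
/-- `D_(V,n)` as an open set. -/
def BasicOpen.opens (a : BasicOpen U X) : Opens (diersSpace X hU) :=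
  ⟨a.points hU, TopologicalSpace.isOpen_generateFrom_of_mem (Set.mem_range_self a)⟩

lemma BasicOpen.opens_le {a b : BasicOpen U X} (f : BasicOpen.Hom a b) :
    b.opens hU ≤ a.opens hU := by
  rintro p ⟨hx, m, hm⟩
  exact ⟨f.le hx, f.hom ≫ m,
    opens_aux (X.presheaf.germ_res (homOfLE f.le) p.1 hx) f.w hm⟩

/-- The functor sending `(V, n)` to the open set `D_(V,n)`. -/
def BasicOpen.D : BasicOpen U X ⥤ (Opens (diersSpace X hU))ᵒᵖ where
  obj a := op (a.opens hU)
  map f := (homOfLE (BasicOpen.opens_le X hU f)).op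

lemma mem_ofOpens {V : Opens X.carrier} {p : DiersPoint X hU} (h : p.1 ∈ V) :
    p ∈ (BasicOpen.ofOpens U X V).points hU :=
  ⟨h, X.presheaf.germ V p.1 h ≫ p.localUnit.hom, Category.id_comp _⟩

/-- The projection of the Diers space to `X`. -/
def diersProj : diersSpace X hU ⟶ X.carrier :=
  TopCat.ofHom
    { toFun := fun p : DiersPoint X hU ↦ p.1
      continuous_toFun := ⟨fun V hV ↦ by
        have h : (fun p : DiersPoint X hU ↦ p.1) ⁻¹' V =
            (BasicOpen.ofOpens U X ⟨V, hV⟩).points hU :=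
          Set.ext fun p ↦ ⟨fun hp ↦ mem_ofOpens X hU hp, fun hp ↦ hp.1⟩
        rw [h]
        exact TopologicalSpace.isOpen_generateFrom_of_mem (Set.mem_range_self _)⟩ }

/-- The data, unique up to isomorphism, of the spectrum of a `B`-space: the structural presheaf `P`
is a left Kan extension of the codomain functor along `D`, the structural sheaf `S` is the
sheafification of `P`, and the stalk of `S` at a point `(x, ξ)` is identified with the
codomain `U(A_ξ)` of `ξ`, compatibly with the factorizations of `ξ`. -/
structure SpectrumModel where
  /-- the structural presheaf -/
  P : (diersSpace X hU).Presheaf B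
  /-- the universal transformation of the left Kan extension -/
  ζ : BasicOpen.cod U X ⟶ BasicOpen.D X hU ⋙ P
  isLeftKanExtension : P.IsLeftKanExtension ζ
  /-- the structural sheaf -/
  S : (diersSpace X hU).Presheaf B
  isSheaf : S.IsSheaf
  /-- the sheafification morphism -/
  γ : P ⟶ S
  isSheafification : (Opens.grothendieckTopology (diersSpace X hU)).W γ
  /-- the identification of the stalks -/
  stalkIso : ∀ p : DiersPoint X hU,
    TopCat.Presheaf.stalk (X := diersSpace X hU) S p ≅ U.obj p.localUnit.right
  fac : ∀ (a : BasicOpen U X) (p : DiersPoint X hU) (hp : p ∈ a.points hU),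
    a.n.hom ≫ ζ.app a ≫ γ.app (op (a.opens hU)) ≫ TopCat.Presheaf.germ (X := diersSpace X hU)
      S (a.opens hU) p hp ≫ (stalkIso p).hom = X.presheaf.germ a.V p.1 hp.1 ≫ p.localUnit.hom

namespace SpectrumModel

variable {X hU} (M : SpectrumModel X hU)

/-- The underlying `U`-space of the spectrum. -/
def toUSpace : USpace U where
  carrier := diersSpace X hU
  presheaf := M.S
  IsSheaf := M.isSheaf
  loc := fun p : DiersPoint X hU ↦ p.localUnit.right
  stalkIso := M.stalkIso

/-- The component at `V` of the comorphism of the unit. -/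
def unitApp (V : Opens X.carrier) :
    X.presheaf.obj (op V) ⟶ M.S.obj (op ((Opens.map (diersProj X hU)).obj V)) :=
  M.ζ.app (BasicOpen.ofOpens U X V) ≫
    M.P.map (homOfLE fun p hp ↦ mem_ofOpens X hU (p := p) hp :
      (Opens.map (diersProj X hU)).obj V ⟶ (BasicOpen.ofOpens U X V).opens hU).op ≫
    M.γ.app _

/-- The unit of the spectrum: the continuous map is the projection `(x, ξ) ↦ x`, and
the morphism of sheaves at `V` is the universal morphism associated with `(V, 𝟙)`. -/
def unit : (op X : BSpace B) ⟶ (USpace.ι U).obj M.toUSpace :=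
  (InducedCategory.homMk (C := SheafedSpace B)
    { base := diersProj X hU
      c :=
        { app := fun V ↦ M.unitApp V.unop
          naturality := fun _ _ i ↦ push_aux
            (M.ζ.naturality (BasicOpen.ofOpensHom U X (leOfHom i.unop)))
            ((M.P.map_comp _ _).symm.trans ((congrArg M.P.map (Subsingleton.elim _ _)).trans
              (M.P.map_comp _ _)))
            (M.γ.naturality ((Opens.map (diersProj X hU)).map i.unop).op) } } :
    M.toUSpace.toSheafedSpace ⟶ X).op

end SpectrumModel

end Spectrum

/-! ### The 2-functor -/

instance (C : DiersContext.{v, u₁, u₂}) : HasColimits C.ℬ := C.lfp.toHasColimitsOfSize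

/-- The structure of a spectral duality on the forgetful functor from the `U`-spaces to the
`B`-spaces. -/
abbrev SpecDuality (C : DiersContext.{v, u₁, u₂}) : Type (max (v + 1) u₁ u₂) :=
  DualityStructure (USpace.proj C.U) (BSpace.proj C.ℬ) (USpace.ι C.U)

/-- The functors induced by a morphism of Diers contexts are morphisms of fibrations. -/
def PushIsFibMorphism {C E : DiersContext.{v, u₁, u₂}} (f : C ⟶ E) : Prop :=
  IsFibMorphism (USpace.proj C.U) (USpace.proj E.U)
      (pushU f.toSquare f.isRightAdjoint f.finitary) ∧
    IsFibMorphism (BSpace.proj C.ℬ) (BSpace.proj E.ℬ) (pushB f.G f.isRightAdjoint)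

/-- The action of the spectral construction on 0-cells, 1-cells and 2-cells: a Diers context is sent
to the adjunction between the categories of `U`-spaces and of `B`-spaces, a morphism `(F, G, θ)` to
the functors which postcompose the sheaves with `G` (and apply `F` to the local objects), and
a 2-cell `(α, β)` to the transformations with components `β` on the sheaves and `α` on the
local objects. -/
def specData (D : ∀ C : DiersContext.{v, u₁, u₂}, SpecDuality C)
    (H : ∀ {C E : DiersContext.{v, u₁, u₂}} (f : C ⟶ E), PushIsFibMorphism f) :
    PrelaxFunctorStruct DiersContext.{v, u₁, u₂}
      SpectralDuality.{v, max (v + 1) u₁ u₂, max (v + 1) u₂} where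
  obj C :=
    { 𝔄 := USpace C.U
      𝔅 := BSpace C.ℬ
      p := USpace.proj C.U
      q := BSpace.proj C.ℬ
      ι := USpace.ι C.U
      str := D C }
  map f :=
    { pushSquare f.toSquare f.isRightAdjoint f.finitary with
      isFibMorphism_F := (H f).1
      isFibMorphism_G := (H f).2 }
  map₂ {_ _ f g} η :=
    ({ α := pushUTrans f.isRightAdjoint f.finitary g.isRightAdjoint g.finitary η
       β := pushBTrans f.isRightAdjoint g.isRightAdjoint (Square.Hom.β η)
       w := fun _ ↦ (Category.id_comp _).trans (Category.comp_id _).symm } :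
      Square.Hom (pushSquare f.toSquare f.isRightAdjoint f.finitary)
        (pushSquare g.toSquare g.isRightAdjoint g.finitary))

end SpectralDualities

end

open SpectralDualities

/-!
Every Diers context has a spectrum functor, left adjoint to the forgetful functor from `U`-spaces
to `B`-spaces, and postcomposition of sheaves makes this construction strictly 2-functorial.

**Sheaves.** Everything about sheaves with values in a locally finitely presentable category `B`
reduces to sheaves of sets by means of the functors represented by the finitely presentable
objects, which jointly reflect isomorphisms and limits and commute with filtered colimits. So `B`
is complete, sheafification exists (`hasWeakSheafify_of_isLocallyFinitelyPresentable`), sections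
are determined by their germs and can be glued from their germs (`hom_ext_of_germ_eq`,
`exists_hom_germ_eq`), and isomorphisms of sheaves are detected on stalks
(`isIso_of_isIso_stalk`). Morphisms out of a stalk are transformations to a skyscraper sheaf, so
universal properties of sheaves determine stalks without any appeal to their construction.

**Fibrations.** The cartesian lifts of `B`-spaces are inverse images and the cocartesian ones
direct images. A morphism of `B`-spaces is cartesian if and only if it induces isomorphisms on the
stalks, and a morphism of `U`-spaces if and only if moreover it induces isomorphisms on the local
objects (`isInverseImage_of_isIso_stalkMap`, `USpace.existsUnique`). Hence the forgetful functor
preserves cartesian arrows, and so does postcomposition with a functor `G` preserving filtered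
colimits, which commutes with stalks (`pushIsFibMorphism`).

**Existence of the spectrum.** The stalk at `(x, ξ)` of the sheafified Kan extension is the
colimit of the `cod n` over the `(V, n)` such that `(x, ξ)` belongs to `D_(V,n)`
(`existsUnique_stalk_desc`). This colimit is `U(A_ξ)` (`BasicOpen.existsUnique_desc`). Indeed `ξ`
is the colimit of the `n ≤ ξ` in `𝒟_b`, for `b` the stalk of the given sheaf at `x`. By finite
presentability, each such `n` is the pushout of a morphism defined under the sections over a
neighbourhood of `x`, and so are the morphisms between them.

**Universal property.** Let `φ` be a morphism from the `B`-space `X` to the underlying `B`-space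
of a `U`-space `T`. At each point `y` of `T`, the morphism from the stalk of `X` to the local
object `U(T_y)` factorizes through a unique local unit. This gives the map on points, and the
factors `u_y`. The factorization through `(V, n)` is an open condition on `y`, by finite
presentability, which proves continuity. The factorizations, being unique
(`DiersCondition.fac_unique`), glue to sections (`BasicOpen.exists_glued_section`), which define
the morphism of sheaves by the universal properties of the Kan extension and of the sheafification
(`SpectrumModel.existsUnique_hom`).

**Strictness.** The composite of the functors attached to two 1-cells has the same underlying
spaces and local objects as the functor attached to the composite, and the stalk isomorphisms are
equal because both are determined on germs (`stalkIso_pushU_comp`). Therefore the functors are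
equal, and all the coherence 2-cells are identities (`specPreCore`).
-/

namespace SpectralDualities

noncomputable section

/-! ### Locally finitely presentable categories -/

section FinitelyPresentable

attribute [local instance] Cardinal.fact_isRegular_aleph0

variable {B : Type u₂} [Category.{v} B] [IsLocallyFinitelyPresentable.{v} B]

variable (B) in
lemma isStrongGenerator_isFinitelyPresentable :
    (ObjectProperty.isFinitelyPresentable.{v} B).IsStrongGenerator :=
  (isCardinalFilteredGenerator_isCardinalPresentable B Cardinal.aleph0.{v}).isStrongGenerator

lemma hom_ext_of_finitelyPresentable {X Y : B} {f g : X ⟶ Y}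
    (h : ∀ (k : B) (_ : IsFinitelyPresentable.{v} k) (p : k ⟶ X), p ≫ f = p ≫ g) : f = g :=
  (isStrongGenerator_isFinitelyPresentable B).isSeparating _ _ h

lemma isIso_of_finitelyPresentable {X Y : B} (f : X ⟶ Y)
    (h : ∀ (k : B) (_ : IsFinitelyPresentable.{v} k),
      Function.Bijective (fun p : k ⟶ X ↦ p ≫ f)) : IsIso f := by
  have : Mono f := ⟨fun {Z} a b hab ↦ hom_ext_of_finitelyPresentable fun k hk p ↦
    (h k hk).1 (by simp only [Category.assoc, hab])⟩
  exact (isStrongGenerator_isFinitelyPresentable B).isIso_of_mono f fun k hk ↦ (h k hk).2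

variable (B) in
/-- A locally finitely presentable category is reflective in the presheaves on a small model of its
finitely presentable objects, hence complete. -/
lemma hasLimits_of_isLocallyFinitelyPresentable : HasLimits B := by
  have : EssentiallySmall.{v} (ObjectProperty.isFinitelyPresentable.{v} B).FullSubcategory :=
    inferInstance
  let F : SmallModel.{v} (ObjectProperty.isFinitelyPresentable.{v} B).FullSubcategory ⥤ B :=
    (equivSmallModel _).inverse ⋙ (ObjectProperty.isFinitelyPresentable.{v} B).ι
  have : F.IsDense := inferInstance
  let L := (uliftYoneda.{v}).leftKanExtension F
  have adj : L ⊣ Presheaf.restrictedULiftYoneda.{v} F :=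
    Presheaf.uliftYonedaAdjunction.{v} L ((uliftYoneda.{v}).leftKanExtensionUnit F)
  let _ : Reflective (Presheaf.restrictedULiftYoneda.{v} F) := { L := L, adj := adj }
  exact hasLimits_of_reflective (Presheaf.restrictedULiftYoneda.{v} F)

end FinitelyPresentable

/-! ### Sheaves with values in a locally finitely presentable category -/

section Sheafification

variable {B : Type u₂} [Category.{v} B] [IsLocallyFinitelyPresentable.{v} B]

/-- A cone in a locally finitely presentable category is a limit as soon as its images under the
functors represented by finitely presentable objects are. -/
lemma nonempty_isLimit_of_finitelyPresentable {D : Type v} [SmallCategory D] {K : D ⥤ B}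
    (c : Cone K) (h : ∀ (k : B) (_ : IsFinitelyPresentable.{v} k),
      Nonempty (IsLimit ((coyoneda.obj (op k)).mapCone c))) : Nonempty (IsLimit c) := by
  have := hasLimits_of_isLocallyFinitelyPresentable B
  have : IsIso ((limit.isLimit K).lift c) := isIso_of_finitelyPresentable _ fun k hk ↦ by
    obtain ⟨h₁⟩ := h k hk
    have h₂ := isLimitOfPreserves (coyoneda.obj (op k)) (limit.isLimit K)
    have e : (coyoneda.obj (op k)).map ((limit.isLimit K).lift c) =
        (h₁.conePointUniqueUpToIso h₂).hom := h₂.hom_ext fun j ↦ by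
      rw [IsLimit.conePointUniqueUpToIso_hom_comp]
      simp only [Functor.mapCone_π_app, ← Functor.map_comp, IsLimit.fac]
    have : IsIso ((coyoneda.obj (op k)).map ((limit.isLimit K).lift c)) := by
      rw [e]; infer_instance
    exact (isIso_iff_bijective _).1 this
  exact ⟨IsLimit.ofPointIso (limit.isLimit K)⟩

/-- The sheaf condition can be tested on the presheaves of sets of morphisms from finitely
presentable objects. -/
lemma isSheaf_of_finitelyPresentable {C : Type v} [SmallCategory C] (J : GrothendieckTopology C)
    (P : Cᵒᵖ ⥤ B)
    (h : ∀ (k : B) (_ : IsFinitelyPresentable.{v} k),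
      Presheaf.IsSheaf J (P ⋙ coyoneda.obj (op k))) : Presheaf.IsSheaf J P := by
  rw [Presheaf.isSheaf_iff_multifork]
  intro X S
  refine nonempty_isLimit_of_finitelyPresentable _ fun k hk ↦ ?_
  obtain ⟨h₁⟩ := (Presheaf.isSheaf_iff_multifork J _).1 (h k hk) X S
  exact ⟨IsLimit.ofIsoLimit ((IsLimit.postcomposeHomEquiv (S.multicospanComp _ P) _).symm h₁)
    (S.mapMultifork _ P).symm⟩

/-- The plus construction yields a sheaf although `B` is not a concrete category: finitely
presentable objects represent functors which commute with limits and with the filtered colimits in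
the construction, so this reduces to presheaves of sets. -/
lemma isSheaf_sheafify {C : Type v} [SmallCategory C] (J : GrothendieckTopology C)
    (P : Cᵒᵖ ⥤ B) :
    haveI := hasLimits_of_isLocallyFinitelyPresentable B
    Presheaf.IsSheaf J (J.sheafify P) := by
  have := hasLimits_of_isLocallyFinitelyPresentable B
  refine isSheaf_of_finitelyPresentable J _ fun k hk ↦ ?_
  refine (Presheaf.isSheaf_of_iso_iff (J.sheafifyCompIso (coyoneda.obj (op k)) P)).2 ?_
  exact J.sheafify_isSheaf _

variable (B) in
lemma hasWeakSheafify_of_isLocallyFinitelyPresentable {C : Type v} [SmallCategory C]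
    (J : GrothendieckTopology C) : HasWeakSheafify J B := by
  have := hasLimits_of_isLocallyFinitelyPresentable B
  let G : (Cᵒᵖ ⥤ B) ⥤ Sheaf J B :=
    { obj := fun P ↦ ⟨J.sheafify P, isSheaf_sheafify J P⟩
      map := fun η ↦ ⟨J.sheafifyMap η⟩ }
  have adj : G ⊣ sheafToPresheaf J B := Adjunction.mkOfHomEquiv
    { homEquiv := fun P Q ↦
        { toFun := fun e ↦ J.toSheafify P ≫ e.hom
          invFun := fun e ↦ ⟨J.sheafifyLift e Q.2⟩
          left_inv := fun _ ↦ Sheaf.hom_ext <| (J.sheafifyLift_unique _ _ _ rfl).symm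
          right_inv := fun _ ↦ J.toSheafify_sheafifyLift _ _ }
      homEquiv_naturality_left_symm := fun η γ ↦
        Sheaf.hom_ext (J.sheafifyMap_sheafifyLift η γ _).symm
      homEquiv_naturality_right := fun f g ↦ (Category.assoc (J.toSheafify _) f.hom g.hom).symm }
  exact adj.isRightAdjoint

end Sheafification

/-! ### Germs and sections -/

section Germs

open TopCat

variable {B : Type u₂} [Category.{v} B] {X : TopCat.{v}}

/-- Morphisms to the sections of a sheaf over `W` which agree after restriction to a neighbourhood
of each point of `W` are equal. -/
lemma hom_ext_of_locally_eq {P : X.Presheaf B} (hP : P.IsSheaf) {E : B} {W : Opens X}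
    {s t : E ⟶ P.obj (op W)}
    (h : ∀ x ∈ W, ∃ (V : Opens X) (hVW : V ≤ W) (_ : x ∈ V),
      s ≫ P.map (homOfLE hVW).op = t ≫ P.map (homOfLE hVW).op) : s = t := by
  choose V hVW hxV hV using fun x : W ↦ h x.1 x.2
  let F : TopCat.Sheaf (Type v) X :=
    ⟨P ⋙ coyoneda.obj (op E), (isSheaf_iff_isSheaf_of_type _ _).2 (hP E)⟩
  exact F.eq_of_locally_eq' V W (fun x ↦ homOfLE (hVW x))
    (fun x hx ↦ Opens.mem_iSup.2 ⟨⟨x, hx⟩, hxV ⟨x, hx⟩⟩) s t hV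

variable [HasColimits B]

/-- A morphism from a finitely presentable object to a stalk, which is a filtered colimit,
comes from sections. -/
lemma exists_germ_eq_of_finitelyPresentable (P : X.Presheaf B) {k : B}
    (hk : IsFinitelyPresentable.{v} k) {x : X} (f : k ⟶ P.stalk x) (W : Opens X) (hx : x ∈ W) :
    ∃ (V : Opens X) (_ : V ≤ W) (hV : x ∈ V) (g : k ⟶ P.obj (op V)), g ≫ P.germ V x hV = f := by
  obtain ⟨V, hV, g, hg⟩ : ∃ (V : Opens X) (hV : x ∈ V) (g : k ⟶ P.obj (op V)),
      g ≫ P.germ V x hV = f :=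
    have ⟨V, g, hg⟩ := IsFinitelyPresentable.exists_hom_of_isColimit
      (colimit.isColimit ((OpenNhds.inclusion x).op ⋙ P)) f
    ⟨V.unop.1, V.unop.2, g, hg⟩
  have hVW : x ∈ V ⊓ W := ⟨hV, hx⟩
  exact ⟨V ⊓ W, inf_le_right, hVW, g ≫ P.map (homOfLE (inf_le_left : V ⊓ W ≤ V)).op, by
    rw [Category.assoc, P.germ_res, hg]⟩

/-- Morphisms from a finitely presentable object to sections which agree at a stalk agree on
a neighbourhood. -/
lemma exists_res_eq_of_finitelyPresentable (P : X.Presheaf B) {k : B}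
    (hk : IsFinitelyPresentable.{v} k) {x : X} {W : Opens X} (hx : x ∈ W)
    (f g : k ⟶ P.obj (op W)) (h : f ≫ P.germ W x hx = g ≫ P.germ W x hx) :
    ∃ (V : Opens X) (hVW : V ≤ W) (_ : x ∈ V),
      f ≫ P.map (homOfLE hVW).op = g ≫ P.map (homOfLE hVW).op := by
  obtain ⟨V, i, j, hij⟩ := IsFinitelyPresentable.exists_eq_of_isColimit
    (colimit.isColimit ((OpenNhds.inclusion x).op ⋙ P)) (i := op ⟨W, hx⟩) (j := op ⟨W, hx⟩) f g h
  obtain rfl : i = j := Subsingleton.elim _ _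
  exact ⟨V.unop.1, leOfHom i.unop, V.unop.2, hij⟩

/-- Morphisms from `E` to the stalks of a sheaf at the points of `W` which locally come from
sections come from a section over `W`, provided sections are determined by their germs. -/
lemma exists_hom_germ_eq {P : X.Presheaf B} (hP : P.IsSheaf) {E : B} {W : Opens X}
    (hsep : ∀ (V : Opens X) (s t : E ⟶ P.obj (op V)),
      (∀ (x : X) (hx : x ∈ V), s ≫ P.germ V x hx = t ≫ P.germ V x hx) → s = t)
    (τ : ∀ x ∈ W, (E ⟶ P.stalk x))
    (h : ∀ x ∈ W, ∃ (V : Opens X) (hVW : V ≤ W) (_ : x ∈ V) (s : E ⟶ P.obj (op V)),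
      ∀ (y : X) (hy : y ∈ V), s ≫ P.germ V y hy = τ y (hVW hy)) :
    ∃ s : E ⟶ P.obj (op W), ∀ (x : X) (hx : x ∈ W), s ≫ P.germ W x hx = τ x hx := by
  choose V hVW hxV s hs using fun x : W ↦ h x.1 x.2
  let F : TopCat.Sheaf (Type v) X :=
    ⟨P ⋙ coyoneda.obj (op E), (isSheaf_iff_isSheaf_of_type _ _).2 (hP E)⟩
  obtain ⟨t, ht, -⟩ := F.existsUnique_gluing' V W (fun x ↦ homOfLE (hVW x))
    (fun x hx ↦ Opens.mem_iSup.2 ⟨⟨x, hx⟩, hxV ⟨x, hx⟩⟩) s (fun x y ↦ by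
      refine hsep _ _ _ fun z hz ↦ ?_
      change (s x ≫ P.map _) ≫ _ = (s y ≫ P.map _) ≫ _
      rw [Category.assoc, Category.assoc, P.germ_res, P.germ_res]
      exact (hs x z hz.1).trans (hs y z hz.2).symm)
  refine ⟨t, fun x hx ↦ ?_⟩
  have h₁ : t ≫ P.map (homOfLE (hVW ⟨x, hx⟩)).op = s ⟨x, hx⟩ := ht ⟨x, hx⟩
  rw [← hs ⟨x, hx⟩ x (hxV ⟨x, hx⟩), ← h₁, Category.assoc, P.germ_res]

end Germs

section Sections

open TopCat

variable {B : Type u₂} [Category.{v} B] [IsLocallyFinitelyPresentable.{v} B] {X : TopCat.{v}}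

/-- Sections of a sheaf with values in a locally finitely presentable category are determined
by their germs. -/
lemma hom_ext_of_germ_eq {P : X.Presheaf B} (hP : P.IsSheaf) {E : B} {W : Opens X}
    {s t : E ⟶ P.obj (op W)}
    (h : ∀ (x : X) (hx : x ∈ W), s ≫ P.germ W x hx = t ≫ P.germ W x hx) : s = t :=
  hom_ext_of_finitelyPresentable fun k hk p ↦ hom_ext_of_locally_eq hP fun x hx ↦
    exists_res_eq_of_finitelyPresentable P hk hx _ _ (by
      rw [Category.assoc, Category.assoc, h x hx])

/-- A morphism of sheaves which induces isomorphisms on the stalks is an isomorphism. It suffices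
to see that it induces bijections on the morphisms from a finitely presentable object to the
sections, where the argument is that for sheaves of sets. -/
lemma isIso_of_isIso_stalk {P Q : X.Presheaf B} (hP : P.IsSheaf) (hQ : Q.IsSheaf) (φ : P ⟶ Q)
    (σ : ∀ x : X, P.stalk x ⟶ Q.stalk x)
    (hσ : ∀ (V : Opens X) (x : X) (hx : x ∈ V), P.germ V x hx ≫ σ x = φ.app (op V) ≫ Q.germ V x hx)
    (h : ∀ x : X, IsIso (σ x)) : IsIso φ := by
  have (W : (Opens X)ᵒᵖ) : IsIso (φ.app W) := by
    induction W using Opposite.rec with | _ W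
    have inj (k : B) (V : Opens X) : Function.Injective
        (fun p : k ⟶ P.obj (op V) ↦ p ≫ φ.app (op V)) := fun s t hst ↦
      hom_ext_of_germ_eq hP fun x hx ↦ by
        have hst : s ≫ φ.app (op V) = t ≫ φ.app (op V) := hst
        rw [← cancel_mono (σ x), Category.assoc, Category.assoc, hσ, reassoc_of% hst]
    refine isIso_of_finitelyPresentable _ fun k hk ↦ ⟨inj k W, fun t ↦ ?_⟩
    -- `t` is glued from lifts, defined locally, of its images in the stalks of `P`
    obtain ⟨s, hs⟩ := exists_hom_germ_eq hP (W := W) (fun V s t ↦ hom_ext_of_germ_eq hP)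
      (fun x hx ↦ t ≫ Q.germ W x hx ≫ inv (σ x)) (fun x hx ↦ by
        obtain ⟨V, hVW, hV, g, hg⟩ := exists_germ_eq_of_finitelyPresentable P hk
          (t ≫ Q.germ W x hx ≫ inv (σ x)) W hx
        obtain ⟨V', hV'V, hV', e⟩ := exists_res_eq_of_finitelyPresentable Q hk hV
          (g ≫ φ.app (op V)) (t ≫ Q.map (homOfLE hVW).op) (by
            rw [Category.assoc, Category.assoc, ← hσ, reassoc_of% hg, IsIso.inv_hom_id,
              Category.comp_id, Q.germ_res])
        refine ⟨V', hV'V.trans hVW, hV', g ≫ P.map (homOfLE hV'V).op, fun y hy ↦ ?_⟩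
        have e' := e =≫ Q.germ V' y hy
        simp only [Category.assoc, Presheaf.germ_res, ← hσ] at e'
        rw [← cancel_mono (σ y)]
        simpa only [Category.assoc, Presheaf.germ_res, IsIso.inv_hom_id, Category.comp_id]
          using e')
    refine ⟨s, hom_ext_of_germ_eq hQ fun x hx ↦ ?_⟩
    have := hs x hx =≫ σ x
    simp only [Category.assoc, IsIso.inv_hom_id, Category.comp_id, hσ] at this
    simpa only [Category.assoc] using this
  exact NatIso.isIso_of_isIso_app φ

end Sections

/-! ### Skyscraper sheaves and stalks -/

section Skyscraper

open TopCat

variable {B : Type u₂} [Category.{v} B] [HasTerminal B] {X : TopCat.{v}} (p : X)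
  [∀ V : Opens X, Decidable (p ∈ V)] (e : B)

/-- The identification with `e` of the sections of the skyscraper sheaf over a neighbourhood
of `p`. -/
def skyπ (V : (Opens X)ᵒᵖ) (hV : p ∈ V.unop) : (skyscraperPresheaf p e).obj V ⟶ e :=
  eqToHom (if_pos hV)

instance (V : (Opens X)ᵒᵖ) (hV : p ∈ V.unop) : IsIso (skyπ p e V hV) :=
  inferInstanceAs (IsIso (eqToHom (if_pos hV : (if p ∈ V.unop then e else ⊤_ B) = e)))

lemma map_skyπ {V W : (Opens X)ᵒᵖ} (i : V ⟶ W) (hV : p ∈ V.unop) (hW : p ∈ W.unop) :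
    (skyscraperPresheaf p e).map i ≫ skyπ p e W hW = skyπ p e V hV :=
  (congrArg (· ≫ skyπ p e W hW) (dif_pos hW)).trans (eqToHom_trans _ _)

/-- The sections of the skyscraper sheaf over an open set avoiding `p` are terminal. -/
def skyTerminal {V : (Opens X)ᵒᵖ} (hV : p ∉ V.unop) :
    IsTerminal ((skyscraperPresheaf p e).obj V) :=
  (if_neg hV).symm.ndrec terminalIsTerminal

/-- The morphism to the sections of the skyscraper sheaf over `V` given by a morphism to `e` in case
`p` belongs to `V`. -/
def skySection (V : (Opens X)ᵒᵖ) {b : B} (t : p ∈ V.unop → (b ⟶ e)) :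
    b ⟶ (skyscraperPresheaf p e).obj V :=
  if hV : p ∈ V.unop then t hV ≫ inv (skyπ p e V hV)
  else (skyTerminal p e hV).from b

lemma skySection_π (V : (Opens X)ᵒᵖ) {b : B} (t : p ∈ V.unop → (b ⟶ e)) (hV : p ∈ V.unop) :
    skySection p e V t ≫ skyπ p e V hV = t hV := by
  rw [skySection, dif_pos hV, Category.assoc, IsIso.inv_hom_id, Category.comp_id]

variable {p e} {I : Type*} [Category* I] {F : I ⥤ B} {D : I ⥤ (Opens X)ᵒᵖ}

/-- Transformations to a skyscraper sheaf are determined by the components indexed by the `i` such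
that `p` belongs to `D i`, the other ones having terminal codomains. -/
lemma skyscraper_natTrans_ext {α β : F ⟶ D ⋙ skyscraperPresheaf p e}
    (h : ∀ (i : I) (hi : p ∈ (D.obj i).unop),
      α.app i ≫ skyπ p e (D.obj i) hi = β.app i ≫ skyπ p e (D.obj i) hi) : α = β := by
  ext i
  by_cases hi : p ∈ (D.obj i).unop
  · exact (cancel_mono (skyπ p e (D.obj i) hi)).1 (h i hi)
  · exact (skyTerminal p e hi).hom_ext _ _

/-- A transformation to a skyscraper sheaf at `p` is a compatible family of morphisms to its value
indexed by the `i` such that `p` belongs to `D i`. -/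
def skyscraperLift (t : ∀ (i : I), p ∈ (D.obj i).unop → (F.obj i ⟶ e))
    (ht : ∀ ⦃i j : I⦄ (f : i ⟶ j) (hi : p ∈ (D.obj i).unop) (hj : p ∈ (D.obj j).unop),
      F.map f ≫ t j hj = t i hi) : F ⟶ D ⋙ skyscraperPresheaf p e where
  app i := skySection p e (D.obj i) (t i)
  naturality i j f := by
    by_cases hj : p ∈ (D.obj j).unop
    · have hi : p ∈ (D.obj i).unop := leOfHom (D.map f).unop hj
      rw [← cancel_mono (skyπ p e (D.obj j) hj)]
      have h₁ := map_skyπ p e (D.map f) hi hj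
      have h₂ := skySection_π p e (D.obj i) (t i) hi
      have h₃ := skySection_π p e (D.obj j) (t j) hj
      exact (Category.assoc _ _ _).trans ((congrArg (F.map f ≫ ·) h₃).trans ((ht f hi hj).trans
        (h₂.symm.trans ((congrArg (skySection p e (D.obj i) (t i) ≫ ·) h₁).symm.trans
          (Category.assoc _ _ _).symm))))
    · exact (skyTerminal p e hj).hom_ext _ _

lemma skyscraperLift_app (t : ∀ (i : I), p ∈ (D.obj i).unop → (F.obj i ⟶ e))
    (ht : ∀ ⦃i j : I⦄ (f : i ⟶ j) (hi : p ∈ (D.obj i).unop) (hj : p ∈ (D.obj j).unop),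
      F.map f ≫ t j hj = t i hi) (i : I) (hi : p ∈ (D.obj i).unop) :
    (skyscraperLift t ht).app i ≫ skyπ p e (D.obj i) hi = t i hi :=
  skySection_π p e (D.obj i) (t i) hi

end Skyscraper

section StalkDesc

open TopCat

variable {B : Type u₂} [Category.{v} B] [HasColimits B]

lemma exists_stalk_desc {X : TopCat.{v}} (P : X.Presheaf B) (x : X) {e : B}
    (t : ∀ V : Opens X, x ∈ V → (P.obj (op V) ⟶ e))
    (ht : ∀ ⦃V W : Opens X⦄ (h : W ≤ V) (hV : x ∈ V) (hW : x ∈ W),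
      P.map (homOfLE h).op ≫ t W hW = t V hV) :
    ∃ d : P.stalk x ⟶ e, ∀ (V : Opens X) (hV : x ∈ V), P.germ V x hV ≫ d = t V hV :=
  ⟨colimit.desc ((OpenNhds.inclusion x).op ⋙ P) (Cocone.mk e
    { app := fun V ↦ t V.unop.1 V.unop.2
      naturality := fun V W i ↦ (ht (leOfHom i.unop) V.unop.2 W.unop.2).trans
        (Category.comp_id _).symm }),
    fun V hV ↦ colimit.ι_desc (F := (OpenNhds.inclusion x).op ⋙ P) _ (op ⟨V, hV⟩)⟩

variable [HasTerminal B]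

/-- A transformation `c : P ⟶ f_* Q` which is universal among those to direct images of sheaves
induces isomorphisms on the stalks: the stalks are tested on skyscraper sheaves. -/
lemma isIso_stalk_of_bijective {X Y : TopCat.{v}} (f : X ⟶ Y) {P : Y.Presheaf B}
    {Q : X.Presheaf B} (c : P ⟶ (Presheaf.pushforward B f).obj Q)
    (hc : ∀ (S : X.Presheaf B), S.IsSheaf → Function.Bijective
      (fun ψ : Q ⟶ S ↦ c ≫ (Presheaf.pushforward B f).map ψ))
    (x : X) (σ : P.stalk (f x) ⟶ Q.stalk x)
    (hσ : ∀ (V : Opens Y) (hV : f x ∈ V),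
      P.germ V (f x) hV ≫ σ = c.app (op V) ≫ Q.germ ((Opens.map f).obj V) x hV) : IsIso σ := by
  classical
  rw [isIso_iff_coyoneda_map_bijective]
  intro e
  have hS := hc (skyscraperPresheaf x e) (skyscraperPresheaf_isSheaf x e)
  constructor
  · intro u u' h
    have h : σ ≫ u = σ ≫ u' := h
    let T (u : Q.stalk x ⟶ e) : Q ⟶ 𝟭 _ ⋙ skyscraperPresheaf x e :=
      skyscraperLift (fun V hV ↦ Q.germ V.unop x hV ≫ u) (fun V W i hV hW ↦ by
        rw [← Category.assoc, Q.germ_res'])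
    have hT (u : Q.stalk x ⟶ e) (V : Opens X) (hV : x ∈ V) :
        (T u).app (op V) ≫ skyπ x e (op V) hV = Q.germ V x hV ≫ u :=
      skyscraperLift_app _ _ (op V) hV
    have : T u = T u' := hS.1 (by
      refine skyscraper_natTrans_ext (D := (Opens.map f).op) fun V hV ↦ ?_
      have hV : f x ∈ V.unop := hV
      have h₁ (u : Q.stalk x ⟶ e) : (c ≫ (Presheaf.pushforward B f).map (T u)).app V ≫
          skyπ x e ((Opens.map f).op.obj V) hV = P.germ V.unop (f x) hV ≫ σ ≫ u := by
        rw [← Category.assoc, hσ]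
        exact (Category.assoc _ _ _).trans ((congrArg (c.app V ≫ ·)
          (hT u ((Opens.map f).obj V.unop) hV)).trans (Category.assoc _ _ _).symm)
      exact (h₁ u).trans ((congrArg _ h).trans (h₁ u').symm))
    refine Q.stalk_hom_ext fun V hV ↦ ?_
    rw [← hT, ← hT, this]
  · intro w
    let χ : P ⟶ (Opens.map f).op ⋙ skyscraperPresheaf x e :=
      skyscraperLift (fun V hV ↦ P.germ V.unop (f x) hV ≫ w) (fun V W i hV hW ↦ by
        rw [← Category.assoc, P.germ_res' i (f x) hW])
    obtain ⟨ψ, hψ⟩ := hS.2 χ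
    have hψ : c ≫ (Presheaf.pushforward B f).map ψ = χ := hψ
    obtain ⟨d, hd⟩ := exists_stalk_desc Q x (fun V hV ↦ ψ.app (op V) ≫ skyπ x e (op V) hV)
      (fun V W h hV hW ↦ by
        rw [← Category.assoc, ψ.naturality, Category.assoc, map_skyπ])
    refine ⟨d, P.stalk_hom_ext fun V hV ↦ ?_⟩
    have h₁ : χ.app (op V) ≫ skyπ x e (op ((Opens.map f).obj V)) hV = P.germ V (f x) hV ≫ w :=
      skyscraperLift_app _ _ (op V) hV
    change P.germ V (f x) hV ≫ σ ≫ d = P.germ V (f x) hV ≫ w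
    rw [← Category.assoc, hσ, ← h₁, ← hψ]
    exact (Category.assoc _ _ _).trans ((congrArg (c.app (op V) ≫ ·)
      (hd ((Opens.map f).obj V) hV)).trans (Category.assoc _ _ _).symm)

end StalkDesc

/-! ### Inverse images of sheaves -/

section InverseImage

open TopCat

variable {B : Type u₂} [Category.{v} B]

/-- A morphism `(X, 𝔸) ⟶ (Y, ℂ)` of spaces with a sheaf exhibits `𝔸` as the inverse image of `ℂ` if
it is universal among the morphisms of sheaves from `ℂ` to direct images of sheaves on `X`. -/
def IsInverseImage {X Y : SheafedSpace.{u₂, v, v} B} (φ : X ⟶ Y) : Prop :=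
  ∀ S : Presheaf B X.carrier, S.IsSheaf → Function.Bijective
    (fun ψ : X.presheaf ⟶ S ↦ φ.hom.c ≫ (Presheaf.pushforward B φ.hom.base).map ψ)

/-- The universal property of an inverse image, for morphisms over an arbitrary continuous map. -/
lemma IsInverseImage.existsUnique {X Y : SheafedSpace.{u₂, v, v} B} {φ : X ⟶ Y}
    (hφ : IsInverseImage φ) {T : SheafedSpace.{u₂, v, v} B} (ψ : T ⟶ Y)
    (g : T.carrier ⟶ X.carrier) (hg : g ≫ φ.hom.base = ψ.hom.base) :
    ∃! χ : T ⟶ X, χ.hom.base = g ∧ χ ≫ φ = ψ := by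
  obtain ⟨⟨b, c⟩⟩ := ψ
  obtain rfl : g ≫ φ.hom.base = b := hg
  obtain ⟨d, hd⟩ := (hφ ((Presheaf.pushforward B g).obj T.presheaf)
    (Sheaf.pushforward_sheaf_of_sheaf g T.IsSheaf)).2 c
  refine ⟨InducedCategory.homMk { base := g, c := d }, ⟨rfl, ?_⟩, ?_⟩
  · exact InducedCategory.hom_ext (PresheafedSpace.hext _ _ rfl (heq_of_eq hd))
  · rintro ⟨⟨b', c'⟩⟩ ⟨h, h'⟩
    obtain rfl : b' = g := h
    have h₁ : c' = d := (hφ _ (Sheaf.pushforward_sheaf_of_sheaf b' T.IsSheaf)).1 (by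
      refine Eq.trans ?_ hd.symm
      injection h' with h₂
      injection h₂)
    rw [h₁]
    rfl

variable [HasColimits B]

lemma IsInverseImage.isIso_stalkMap [HasTerminal B] {X Y : SheafedSpace.{u₂, v, v} B} {φ : X ⟶ Y}
    (hφ : IsInverseImage φ) (x : X.carrier) : IsIso (φ.hom.stalkMap x) :=
  isIso_stalk_of_bijective φ.hom.base φ.hom.c hφ x (φ.hom.stalkMap x)
    fun V hV ↦ PresheafedSpace.stalkMap_germ φ.hom V x hV

end InverseImage

section InverseImageExistence

open TopCat

variable {B : Type u₂} [Category.{v} B] [IsLocallyFinitelyPresentable.{v} B]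

/-- Inverse images exist: sheafify the inverse image of the presheaf. -/
lemma exists_isInverseImage (Y : SheafedSpace.{u₂, v, v} B) {R : TopCat.{v}} (f : R ⟶ Y.carrier) :
    ∃ (Q : R.Presheaf B) (hQ : Q.IsSheaf) (c : Y.presheaf ⟶ (Presheaf.pushforward B f).obj Q),
      IsInverseImage (InducedCategory.homMk { base := f, c := c } :
        ({ carrier := R, presheaf := Q, IsSheaf := hQ } : SheafedSpace.{u₂, v, v} B) ⟶ Y) := by
  have := hasWeakSheafify_of_isLocallyFinitelyPresentable B (Opens.grothendieckTopology R)
  let P : R.Presheaf B := (Presheaf.pullback B f).obj Y.presheaf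
  let J := Opens.grothendieckTopology R
  let adj := Presheaf.pullbackPushforwardAdjunction B f
  refine ⟨CategoryTheory.sheafify J P, (presheafToSheaf J B).obj P |>.property,
    adj.homEquiv _ _ (CategoryTheory.toSheafify J P), fun S hS ↦ ?_⟩
  have h₁ := (adj.homEquiv Y.presheaf S).bijective.comp (J.W_toSheafify P S hS)
  convert! h₁ using 1
  funext ψ
  exact (adj.homEquiv_naturality_right _ _).symm

/-- Inverse images are characterized by the stalks: the comparison with an inverse image is
a morphism of sheaves which induces isomorphisms on the stalks. -/
lemma isInverseImage_of_isIso_stalkMap {X Y : SheafedSpace.{u₂, v, v} B} (φ : X ⟶ Y)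
    (h : ∀ x, IsIso (φ.hom.stalkMap x)) : IsInverseImage φ := by
  have := hasLimits_of_isLocallyFinitelyPresentable B
  obtain ⟨Q, hQ, c, hc⟩ := exists_isInverseImage Y φ.hom.base
  obtain ⟨θ, hθ⟩ := (hc X.presheaf X.IsSheaf).2 φ.hom.c
  have hθ : c ≫ (Presheaf.pushforward B φ.hom.base).map θ = φ.hom.c := hθ
  have : IsIso θ := by
    refine isIso_of_isIso_stalk hQ X.IsSheaf θ (fun x ↦ (Presheaf.stalkFunctor B x).map θ)
      (fun V x hx ↦ Presheaf.stalkFunctor_map_germ V x hx θ) fun x ↦ ?_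
    have h₁ := hc.isIso_stalkMap x
    have h₂ := h x
    refine @IsIso.of_isIso_fac_left _ _ _ _ _ _ _ (φ.hom.stalkMap x) h₁ h₂
      (Presheaf.stalk_hom_ext _ fun V hV ↦ ?_)
    have e₁ := PresheafedSpace.stalkMap_germ_assoc (C := B) (X := ⟨X.carrier, Q⟩)
      (Y := Y.toPresheafedSpace) ⟨φ.hom.base, c⟩ V x hV ((Presheaf.stalkFunctor B x).map θ)
    have e₂ := Presheaf.stalkFunctor_map_germ ((Opens.map φ.hom.base).obj V) x hV θ
    have e₃ := PresheafedSpace.stalkMap_germ φ.hom V x hV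
    have e₄ := NatTrans.congr_app hθ (op V)
    refine e₁.trans (Eq.trans ?_ e₃.symm)
    rw [← e₄]
    exact (congrArg (c.app (op V) ≫ ·) e₂).trans (Category.assoc _ _ _).symm
  intro S hS
  have h₁ := (hc S hS).comp (f := fun ψ : X.presheaf ⟶ S ↦ θ ≫ ψ)
    ⟨fun _ _ h ↦ (cancel_epi θ).1 h, fun ψ ↦ ⟨inv θ ≫ ψ, by simp⟩⟩
  convert! h₁ using 1
  funext ψ
  change _ = c ≫ (Presheaf.pushforward B φ.hom.base).map (θ ≫ ψ)
  rw [Functor.map_comp, ← Category.assoc, hθ]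

end InverseImageExistence

/-! ### The fibrations of `B`-spaces and of `U`-spaces -/

section Fibration

open TopCat

variable {B : Type u₂} [Category.{v} B]

/-- The cocartesian lifts are given by direct images of sheaves. -/
lemma BSpace.isOpfibered : IsOpfibered (BSpace.proj B).leftOp := by
  intro a s f
  let X : SheafedSpace.{u₂, v, v} B := a.unop.unop
  let f : X.carrier ⟶ s := f
  let Y : SheafedSpace.{u₂, v, v} B :=
    { carrier := s
      presheaf := (Presheaf.pushforward B f).obj X.presheaf
      IsSheaf := Sheaf.pushforward_sheaf_of_sheaf f X.IsSheaf }
  let φ : X ⟶ Y := InducedCategory.homMk { base := f, c := 𝟙 _ }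
  refine ⟨op (op Y), φ.op.op, ?_⟩
  have h : (BSpace.proj B).leftOp.IsHomLift f φ.op.op :=
    IsHomLift.map (p := (BSpace.proj B).leftOp) φ.op.op
  refine { toIsHomLift := h, universal_property' := fun {b'} g φ' hφ' ↦ ?_ }
  let Z : SheafedSpace.{u₂, v, v} B := b'.unop.unop
  let g : s ⟶ Z.carrier := g
  have hg : f ≫ g = φ'.unop.unop.hom.base :=
    IsHomLift.eq_of_isHomLift (p := (BSpace.proj B).leftOp) (a := op (op X)) (f ≫ g) φ'
  obtain ⟨ψ, rfl⟩ : ∃ ψ : X ⟶ Z, ψ.op.op = φ' := ⟨φ'.unop.unop, rfl⟩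
  clear hφ'
  obtain ⟨⟨b, c⟩⟩ := ψ
  obtain rfl : f ≫ g = b := hg
  refine ⟨(InducedCategory.homMk { base := g, c := c } : Y ⟶ Z).op.op, ⟨?_, ?_⟩, ?_⟩
  · exact IsHomLift.map (p := (BSpace.proj B).leftOp)
      (InducedCategory.homMk { base := g, c := c } : Y ⟶ Z).op.op
  · refine congrArg (fun χ : X ⟶ Z ↦ χ.op.op) (InducedCategory.hom_ext
      (PresheafedSpace.hext _ _ rfl (heq_of_eq (NatTrans.ext (funext fun V ↦ ?_)))))
    exact Category.comp_id _
  · intro χ ⟨h₁, h₂⟩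
    have h₁' : g = χ.unop.unop.hom.base :=
      @IsHomLift.eq_of_isHomLift _ _ _ _ (BSpace.proj B).leftOp (op (op Y)) (op (op Z)) g χ h₁
    obtain ⟨χ, rfl⟩ : ∃ χ' : Y ⟶ Z, χ'.op.op = χ := ⟨χ.unop.unop, rfl⟩
    have h₂' : φ ≫ χ = (InducedCategory.homMk { base := f ≫ g, c := c } : X ⟶ Z) :=
      congrArg (fun χ ↦ χ.unop.unop) h₂
    clear h₁ h₂
    obtain ⟨⟨b, d⟩⟩ := χ
    obtain rfl : g = b := h₁'
    injection h₂' with h₃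
    injection h₃ with _ h₄
    refine congrArg (fun χ : Y ⟶ Z ↦ χ.op.op) (InducedCategory.hom_ext
      (PresheafedSpace.hext _ _ rfl (heq_of_eq (NatTrans.ext (funext fun V ↦ ?_)))))
    rw [← h₄]
    exact (Category.comp_id _).symm

variable [IsLocallyFinitelyPresentable.{v} B]

lemma BSpace.isStronglyCartesian {a b : (BSpace B)ᵒᵖ} (φ : a ⟶ b)
    (h : ∀ x, IsIso (φ.unop.unop.hom.stalkMap x)) :
    (BSpace.proj B).leftOp.IsStronglyCartesian ((BSpace.proj B).leftOp.map φ) φ where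
  universal_property' {a'} g φ' hφ' := by
    have hg := IsHomLift.eq_of_isHomLift (p := (BSpace.proj B).leftOp)
      (g ≫ (BSpace.proj B).leftOp.map φ) φ'
    obtain ⟨χ, ⟨h₁, h₂⟩, h₃⟩ := (isInverseImage_of_isIso_stalkMap φ.unop.unop h).existsUnique
      φ'.unop.unop g hg
    subst h₁
    refine ⟨χ.op.op, ⟨IsHomLift.map (p := (BSpace.proj B).leftOp) χ.op.op,
      congrArg (fun χ ↦ χ.op.op) h₂⟩, fun χ' ⟨h₄, h₅⟩ ↦ ?_⟩
    exact congrArg (fun χ ↦ χ.op.op) (h₃ χ'.unop.unop ⟨(IsHomLift.eq_of_isHomLift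
      (p := (BSpace.proj B).leftOp) (a := a') (b := a) χ.hom.base χ').symm,
      congrArg (fun χ ↦ χ.unop.unop) h₅⟩)

/-- The inverse images of sheaves give cartesian lifts which are isomorphisms on the stalks. -/
lemma BSpace.exists_lift (b : (BSpace B)ᵒᵖ) {R : TopCat.{v}}
    (f : R ⟶ (BSpace.proj B).leftOp.obj b) : ∃ (a : (BSpace B)ᵒᵖ) (φ : a ⟶ b),
      (∀ x, IsIso (φ.unop.unop.hom.stalkMap x)) ∧
        (BSpace.proj B).leftOp.IsStronglyCartesian f φ := by
  have := hasLimits_of_isLocallyFinitelyPresentable B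
  obtain ⟨Q, hQ, c, hc⟩ := exists_isInverseImage b.unop.unop f
  let X' : SheafedSpace.{u₂, v, v} B := ⟨⟨R, Q⟩, hQ⟩
  let ψ : X' ⟶ b.unop.unop := InducedCategory.homMk ⟨f, c⟩
  have h := hc.isIso_stalkMap
  exact ⟨op (op X'), ψ.op.op, h, BSpace.isStronglyCartesian (a := op (op X')) (b := b) ψ.op.op h⟩

lemma BSpace.isFibered : (BSpace.proj B).leftOp.IsFibered :=
  Functor.IsFibered.of_exists_isStronglyCartesian fun b R f ↦ by
    obtain ⟨a, φ, -, h⟩ := BSpace.exists_lift b f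
    exact ⟨a, φ, h⟩

/-- Cartesian arrows between `B`-spaces are isomorphisms on the stalks. -/
lemma BSpace.isIso_stalkMap {R S : TopCat.{v}} (f : R ⟶ S) {a b : (BSpace B)ᵒᵖ} (φ : a ⟶ b)
    (h : (BSpace.proj B).leftOp.IsStronglyCartesian f φ) (x : a.unop.unop.carrier) :
    IsIso (φ.unop.unop.hom.stalkMap x) := by
  cases h.toIsHomLift
  obtain ⟨a', φ', h₁, h₂⟩ := BSpace.exists_lift b ((BSpace.proj B).leftOp.map φ)
  let e := Functor.IsCartesian.domainUniqueUpToIso (BSpace.proj B).leftOp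
    ((BSpace.proj B).leftOp.map φ) φ' φ
  have he : e.hom ≫ φ' = φ := Functor.IsCartesian.fac (BSpace.proj B).leftOp
    ((BSpace.proj B).leftOp.map φ) φ' φ
  have h₃ : IsIso e.hom.unop.unop.hom := inferInstance
  rw [← he]
  have := h₁ (e.hom.unop.unop.hom.base x)
  have := PresheafedSpace.stalkMap.comp e.hom.unop.unop.hom φ'.unop.unop.hom x
  exact (congrArg IsIso this).mpr (@IsIso.comp_isIso _ _ _ _ _ _ _ ‹_› inferInstance)

variable {A : Type u₁} [Category.{v} A] {U : A ⥤ B}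

/-- The universal property of the morphisms of `U`-spaces which are isomorphisms on the stalks
and on the local objects. -/
lemma USpace.existsUnique {S R T : USpace U} (φ : S ⟶ R)
    (h : ∀ x, IsIso (φ.toHom.hom.stalkMap x)) (h' : ∀ x, IsIso (φ.loc x)) (ψ : S ⟶ T)
    (g : T.carrier ⟶ R.carrier) (hg : g ≫ φ.toHom.hom.base = ψ.toHom.hom.base) :
    ∃! χ : R ⟶ T, χ.toHom.hom.base = g ∧ φ ≫ χ = ψ := by
  obtain ⟨χ, ⟨rfl, h₂⟩, h₃⟩ :=
    (isInverseImage_of_isIso_stalkMap φ.toHom h).existsUnique ψ.toHom g hg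
  obtain ⟨ψ, l, hl⟩ := ψ
  obtain rfl : χ ≫ φ.toHom = ψ := h₂
  let l' (x : T.carrier) : S.loc (φ.toHom.hom.base (χ.hom.base x)) ⟶ T.loc x := l x
  have hl' (x : T.carrier) : χ.hom.stalkMap x ≫ (T.stalkIso x).hom =
      (R.stalkIso (χ.hom.base x)).hom ≫ U.map (inv (φ.loc (χ.hom.base x)) ≫ l' x) := by
    have e₁ : φ.toHom.hom.stalkMap (χ.hom.base x) ≫ χ.hom.stalkMap x ≫ (T.stalkIso x).hom =
        (S.stalkIso (φ.toHom.hom.base (χ.hom.base x))).hom ≫ U.map (l' x) :=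
      (Category.assoc _ _ _).symm.trans ((congrArg (· ≫ (T.stalkIso x).hom)
        (PresheafedSpace.stalkMap.comp χ.hom φ.toHom.hom x).symm).trans (hl x))
    have e₂ : U.map (φ.loc (χ.hom.base x)) ≫ U.map (inv (φ.loc (χ.hom.base x)) ≫ l' x) =
        U.map (l' x) := by rw [← U.map_comp, IsIso.hom_inv_id_assoc]
    refine (cancel_epi (φ.toHom.hom.stalkMap (χ.hom.base x))).1 (e₁.trans ?_)
    refine (congrArg (_ ≫ ·) e₂.symm).trans ((Category.assoc _ _ _).symm.trans ?_)
    exact (congrArg (· ≫ _) (φ.comm (χ.hom.base x)).symm).trans (Category.assoc _ _ _)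
  refine ⟨⟨χ, fun x ↦ inv (φ.loc (χ.hom.base x)) ≫ l' x, hl'⟩, ⟨rfl, ?_⟩, ?_⟩
  · exact USpace.Hom.ext rfl (heq_of_eq (funext fun x ↦
      IsIso.hom_inv_id_assoc (φ.loc (χ.hom.base x)) (l' x)))
  · rintro ⟨χ', m, hm⟩ ⟨h₄, h₅⟩
    injection h₅ with h₆ h₇
    obtain rfl : χ' = χ := h₃ χ' ⟨h₄, h₆⟩
    have h₈ := eq_of_heq h₇
    subst h₈
    exact USpace.Hom.ext rfl (heq_of_eq (funext fun x ↦
      (IsIso.inv_hom_id_assoc (φ.loc (χ'.hom.base x)) (m x)).symm))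

lemma USpace.isStronglyCartesian {a b : (USpace U)ᵒᵖ} (φ : a ⟶ b)
    (h : ∀ x, IsIso (φ.unop.toHom.hom.stalkMap x)) (h' : ∀ x, IsIso (φ.unop.loc x)) :
    (USpace.proj U).leftOp.IsStronglyCartesian ((USpace.proj U).leftOp.map φ) φ where
  universal_property' {a'} g φ' hφ' := by
    have hg := IsHomLift.eq_of_isHomLift (p := (USpace.proj U).leftOp)
      (g ≫ (USpace.proj U).leftOp.map φ) φ'
    obtain ⟨χ, ⟨h₁, h₂⟩, h₃⟩ := USpace.existsUnique φ.unop h h' φ'.unop g hg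
    subst h₁
    refine ⟨χ.op, ⟨IsHomLift.map (p := (USpace.proj U).leftOp) χ.op,
      congrArg (fun χ ↦ χ.op) h₂⟩, fun χ' ⟨h₄, h₅⟩ ↦ ?_⟩
    exact congrArg (fun χ ↦ χ.op) (h₃ χ'.unop ⟨(IsHomLift.eq_of_isHomLift
      (p := (USpace.proj U).leftOp) (a := a') (b := a) χ.toHom.hom.base χ').symm,
      congrArg (fun χ ↦ χ.unop) h₅⟩)

/-- The cartesian lifts are the inverse images of sheaves, with the same local objects. -/
lemma USpace.exists_lift (b : (USpace U)ᵒᵖ) {R : TopCat.{v}}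
    (f : R ⟶ (USpace.proj U).leftOp.obj b) : ∃ (a : (USpace U)ᵒᵖ) (φ : a ⟶ b),
      (∀ x, IsIso (φ.unop.toHom.hom.stalkMap x)) ∧ (∀ x, IsIso (φ.unop.loc x)) ∧
        (USpace.proj U).leftOp.IsStronglyCartesian f φ := by
  have := hasLimits_of_isLocallyFinitelyPresentable B
  obtain ⟨Q, hQ, c, hc⟩ := exists_isInverseImage b.unop.toSheafedSpace f
  let X' : SheafedSpace.{u₂, v, v} B := ⟨⟨R, Q⟩, hQ⟩
  let ψ : X' ⟶ b.unop.toSheafedSpace := InducedCategory.homMk ⟨f, c⟩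
  have h : ∀ x, IsIso (ψ.hom.stalkMap x) := hc.isIso_stalkMap
  let T : USpace U :=
    { toSheafedSpace := X'
      loc := fun x ↦ b.unop.loc (f x)
      stalkIso := fun x ↦ (asIso (ψ.hom.stalkMap x)).symm ≪≫ b.unop.stalkIso (f x) }
  let χ : b.unop ⟶ T :=
    { toHom := ψ
      loc := fun x ↦ 𝟙 _
      comm := fun x ↦ (IsIso.hom_inv_id_assoc (ψ.hom.stalkMap x) _).trans
        ((congrArg (_ ≫ ·) (U.map_id _)).trans (Category.comp_id _)).symm }
  have h' (x) : IsIso (χ.loc x) := inferInstanceAs (IsIso (𝟙 _))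
  exact ⟨op T, χ.op, h, h', USpace.isStronglyCartesian (a := op T) (b := b) χ.op h h'⟩

lemma USpace.isFibered : (USpace.proj U).leftOp.IsFibered :=
  Functor.IsFibered.of_exists_isStronglyCartesian fun b R f ↦ by
    obtain ⟨a, φ, -, -, h⟩ := USpace.exists_lift b f
    exact ⟨a, φ, h⟩

lemma USpace.isIso_loc {S T : USpace U} (f : S ⟶ T) [IsIso f] (x : T.carrier) :
    IsIso (f.loc x) := by
  have h {S : USpace U} {k : S ⟶ S} (hk : k = 𝟙 S) (x : S.carrier) : IsIso (k.loc x) := by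
    subst hk; exact inferInstanceAs (IsIso (𝟙 _))
  let g := inv f
  let y := f.toHom.hom.base x
  have h₁ : IsIso (g.loc y ≫ f.loc x) := h (IsIso.inv_hom_id f) x
  have h₂ : IsIso (f.loc (g.toHom.hom.base y) ≫ g.loc y) := h (IsIso.hom_inv_id f) y
  -- `g.loc y` is invertible on both sides
  have h₃ : IsIso (g.loc y) := by
    have : Mono (g.loc y) := mono_of_mono (g.loc y) (f.loc x)
    have : IsSplitEpi (g.loc y) := IsSplitEpi.mk'
      ⟨inv (f.loc (g.toHom.hom.base y) ≫ g.loc y) ≫ f.loc (g.toHom.hom.base y),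
        (Category.assoc _ _ _).trans (IsIso.inv_hom_id _)⟩
    exact isIso_of_mono_of_isSplitEpi _
  exact IsIso.of_isIso_comp_left (g.loc y) (f.loc x)

/-- Cartesian arrows between `U`-spaces are isomorphisms on the stalks and on the local objects. -/
lemma USpace.isIso_stalkMap_and_isIso_loc {R S : TopCat.{v}} (f : R ⟶ S) {a b : (USpace U)ᵒᵖ}
    (φ : a ⟶ b) (h : (USpace.proj U).leftOp.IsStronglyCartesian f φ) (x : a.unop.carrier) :
    IsIso (φ.unop.toHom.hom.stalkMap x) ∧ IsIso (φ.unop.loc x) := by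
  cases h.toIsHomLift
  obtain ⟨a', φ', h₁, h₂, h₃⟩ := USpace.exists_lift b ((USpace.proj U).leftOp.map φ)
  let e := Functor.IsCartesian.domainUniqueUpToIso (USpace.proj U).leftOp
    ((USpace.proj U).leftOp.map φ) φ' φ
  have he : e.hom ≫ φ' = φ := Functor.IsCartesian.fac (USpace.proj U).leftOp
    ((USpace.proj U).leftOp.map φ) φ' φ
  have h₄ : IsIso e.hom.unop.toHom.hom :=
    inferInstanceAs (IsIso ((USpace.ι U).map e.hom.unop).unop.hom)
  rw [← he]
  constructor
  · have := h₁ (e.hom.unop.toHom.hom.base x)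
    have := PresheafedSpace.stalkMap.comp e.hom.unop.toHom.hom φ'.unop.toHom.hom x
    exact (congrArg IsIso this).mpr (@IsIso.comp_isIso _ _ _ _ _ _ _ ‹_› inferInstance)
  · have := h₂ (e.hom.unop.toHom.hom.base x)
    have := USpace.isIso_loc e.hom.unop x
    exact inferInstanceAs (IsIso (φ'.unop.loc (e.hom.unop.toHom.hom.base x) ≫ e.hom.unop.loc x))

lemma USpace.isFibMorphism_ι : IsFibMorphism (USpace.proj U) (BSpace.proj B) (USpace.ι U) where
  comm := rfl
  preserves s t f a b φ h := by
    have h₁ := fun x ↦ (USpace.isIso_stalkMap_and_isIso_loc f φ h x).1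
    cases h.toIsHomLift
    exact BSpace.isStronglyCartesian ((USpace.ι U).op.map φ) h₁

end Fibration

/-! ### Postcomposition functors are morphisms of fibrations -/

section PushFib

open TopCat

variable {A : Type u₁} [Category.{v} A] {B : Type u₂} [Category.{v} B]
  {A' : Type u₁'} [Category.{v} A'] {B' : Type u₂'} [Category.{v} B']
  [IsLocallyFinitelyPresentable.{v} B] [IsLocallyFinitelyPresentable.{v} B']

lemma isIso_stalkMap_mapPresheaf (G : B ⥤ B') (hG : PreservesFilteredColimits G)
    {X Y : PresheafedSpace.{_, _, v} B} (φ : X ⟶ Y) (x : X) [IsIso (φ.stalkMap x)] :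
    IsIso ((G.mapPresheaf.map φ).stalkMap x) := by
  have h := stalkMap_stalkCompIso G hG φ x
  have h₁ : IsIso ((stalkCompIso G hG Y.presheaf (φ.base x)).hom ≫ G.map (φ.stalkMap x)) :=
    inferInstance
  have h₂ : IsIso ((G.mapPresheaf.map φ).stalkMap x ≫ (stalkCompIso G hG X.presheaf x).hom) :=
    (congrArg IsIso h).mpr h₁
  have h₃ : IsIso (stalkCompIso G hG X.presheaf x).hom := Iso.isIso_hom _
  exact @IsIso.of_isIso_comp_right _ _ _ _ _ _ _ h₃ h₂

/-- Cartesian arrows are those which induce isomorphisms on the stalks, and a functor preserving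
filtered colimits commutes with stalks. -/
lemma isFibMorphism_pushB (G : B ⥤ B') (hG : G.IsRightAdjoint)
    (hG' : PreservesFilteredColimits G) :
    IsFibMorphism (BSpace.proj B) (BSpace.proj B') (pushB G hG) where
  comm := rfl
  preserves s t f a b φ h := by
    have h₁ := BSpace.isIso_stalkMap f φ h
    cases h.toIsHomLift
    exact BSpace.isStronglyCartesian ((pushB G hG).op.map φ) fun x ↦
      have := h₁ x
      isIso_stalkMap_mapPresheaf G hG' φ.unop.unop.hom x

lemma isFibMorphism_pushU {U : A ⥤ B} {U' : A' ⥤ B'} (s : Square U U')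
    (hG : s.G.IsRightAdjoint) (hG' : PreservesFilteredColimits s.G) :
    IsFibMorphism (USpace.proj U) (USpace.proj U') (pushU s hG hG') where
  comm := rfl
  preserves r t f a b φ h := by
    have h₁ := USpace.isIso_stalkMap_and_isIso_loc f φ h
    cases h.toIsHomLift
    refine USpace.isStronglyCartesian ((pushU s hG hG').op.map φ) (fun x ↦ ?_) fun x ↦ ?_
    · have := (h₁ x).1
      exact isIso_stalkMap_mapPresheaf s.G hG' φ.unop.toHom.hom x
    · have := (h₁ x).2
      exact inferInstanceAs (IsIso (s.F.map (φ.unop.loc x)))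

end PushFib

lemma pushIsFibMorphism {C E : DiersContext.{v, u₁, u₂}} (f : C ⟶ E) : PushIsFibMorphism f := by
  have := C.lfp
  have := E.lfp
  exact ⟨isFibMorphism_pushU f.toSquare f.isRightAdjoint f.finitary,
    isFibMorphism_pushB f.G f.isRightAdjoint f.finitary⟩

/-! ### Strict functoriality of postcomposition -/

section Strictness

variable {A : Type u₁} [Category.{v} A] {B : Type u₂} [Category.{v} B]
  {A' : Type u₁'} [Category.{v} A'] {B' : Type u₂'} [Category.{v} B']
  {A'' : Type u₁''} [Category.{v} A''] {B'' : Type u₂''} [Category.{v} B'']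
  [HasColimits B] [HasColimits B'] [HasColimits B'']

lemma USpace.mk_congr {U : A ⥤ B} {X : SheafedSpace.{u₂, v, v} B} {l : X.carrier → A}
    {i j : ∀ x, X.presheaf.stalk x ≅ U.obj (l x)} (h : ∀ x, (i x).hom = (j x).hom) :
    (⟨X, l, i⟩ : USpace U) = ⟨X, l, j⟩ := by
  obtain rfl : i = j := funext fun x ↦ Iso.ext (h x)
  rfl

/-- Morphisms between `U`-spaces whose stalk isomorphisms are only propositionally equal are
compared by their underlying data. The functor attached to a composite of 1-cells
differs from the composite of the functors exactly in this way. -/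
lemma USpace.hom_heq {U : A ⥤ B} {X Y : SheafedSpace.{u₂, v, v} B} {l : X.carrier → A}
    {l' : Y.carrier → A} {i j : ∀ x, X.presheaf.stalk x ≅ U.obj (l x)}
    {i' j' : ∀ y, Y.presheaf.stalk y ≅ U.obj (l' y)} (h : ∀ x, (i x).hom = (j x).hom)
    (h' : ∀ y, (i' y).hom = (j' y).hom) (f : (⟨X, l, i⟩ : USpace U) ⟶ ⟨Y, l', i'⟩)
    (g : (⟨X, l, j⟩ : USpace U) ⟶ ⟨Y, l', j'⟩) (hfg : f.toHom = g.toHom)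
    (hl : f.loc ≍ g.loc) : f ≍ g := by
  obtain rfl : i = j := funext fun x ↦ Iso.ext (h x)
  obtain rfl : i' = j' := funext fun x ↦ Iso.ext (h' x)
  exact heq_of_eq (USpace.Hom.ext hfg hl)

lemma natTrans_heq {C D : Type*} [Category* C] [Category* D] {F F' G G' : C ⥤ D}
    (hF : F = F') (hG : G = G') (α : F ⟶ G) (β : F' ⟶ G') (h : ∀ X, α.app X ≍ β.app X) :
    α ≍ β := by
  subst hF hG
  exact heq_of_eq (NatTrans.ext (funext fun X ↦ eq_of_heq (h X)))

lemma stalkCompIso_id {X : TopCat.{v}} (P : X.Presheaf B)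
    (h : PreservesFilteredColimits (𝟭 B)) (x : X) :
    (stalkCompIso (𝟭 B) h P x).hom = 𝟙 (P.stalk x) :=
  TopCat.Presheaf.stalk_hom_ext _ fun V hV ↦
    (germ_stalkCompIso (𝟭 B) h P V x hV).trans (Category.comp_id _).symm

lemma stalkCompIso_comp {X : TopCat.{v}} (P : X.Presheaf B) (G : B ⥤ B') (G' : B' ⥤ B'')
    (h : PreservesFilteredColimits G) (h' : PreservesFilteredColimits G')
    (h'' : PreservesFilteredColimits (G ⋙ G')) (x : X) :
    (stalkCompIso (G ⋙ G') h'' P x).hom =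
      (stalkCompIso G' h' (P ⋙ G) x).hom ≫ G'.map (stalkCompIso G h P x).hom := by
  refine TopCat.Presheaf.stalk_hom_ext _ fun V hV ↦ ?_
  refine (germ_stalkCompIso (G ⋙ G') h'' P V x hV).trans ?_
  refine Eq.trans ?_ ((congrArg (· ≫ G'.map (stalkCompIso G h P x).hom)
    (germ_stalkCompIso G' h' (P ⋙ G) V x hV)).symm.trans (Category.assoc _ _ _))
  exact (congrArg G'.map (germ_stalkCompIso G h P V x hV)).symm.trans (G'.map_comp _ _)

variable {U : A ⥤ B} {U' : A' ⥤ B'} {U'' : A'' ⥤ B''}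

lemma stalkIso_pushU_id (hG : (𝟭 B).IsRightAdjoint) (hG' : PreservesFilteredColimits (𝟭 B))
    (S : USpace U) (x : S.carrier) :
    (((pushU (Square.id U) hG hG').obj S).stalkIso x).hom = (S.stalkIso x).hom := by
  have h := stalkCompIso_id S.presheaf hG' x
  refine (congrArg (· ≫ (S.stalkIso x).hom ≫ 𝟙 _) h).trans ?_
  exact (Category.id_comp _).trans (Category.comp_id _)

lemma pushU_id (hG : (𝟭 B).IsRightAdjoint) (hG' : PreservesFilteredColimits (𝟭 B)) :
    pushU (Square.id U) hG hG' = 𝟭 (USpace U) :=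
  Functor.hext (fun S ↦ USpace.mk_congr (stalkIso_pushU_id hG hG' S)) fun S T f ↦
    USpace.hom_heq (stalkIso_pushU_id hG hG' S) (stalkIso_pushU_id hG hG' T) _ f rfl HEq.rfl

lemma pushSquare_id (hG : (𝟭 B).IsRightAdjoint) (hG' : PreservesFilteredColimits (𝟭 B)) :
    pushSquare (Square.id U) hG hG' = Square.id (USpace.ι U) :=
  Square.ext_of (pushU_id hG hG') rfl (heq_of_eq (NatTrans.ext (funext fun _ ↦ rfl)))

lemma stalkIso_pushU_comp (s : Square U U') (t : Square U' U'') (hs : s.G.IsRightAdjoint)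
    (hs' : PreservesFilteredColimits s.G) (ht : t.G.IsRightAdjoint)
    (ht' : PreservesFilteredColimits t.G) (hst : (s.comp t).G.IsRightAdjoint)
    (hst' : PreservesFilteredColimits (s.comp t).G) (S : USpace U) (x : S.carrier) :
    (((pushU (s.comp t) hst hst').obj S).stalkIso x).hom =
      (((pushU t ht ht').obj ((pushU s hs hs').obj S)).stalkIso x).hom := by
  have h := stalkCompIso_comp S.presheaf s.G t.G hs' ht' hst' x
  have h₁ : t.G.map ((stalkCompIso s.G hs' S.presheaf x).hom ≫
      s.G.map (S.stalkIso x).hom ≫ s.θ.hom.app (S.loc x)) =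
      t.G.map (stalkCompIso s.G hs' S.presheaf x).hom ≫ t.G.map (s.G.map (S.stalkIso x).hom) ≫
        t.G.map (s.θ.hom.app (S.loc x)) := by
    rw [Functor.map_comp, Functor.map_comp]
  refine (congrArg (· ≫ t.G.map (s.G.map (S.stalkIso x).hom) ≫
    t.G.map (s.θ.hom.app (S.loc x)) ≫ t.θ.hom.app (s.F.obj (S.loc x))) h).trans ?_
  refine Eq.trans ?_ (congrArg (fun k ↦ (stalkCompIso t.G ht' (S.presheaf ⋙ s.G) x).hom ≫ k ≫
    t.θ.hom.app (s.F.obj (S.loc x))) h₁).symm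
  simp only [Category.assoc]

lemma pushU_comp (s : Square U U') (t : Square U' U'') (hs : s.G.IsRightAdjoint)
    (hs' : PreservesFilteredColimits s.G) (ht : t.G.IsRightAdjoint)
    (ht' : PreservesFilteredColimits t.G) (hst : (s.comp t).G.IsRightAdjoint)
    (hst' : PreservesFilteredColimits (s.comp t).G) :
    pushU (s.comp t) hst hst' = pushU s hs hs' ⋙ pushU t ht ht' :=
  Functor.hext (fun S ↦ USpace.mk_congr (stalkIso_pushU_comp s t hs hs' ht ht' hst hst' S))
    fun S T f ↦ USpace.hom_heq (stalkIso_pushU_comp s t hs hs' ht ht' hst hst' S)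
      (stalkIso_pushU_comp s t hs hs' ht ht' hst hst' T) _
      ((pushU t ht ht').map ((pushU s hs hs').map f)) rfl HEq.rfl

lemma pushSquare_comp (s : Square U U') (t : Square U' U'') (hs : s.G.IsRightAdjoint)
    (hs' : PreservesFilteredColimits s.G) (ht : t.G.IsRightAdjoint)
    (ht' : PreservesFilteredColimits t.G) (hst : (s.comp t).G.IsRightAdjoint)
    (hst' : PreservesFilteredColimits (s.comp t).G) :
    pushSquare (s.comp t) hst hst' = (pushSquare s hs hs').comp (pushSquare t ht ht') :=
  Square.ext_of (pushU_comp s t hs hs' ht ht' hst hst') rfl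
    (heq_of_eq (NatTrans.ext (funext fun S ↦ by
      refine Eq.symm ((Category.comp_id _).trans ?_)
      exact (pushB t.G ht).map_id _)))

end Strictness

lemma pushSquare_hom_comp {C D E : DiersContext.{v, u₁, u₂}} (f : C ⟶ D) (g : D ⟶ E) :
    pushSquare (f ≫ g).toSquare (f ≫ g).isRightAdjoint (f ≫ g).finitary =
      (pushSquare f.toSquare f.isRightAdjoint f.finitary).comp
        (pushSquare g.toSquare g.isRightAdjoint g.finitary) :=
  pushSquare_comp f.toSquare g.toSquare f.isRightAdjoint f.finitary g.isRightAdjoint g.finitary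
    (f ≫ g).isRightAdjoint (f ≫ g).finitary

lemma stalkIso_pushU_hom_comp {C D E : DiersContext.{v, u₁, u₂}} (f : C ⟶ D) (g : D ⟶ E)
    (S : USpace C.U) (x : S.carrier) :
    (((pushU (f ≫ g).toSquare (f ≫ g).isRightAdjoint (f ≫ g).finitary).obj S).stalkIso x).hom =
      (((pushU g.toSquare g.isRightAdjoint g.finitary).obj
        ((pushU f.toSquare f.isRightAdjoint f.finitary).obj S)).stalkIso x).hom :=
  stalkIso_pushU_comp f.toSquare g.toSquare f.isRightAdjoint f.finitary g.isRightAdjoint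
    g.finitary (f ≫ g).isRightAdjoint (f ≫ g).finitary S x

lemma eqToHom_eq_homOfEq {C D : SpectralDuality.{v, u₁, u₂}} {f g : C ⟶ D} (h : f = g) :
    (eqToHom h : f ⟶ g) = Square.homOfEq (congrArg SpectralDuality.Hom.toSquare h) := by
  subst h; rfl

/-- The spectral construction as a strict 2-functor, for a choice of the spectral dualities. -/
def specPreCore (D : ∀ C : DiersContext.{v, u₁, u₂}, SpecDuality C)
    (H : ∀ {C E : DiersContext.{v, u₁, u₂}} (f : C ⟶ E), PushIsFibMorphism f) :
    StrictPseudofunctorPreCore DiersContext.{v, u₁, u₂}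
      SpectralDuality.{v, max (v + 1) u₁ u₂, max (v + 1) u₂} where
  toPrelaxFunctorStruct := specData D H
  map₂_id f := Square.Hom.ext
    (NatTrans.ext (funext fun S ↦ USpace.Hom.ext rfl HEq.rfl))
    (NatTrans.ext (funext fun S ↦ rfl))
  map₂_comp η ξ := Square.Hom.ext
    (NatTrans.ext (funext fun S ↦ USpace.Hom.ext (InducedCategory.hom_ext
      (PresheafedSpace.hext _ _ rfl (heq_of_eq (NatTrans.ext (funext fun V ↦ rfl))))) HEq.rfl))
    (NatTrans.ext (funext fun S ↦ congrArg Quiver.Hom.op (InducedCategory.hom_ext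
      (PresheafedSpace.hext _ _ rfl (heq_of_eq (NatTrans.ext (funext fun V ↦ rfl)))))))
  map_id C := SpectralDuality.Hom.ext_of (pushSquare_id _ _)
  map_comp f g := SpectralDuality.Hom.ext_of (pushSquare_hom_comp f g)
  map₂_whisker_left {_ _ _} f g g' η := by
    rw [eqToHom_eq_homOfEq, eqToHom_eq_homOfEq]
    exact Square.conj_ext _ _ _ _
      (natTrans_heq (congrArg (·.F) (pushSquare_hom_comp f g))
        (congrArg (·.F) (pushSquare_hom_comp f g')) _ _ fun S ↦
        USpace.hom_heq (stalkIso_pushU_hom_comp f g S) (stalkIso_pushU_hom_comp f g' S)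
          ((pushUTrans (f ≫ g).isRightAdjoint (f ≫ g).finitary (f ≫ g').isRightAdjoint
            (f ≫ g').finitary (Bicategory.whiskerLeft f η)).app S)
          ((pushUTrans g.isRightAdjoint g.finitary g'.isRightAdjoint g'.finitary η).app
            ((pushU f.toSquare f.isRightAdjoint f.finitary).obj S)) rfl HEq.rfl)
      (heq_of_eq (NatTrans.ext (funext fun S ↦ rfl)))
  map₂_whisker_right {_ _ _ f f'} η g := by
    rw [eqToHom_eq_homOfEq, eqToHom_eq_homOfEq]
    exact Square.conj_ext _ _ _ _
      (natTrans_heq (congrArg (·.F) (pushSquare_hom_comp f g))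
        (congrArg (·.F) (pushSquare_hom_comp f' g)) _ _ fun S ↦
        USpace.hom_heq (stalkIso_pushU_hom_comp f g S) (stalkIso_pushU_hom_comp f' g S)
          ((pushUTrans (f ≫ g).isRightAdjoint (f ≫ g).finitary (f' ≫ g).isRightAdjoint
            (f' ≫ g).finitary (Bicategory.whiskerRight η g)).app S)
          ((pushU g.toSquare g.isRightAdjoint g.finitary).map
            ((pushUTrans f.isRightAdjoint f.finitary f'.isRightAdjoint f'.finitary η).app S))
            rfl HEq.rfl)
      (heq_of_eq (NatTrans.ext (funext fun S ↦ rfl)))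

/-! ### Diagonally universal morphisms of finite presentation -/

section FinDiag

variable {A : Type u₁} [Category.{v} A] {B : Type u₂} [Category.{v} B] {U : A ⥤ B}

lemma DiagonallyUniversal.of_isPushout {k k' b c : B} {f : k ⟶ b} {l : k ⟶ k'} {n : b ⟶ c}
    {f' : k' ⟶ c} (sq : IsPushout f l n f') (hl : DiagonallyUniversal U l) :
    DiagonallyUniversal U n := by
  intro a a' u g h w
  obtain ⟨d, ⟨hd₁, hd₂⟩, hd⟩ := hl u (f ≫ g) (f' ≫ h) (by
    rw [Category.assoc, w, ← Category.assoc, sq.w, Category.assoc])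
  refine ⟨sq.desc g d hd₁.symm, ⟨sq.inl_desc _ _ _, sq.hom_ext ?_ ?_⟩, fun e ⟨he₁, he₂⟩ ↦ ?_⟩
  · rw [sq.inl_desc_assoc, w]
  · rw [sq.inr_desc_assoc, hd₂]
  · refine sq.hom_ext (he₁.trans (sq.inl_desc _ _ _).symm) ?_
    rw [sq.inr_desc]
    refine hd _ ⟨?_, ?_⟩
    · rw [← Category.assoc, ← sq.w, Category.assoc, he₁]
    · rw [Category.assoc, he₂]

lemma FinDiag.diagonallyUniversal {b c : B} {n : b ⟶ c} (hn : FinDiag U n) :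
    DiagonallyUniversal U n := by
  obtain ⟨k, k', l, f, f', -, -, hl, sq⟩ := hn
  exact hl.of_isPushout sq

lemma FinDiag.of_isPushout {b b' c c' : B} {n : b ⟶ c} {n' : b' ⟶ c'} {g : b ⟶ b'} {g' : c ⟶ c'}
    (sq : IsPushout g n n' g') (hn : FinDiag U n) : FinDiag U n' := by
  obtain ⟨k, k', l, f, f', hk, hk', hl, sq'⟩ := hn
  exact ⟨k, k', l, f ≫ g, f' ≫ g', hk, hk', hl, sq'.paste_horiz sq⟩

/-- Diagonally universal morphisms of finite presentation are finitely presentable as objects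
under their domain. -/
lemma FinDiag.exists_hom_of_isColimit {b e : B} {n : b ⟶ e} (hn : FinDiag U n) {J : Type*}
    [Category* J] [EssentiallySmall.{v} J] [IsFiltered J] {D : J ⥤ B} {c : Cocone D}
    (hc : IsColimit c) (s : (Functor.const J).obj b ⟶ D) (p : e ⟶ c.pt)
    (h : ∀ j, s.app j ≫ c.ι.app j = n ≫ p) :
    ∃ (j : J) (q : e ⟶ D.obj j), n ≫ q = s.app j ∧ q ≫ c.ι.app j = p := by
  obtain ⟨k, k', l, f, f', hk, hk', -, sq⟩ := hn
  have : Fact Cardinal.aleph0.{v}.IsRegular := Cardinal.fact_isRegular_aleph0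
  have : IsCardinalFiltered J Cardinal.aleph0.{v} := (isCardinalFiltered_aleph0_iff J).2 ‹_›
  have : IsCardinalPresentable k Cardinal.aleph0.{v} := hk
  have : IsCardinalPresentable k' Cardinal.aleph0.{v} := hk'
  obtain ⟨j, q, hq⟩ := IsCardinalPresentable.exists_hom_of_isColimit Cardinal.aleph0.{v} hc (f' ≫ p)
  obtain ⟨i, u, w, huw⟩ := IsCardinalPresentable.exists_eq_of_isColimit Cardinal.aleph0.{v} hc
    (l ≫ q) (f ≫ s.app j) (by
      rw [Category.assoc, Category.assoc, hq, h j, ← Category.assoc, ← sq.w, Category.assoc])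
  have hs : s.app j ≫ D.map w = s.app i := (s.naturality w).symm.trans (Category.id_comp _)
  have e : f ≫ s.app i = l ≫ q ≫ D.map u := by
    rw [← hs, ← Category.assoc, ← huw, Category.assoc]
  refine ⟨i, sq.desc _ _ e, sq.inl_desc _ _ _, sq.hom_ext ?_ ?_⟩
  · rw [sq.inl_desc_assoc, h]
  · rw [sq.inr_desc_assoc, Category.assoc, c.w, hq]

lemma BasicOpen.hom_w_of_under {X : SheafedSpace.{u₂, v, v} B} {V : Opens X.carrier}
    {n n' : Under (X.presheaf.obj (op V))} (e : n ⟶ n') :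
    n.hom ≫ e.right = X.presheaf.map (homOfLE (le_refl V)).op ≫ n'.hom :=
  (Under.w e).trans ((Category.id_comp _).symm.trans
    (congrArg (· ≫ n'.hom) (X.presheaf.map_id (op V)).symm))

variable [IsLocallyFinitelyPresentable.{v} B]

/-- Up to isomorphism, the objects of `𝒟_b` form a small set. -/
lemma FinDiag.essentiallySmall (U : A ⥤ B) (b : B) :
    ObjectProperty.EssentiallySmall.{v} (fun n : Under b ↦ FinDiag U n.hom) := by
  obtain ⟨Q, hQ, hQ', hQ''⟩ := ObjectProperty.EssentiallySmall.exists_small_le.{v}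
    (ObjectProperty.isFinitelyPresentable.{v} B)
  let T := Σ k k' : Subtype Q, (k.1 ⟶ k'.1) × (k.1 ⟶ b)
  let F : T → Under b := fun t ↦ Under.mk (pushout.inl t.2.2.2 t.2.2.1)
  have : Small.{v} T := inferInstance
  refine ⟨ObjectProperty.ofObj F, inferInstance, fun n ⟨k, k', l, f, f', hk, hk', hl, sq⟩ ↦ ?_⟩
  obtain ⟨k₁, h₁, ⟨e₁⟩⟩ := hQ'' _ hk
  obtain ⟨k₁', h₁', ⟨e₁'⟩⟩ := hQ'' _ hk'
  let t : T := ⟨⟨k₁, h₁⟩, ⟨k₁', h₁'⟩, e₁.inv ≫ l ≫ e₁'.hom, e₁.inv ≫ f⟩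
  have sq₁ : IsPushout (e₁.inv ≫ f) (e₁.inv ≫ l ≫ e₁'.hom) n.hom (e₁'.inv ≫ f') :=
    IsPushout.of_iso sq e₁ (Iso.refl _) e₁' (Iso.refl _) (by simp) (by simp) (by simp) (by simp)
  refine ⟨F t, ObjectProperty.ofObj_apply F t, ⟨Under.isoMk (sq₁.isoPushout) ?_⟩⟩
  exact sq₁.inl_isoPushout_hom

/-- Isomorphic objects of `𝒟_b`, for `b` the value of the sheaf at `V`, give isomorphic indices. -/
def BasicOpen.isoOfUnder {X : SheafedSpace.{u₂, v, v} B} {V : Opens X.carrier}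
    {n n' : Under (X.presheaf.obj (op V))} (hn : FinDiag U n.hom) (hn' : FinDiag U n'.hom)
    (e : n ≅ n') : (⟨V, n, hn⟩ : BasicOpen U X) ≅ ⟨V, n', hn'⟩ where
  hom := ⟨le_rfl, e.hom.right, BasicOpen.hom_w_of_under e.hom⟩
  inv := ⟨le_rfl, e.inv.right, BasicOpen.hom_w_of_under e.inv⟩
  hom_inv_id := BasicOpen.Hom.ext (congrArg (·.right) e.hom_inv_id)
  inv_hom_id := BasicOpen.Hom.ext (congrArg (·.right) e.inv_hom_id)

lemma BasicOpen.essentiallySmall (X : SheafedSpace.{u₂, v, v} B) :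
    EssentiallySmall.{v} (BasicOpen U X) := by
  have h (V : Opens X.carrier) :=
    (FinDiag.essentiallySmall U (X.presheaf.obj (op V))).exists_small_le'
  choose Q hQ hQ' using h
  let T := Σ V : Opens X.carrier, {n : Subtype (Q V) // FinDiag U n.1.hom}
  have : Small.{v} T := inferInstance
  refine (essentiallySmall_iff _).2 ⟨?_, inferInstance⟩
  refine small_of_surjective
    (f := fun t : T ↦ toSkeleton (⟨t.1, t.2.1, t.2.2⟩ : BasicOpen U X)) fun a ↦ ?_
  obtain ⟨⟨V, n, hn⟩, rfl⟩ := Quotient.exists_rep a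
  obtain ⟨n', hn', ⟨e⟩⟩ := hQ' V n hn
  have : IsIso e.hom.right := inferInstanceAs (IsIso ((Under.forget _).map e.hom))
  have hn'' : FinDiag U n'.hom :=
    hn.of_isPushout (IsPushout.of_horiz_isIso (f := 𝟙 _) (inr := e.hom.right)
      ⟨(Category.id_comp _).trans (Under.w e.hom).symm⟩)
  exact ⟨⟨V, ⟨n', hn'⟩, hn''⟩, Quotient.sound ⟨BasicOpen.isoOfUnder hn'' hn e.symm⟩⟩

end FinDiag

/-! ### Local units -/

section Units

variable {A : Type u₁} [Category.{v} A] {B : Type u₂} [Category.{v} B] {U : A ⥤ B}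

/-- A morphism to an object `U(a)` factorizes through a local unit. -/
lemma exists_localUnit_fac (hU : IsRightMultiAdjoint U) {b : B} {a : A} (f : b ⟶ U.obj a) :
    ∃ (i : LocalUnits hU b) (u : (localUnit hU b i).right ⟶ a),
      (localUnit hU b i).hom ≫ U.map u = f := by
  obtain ⟨⟨⟨i, u⟩⟩, -⟩ := (hU b).choose_spec.choose_spec (StructuredArrow.mk f)
  exact ⟨i, u.right, StructuredArrow.w u⟩

lemma localUnit_fac_unique (hU : IsRightMultiAdjoint U) {b : B} {a : A} {i j : LocalUnits hU b}
    (u : (localUnit hU b i).right ⟶ a) (w : (localUnit hU b j).right ⟶ a)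
    (h : (localUnit hU b i).hom ≫ U.map u = (localUnit hU b j).hom ≫ U.map w) :
    (⟨i, u⟩ : Σ i : LocalUnits hU b, ((localUnit hU b i).right ⟶ a)) = ⟨j, w⟩ := by
  obtain ⟨h'⟩ := (hU b).choose_spec.choose_spec
    (StructuredArrow.mk ((localUnit hU b j).hom ≫ U.map w))
  let u' : localUnit hU b i ⟶ StructuredArrow.mk ((localUnit hU b j).hom ≫ U.map w) :=
    StructuredArrow.homMk u h
  let w' : localUnit hU b j ⟶ StructuredArrow.mk ((localUnit hU b j).hom ≫ U.map w) :=
    StructuredArrow.homMk w rfl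
  have := (h'.uniq ⟨i, u'⟩).trans (h'.uniq ⟨j, w'⟩).symm
  exact congrArg (fun t : Σ i, (localUnit hU b i ⟶ StructuredArrow.mk _) ↦
    (⟨t.1, t.2.right⟩ : Σ i : LocalUnits hU b, ((localUnit hU b i).right ⟶ a))) this

variable [IsLocallyFinitelyPresentable.{v} B] {hU : IsRightMultiAdjoint U}

lemma BelowUnit.essentiallySmall {b : B} (x : StructuredArrow b U) :
    EssentiallySmall.{v} (BelowUnit U x).FullSubcategory := by
  have := FinDiag.essentiallySmall U b
  have : ObjectProperty.EssentiallySmall.{v} (BelowUnit U x) :=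
    ObjectProperty.EssentiallySmall.of_le (Q := fun n : Under b ↦ FinDiag U n.hom) fun n h ↦ h.1
  infer_instance

/-- A local unit is, in the category of ambient objects, the colimit of the codomains of the
diagonally universal morphisms of finite presentation through which it factorizes; moreover
these factorizations are unique, hence are the morphisms of the colimit cocone. -/
lemma DiersCondition.exists_isColimit (hD : DiersCondition U hU) {b : B} (x : LocalUnits hU b) :
    IsFiltered (BelowUnit U (localUnit hU b x)).FullSubcategory ∧
    ∃ c : (BelowUnit U (localUnit hU b x)).ι ⋙ Under.forget b ⟶
        (Functor.const _).obj (U.obj (localUnit hU b x).right),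
      Nonempty (IsColimit (Cocone.mk _ c)) ∧
      (∀ n, n.obj.hom ≫ c.app n = (localUnit hU b x).hom) ∧
      ∀ (n : (BelowUnit U (localUnit hU b x)).FullSubcategory)
        (m : n.obj.right ⟶ U.obj (localUnit hU b x).right),
          n.obj.hom ≫ m = (localUnit hU b x).hom → m = c.app n := by
  obtain ⟨hf, c, ⟨hc⟩⟩ := hD b x
  have := BelowUnit.essentiallySmall (localUnit hU b x)
  let c' : (BelowUnit U (localUnit hU b x)).ι ⋙ Under.forget b ⟶
        (Functor.const _).obj (U.obj (localUnit hU b x).right) :=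
    { app := fun n ↦ (c.app n).right
      naturality := fun n n' f ↦ congrArg (·.right) (c.naturality f) }
  have hc' : IsColimit (Cocone.mk _ c') := isColimitOfPreserves (Under.forget b) hc
  have hw (n) : n.obj.hom ≫ c'.app n = (localUnit hU b x).hom := Under.w (c.app n)
  refine ⟨hf, c', ⟨hc'⟩, hw, fun n m hm ↦ ?_⟩
  let s : (Functor.const _).obj b ⟶ (BelowUnit U (localUnit hU b x)).ι ⋙ Under.forget b :=
    { app := fun n ↦ n.obj.hom
      naturality := fun n n' f ↦ (Category.id_comp _).trans (Under.w f.hom).symm }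
  obtain ⟨j, q, hq, rfl⟩ := n.property.1.exists_hom_of_isColimit hc' s m
    fun j ↦ (hw j).trans hm.symm
  let q' : n ⟶ j := ObjectProperty.homMk (Under.homMk q hq)
  exact (c'.naturality q').trans (Category.comp_id _)

/-- Factorizations through a diagonally universal morphism of finite presentation are unique. -/
lemma DiersCondition.fac_unique (hD : DiersCondition U hU) {b e : B} {n : b ⟶ e}
    (hn : FinDiag U n) {a : A} {f g : e ⟶ U.obj a} (h : n ≫ f = n ≫ g) : f = g := by
  obtain ⟨i, u, hu⟩ := exists_localUnit_fac hU (n ≫ f)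
  obtain ⟨d, ⟨hd, hd'⟩, -⟩ := hn.diagonallyUniversal u _ f hu
  obtain ⟨d', ⟨hd₁, hd₁'⟩, -⟩ := hn.diagonallyUniversal u _ g (hu.trans h)
  obtain ⟨-, c, -, -, hc⟩ := hD.exists_isColimit i
  let n' : (BelowUnit U (localUnit hU b i)).FullSubcategory := ⟨Under.mk n, hn, d, hd⟩
  rw [← hd', ← hd₁', hc n' d hd, hc n' d' hd₁]

/-- A family of morphisms from the objects of `𝒟_b` below a local unit, compatible with the
morphisms under `b`, descends to the codomain of the local unit. -/
lemma DiersCondition.exists_desc (hD : DiersCondition U hU) {b : B} (x : LocalUnits hU b) {e : B}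
    (τ : ∀ (n : Under b) (m : n.right ⟶ U.obj (localUnit hU b x).right), FinDiag U n.hom →
      n.hom ≫ m = (localUnit hU b x).hom → (n.right ⟶ e))
    (hτ : ∀ (n n' : Under b) (m : n.right ⟶ U.obj (localUnit hU b x).right)
      (m' : n'.right ⟶ U.obj (localUnit hU b x).right) (hn : FinDiag U n.hom)
      (hn' : FinDiag U n'.hom) (hm : n.hom ≫ m = (localUnit hU b x).hom)
      (hm' : n'.hom ≫ m' = (localUnit hU b x).hom) (f : n ⟶ n'),
      f.right ≫ τ n' m' hn' hm' = τ n m hn hm) :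
    ∃ d : U.obj (localUnit hU b x).right ⟶ e, ∀ (n : Under b)
      (m : n.right ⟶ U.obj (localUnit hU b x).right) (hn : FinDiag U n.hom)
      (hm : n.hom ≫ m = (localUnit hU b x).hom), m ≫ d = τ n m hn hm := by
  obtain ⟨-, c, ⟨hc⟩, hw, hu⟩ := hD.exists_isColimit x
  refine ⟨hc.desc (Cocone.mk e
    { app := fun n ↦ τ n.obj (c.app n) n.property.1 (hw n)
      naturality := fun n n' f ↦ (hτ _ _ _ _ _ _ _ _ f.hom).trans
        (Category.comp_id _).symm }), fun n m hn hm ↦ ?_⟩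
  let n' : (BelowUnit U (localUnit hU b x)).FullSubcategory := ⟨n, hn, m, hm⟩
  have h : ∀ (m' : n.right ⟶ _) (h' : n.hom ≫ m' = _), m = m' → τ n m' hn h' = τ n m hn hm := by
    rintro _ _ rfl; rfl
  have e := hu n' m hm
  exact (congrArg (· ≫ _) e).trans ((hc.fac _ n').trans (h _ (hw n') e))

lemma DiersCondition.hom_ext (hD : DiersCondition U hU) {b : B} (x : LocalUnits hU b) {e : B}
    {f g : U.obj (localUnit hU b x).right ⟶ e}
    (h : ∀ (n : Under b) (m : n.right ⟶ U.obj (localUnit hU b x).right), FinDiag U n.hom →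
      n.hom ≫ m = (localUnit hU b x).hom → m ≫ f = m ≫ g) : f = g := by
  obtain ⟨-, c, ⟨hc⟩, hw, -⟩ := hD.exists_isColimit x
  exact hc.hom_ext fun n ↦ h n.obj (c.app n) n.property.1 (hw n)

end Units

/-! ### Basic open sets around a point -/

section Stages

open TopCat

variable {A : Type u₁} [Category.{v} A] {B : Type u₂} [Category.{v} B]
  [IsLocallyFinitelyPresentable.{v} B] {U : A ⥤ B} {X : SheafedSpace.{u₂, v, v} B}

/-- A diagonally universal morphism of finite presentation under a stalk is induced by one under
the sections over some neighbourhood. -/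
lemma BasicOpen.exists_isPushout {x : X.carrier} {W : Opens X.carrier} (hx : x ∈ W) {e : B}
    {n : X.presheaf.stalk x ⟶ e} (hn : FinDiag U n) :
    ∃ (a : BasicOpen U X) (_ : a.V ≤ W) (hx : x ∈ a.V) (g : a.n.right ⟶ e),
      IsPushout (X.presheaf.germ a.V x hx) a.n.hom n g := by
  obtain ⟨k, k', l, f, f', hk, hk', hl, sq⟩ := hn
  obtain ⟨V, hVW, hV, q, rfl⟩ := exists_germ_eq_of_finitelyPresentable X.presheaf hk f W hx
  have sq' : IsPushout q l (pushout.inl q l) (pushout.inr q l) := IsPushout.of_hasPushout q l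
  have e₁ : q ≫ X.presheaf.germ V x hV ≫ n = l ≫ f' := by rw [← Category.assoc, sq.w]
  have hn' : FinDiag U (pushout.inl q l) := ⟨k, k', l, q, _, hk, hk', hl, sq'⟩
  refine ⟨⟨V, Under.mk (pushout.inl q l), hn'⟩, hVW, hV, sq'.desc _ _ e₁, ?_⟩
  exact IsPushout.of_left (by rwa [sq'.inr_desc]) (sq'.inl_desc _ _ _).symm sq'

/-- The case `V ⊆ V'` of `BasicOpen.exists_hom_stage`. The pushout to the stalk is the filtered
colimit of the pushouts to the sections over the smaller neighbourhoods of `x`, to which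
the finite presentability of `n'` applies. -/
lemma BasicOpen.exists_hom_stage_of_le {x : X.carrier} {e : B} {n : X.presheaf.stalk x ⟶ e}
    {a : BasicOpen U X} (hx : x ∈ a.V) {g : a.n.right ⟶ e}
    (sq : IsPushout (X.presheaf.germ a.V x hx) a.n.hom n g) {a' : BasicOpen U X}
    (hx' : x ∈ a'.V) (haa' : a.V ≤ a'.V) (h' : a'.n.right ⟶ e)
    (hh' : a'.n.hom ≫ h' = X.presheaf.germ a'.V x hx' ≫ n) :
    ∃ (b : BasicOpen U X) (f : a ⟶ b) (f' : a' ⟶ b) (hb : x ∈ b.V) (g' : b.n.right ⟶ e),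
      IsPushout (X.presheaf.map (homOfLE (BasicOpen.Hom.le f)).op) a.n.hom b.n.hom
          (BasicOpen.Hom.hom f) ∧
        BasicOpen.Hom.hom f ≫ g' = g ∧ BasicOpen.Hom.hom f' ≫ g' = h' ∧
          b.n.hom ≫ g' = X.presheaf.germ b.V x hb ≫ n := by
  let D := (OpenNhds.inclusion x).op ⋙ X.presheaf
  let j₀ : (OpenNhds x)ᵒᵖ := op ⟨a.V, hx⟩
  let m : D.obj j₀ ⟶ a.n.right := a.n.hom
  have : PreservesColimitsOfSize.{v, v} (Under.pushout m) :=
    (Under.mapPushoutAdj m).leftAdjoint_preservesColimits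
  have hc := isColimitOfPreserves (Under.forget _) (isColimitOfPreserves (Under.pushout m)
    ((colimit.isColimit D).underPost j₀))
  have hgerm (j : Under j₀) : D.map j.hom ≫ X.presheaf.germ j.right.unop.1 x j.right.unop.2 =
      X.presheaf.germ a.V x hx := X.presheaf.germ_res j.hom.unop x j.right.unop.2
  let s : (Functor.const _).obj (X.presheaf.obj (op a'.V)) ⟶
      (Under.post (X := j₀) D ⋙ Under.pushout m) ⋙ Under.forget _ :=
    { app := fun j ↦ X.presheaf.map (homOfLE haa').op ≫ D.map j.hom ≫
        pushout.inl (D.map j.hom) m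
      naturality := fun j j' u ↦ by
        have h₁ : D.map j.hom ≫ D.map u.right = D.map j'.hom :=
          (D.map_comp _ _).symm.trans (congrArg D.map (Under.w u))
        refine (Category.id_comp _).trans ?_
        refine Eq.trans ?_ (Category.assoc _ _ _).symm
        refine congrArg (X.presheaf.map (homOfLE haa').op ≫ ·) ?_
        refine Eq.trans ?_ (Category.assoc _ _ _).symm
        refine Eq.trans ?_ (congrArg (D.map j.hom ≫ ·) (pushout.inl_desc _ _ _).symm)
        exact (congrArg (· ≫ pushout.inl (D.map j'.hom) m) h₁.symm).trans (Category.assoc _ _ _) }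
  let i : e ≅ pushout (X.presheaf.germ a.V x hx) m := sq.isoPushout
  obtain ⟨j, q, hq, hq'⟩ := a'.finDiag.exists_hom_of_isColimit hc s (h' ≫ i.hom) fun j ↦ by
    have h₁ : n ≫ i.hom = pushout.inl (X.presheaf.germ a.V x hx) m := sq.inl_isoPushout_hom
    have h₂ : a'.n.hom ≫ h' ≫ i.hom = X.presheaf.germ a'.V x hx' ≫
        pushout.inl (X.presheaf.germ a.V x hx) m := by
      rw [← Category.assoc, hh', Category.assoc, h₁]
    refine Eq.trans ?_ h₂.symm
    refine (Category.assoc _ _ _).trans ?_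
    rw [← X.presheaf.germ_res (homOfLE haa') x hx]
    refine Eq.trans (congrArg (X.presheaf.map (homOfLE haa').op ≫ ·) ?_)
      (Category.assoc _ _ _).symm
    refine (Category.assoc _ _ _).trans ?_
    refine (congrArg (D.map j.hom ≫ ·) (pushout.inl_desc _ _ _)).trans ?_
    exact (Category.assoc _ _ _).symm.trans
      (congrArg (· ≫ pushout.inl (X.presheaf.germ a.V x hx) m) (hgerm j))
  let b : BasicOpen U X :=
    { V := j.right.unop.1
      n := Under.mk (pushout.inl (D.map j.hom) m)
      finDiag := a.finDiag.of_isPushout (IsPushout.of_hasPushout _ _) }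
  have hle : b.V ≤ a.V := leOfHom j.hom.unop
  let f : a ⟶ b :=
    { le := hle
      hom := pushout.inr (D.map j.hom) m
      w := pushout.condition.symm }
  let f' : a' ⟶ b :=
    { le := hle.trans haa'
      hom := q
      w := hq.trans ((Category.assoc _ _ _).symm.trans (congrArg
        (· ≫ pushout.inl (D.map j.hom) m) (X.presheaf.map_comp (homOfLE haa').op _).symm)) }
  have hb : x ∈ b.V := j.right.unop.2
  have h₃ : D.map j.hom ≫ X.presheaf.germ b.V x hb ≫ n = m ≫ g :=
    (Category.assoc _ _ _).symm.trans ((congrArg (· ≫ n) (hgerm j)).trans sq.w)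
  refine ⟨b, f, f', hb, pushout.desc (X.presheaf.germ b.V x hb ≫ n) g h₃,
    IsPushout.of_hasPushout _ _, pushout.inr_desc _ _ _, ?_, pushout.inl_desc _ _ _⟩
  refine (cancel_mono i.hom).1 (Eq.trans ?_ hq')
  refine (Category.assoc _ _ _).trans (congrArg (q ≫ ·) (pushout.hom_ext ?_ ?_))
  · refine (pushout.inl_desc_assoc _ _ _ _).trans ((Category.assoc _ _ _).trans ?_)
    exact (congrArg (_ ≫ ·) sq.inl_isoPushout_hom).trans (pushout.inl_desc _ _ _).symm
  · refine (pushout.inr_desc_assoc _ _ _ _).trans (sq.inr_isoPushout_hom.trans ?_)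
    exact (pushout.inr_desc _ _ _).symm

/-- The pushout of `n` to the sections over a smaller neighbourhood of `x` has the same pushout
to the stalk at `x`. -/
lemma BasicOpen.exists_restrict {x : X.carrier} {e : B} {n : X.presheaf.stalk x ⟶ e}
    {a : BasicOpen U X} (hx : x ∈ a.V) {g : a.n.right ⟶ e}
    (sq : IsPushout (X.presheaf.germ a.V x hx) a.n.hom n g) (W : Opens X.carrier) (hW : W ≤ a.V)
    (hxW : x ∈ W) :
    ∃ (n' : Under (X.presheaf.obj (op W))) (_ : FinDiag U n'.hom) (f : a.n.right ⟶ n'.right)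
      (g' : n'.right ⟶ e), IsPushout (X.presheaf.map (homOfLE hW).op) a.n.hom n'.hom f ∧
        f ≫ g' = g ∧ IsPushout (X.presheaf.germ W x hxW) n'.hom n g' := by
  have hg := X.presheaf.germ_res (homOfLE hW) x hxW
  have sq₁ := IsPushout.of_hasPushout (X.presheaf.map (homOfLE hW).op) a.n.hom
  have e₁ : X.presheaf.map (homOfLE hW).op ≫ X.presheaf.germ W x hxW ≫ n = a.n.hom ≫ g := by
    rw [← Category.assoc, hg, sq.w]
  refine ⟨Under.mk (pushout.inl _ _), a.finDiag.of_isPushout sq₁, pushout.inr _ _,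
    pushout.desc _ _ e₁, sq₁, pushout.inr_desc _ _ _, ?_⟩
  refine IsPushout.of_left ?_ (pushout.inl_desc _ _ _).symm sq₁
  rw [hg, pushout.inr_desc]
  exact sq

/-- Suppose that the pushout of an index `a` to the stalk at `x` is `n`. Then any morphism from the
codomain of another index `a'` to the codomain of `n`, compatible with `n`, is defined over some
neighbourhood: it comes from a morphism to the pushout `b` of `a` to the sections there. -/
lemma BasicOpen.exists_hom_stage {x : X.carrier} {e : B} {n : X.presheaf.stalk x ⟶ e}
    {a : BasicOpen U X} (hx : x ∈ a.V) {g : a.n.right ⟶ e}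
    (sq : IsPushout (X.presheaf.germ a.V x hx) a.n.hom n g) {a' : BasicOpen U X}
    (hx' : x ∈ a'.V) (h' : a'.n.right ⟶ e)
    (hh' : a'.n.hom ≫ h' = X.presheaf.germ a'.V x hx' ≫ n) :
    ∃ (b : BasicOpen U X) (f : a ⟶ b) (f' : a' ⟶ b) (hb : x ∈ b.V) (g' : b.n.right ⟶ e),
      IsPushout (X.presheaf.map (homOfLE (BasicOpen.Hom.le f)).op) a.n.hom b.n.hom
          (BasicOpen.Hom.hom f) ∧
        BasicOpen.Hom.hom f ≫ g' = g ∧ BasicOpen.Hom.hom f' ≫ g' = h' ∧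
          b.n.hom ≫ g' = X.presheaf.germ b.V x hb ≫ n := by
  have hxW : x ∈ a.V ⊓ a'.V := ⟨hx, hx'⟩
  obtain ⟨n₁, hn₁, k, g₁, sq₁, hk, sq₂⟩ := BasicOpen.exists_restrict hx sq _ inf_le_left hxW
  let a₁ : BasicOpen U X := ⟨a.V ⊓ a'.V, n₁, hn₁⟩
  let k' : a ⟶ a₁ := ⟨inf_le_left, k, sq₁.w.symm⟩
  obtain ⟨b, f, f', hb, g', sq₃, h₁, h₂, h₃⟩ := BasicOpen.exists_hom_stage_of_le (a := a₁) hxW sq₂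
    hx' inf_le_right h' hh'
  refine ⟨b, k' ≫ f, f', hb, g', ?_, ?_, h₂, h₃⟩
  · have := sq₁.paste_horiz sq₃
    rwa [← X.presheaf.map_comp] at this
  · exact (Category.assoc _ _ _).trans ((congrArg (k ≫ ·) h₁).trans hk)

end Stages

section Lift

open TopCat

variable {A : Type u₁} [Category.{v} A] {B : Type u₂} [Category.{v} B]
  [IsLocallyFinitelyPresentable.{v} B] {U : A ⥤ B} {X : SheafedSpace.{u₂, v, v} B}

/-- The morphism `(V, 𝟙) ⟶ (V, n)` given by `n`. -/
def BasicOpen.fromOfOpens (a : BasicOpen U X) : BasicOpen.ofOpens U X a.V ⟶ a where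
  le := le_rfl
  hom := a.n.hom
  w := (Category.id_comp _).trans ((Category.id_comp _).symm.trans
    (congrArg (· ≫ a.n.hom) (X.presheaf.map_id (op a.V)).symm))

variable {x : X.carrier} {c : A}

/-- A morphism from the stalk at `x` to an object `U(c)` factorizes through `(V, n)` when `x`
belongs to `V` and the induced morphism on the sections over `V` factorizes through `n`. For
a local unit this means that the corresponding point belongs to `D_(V,n)`. -/
def BasicOpen.Fac (a : BasicOpen U X) (φ : X.presheaf.stalk x ⟶ U.obj c) : Prop :=
  ∃ (hx : x ∈ a.V) (m : a.n.right ⟶ U.obj c), a.n.hom ≫ m = X.presheaf.germ a.V x hx ≫ φ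

variable {φ : X.presheaf.stalk x ⟶ U.obj c}

/-- The factorization through `n`; it is chosen here, and unique by `BasicOpen.eq_lift`
in a Diers context. -/
def BasicOpen.lift (a : BasicOpen U X) (h : a.Fac φ) : a.n.right ⟶ U.obj c :=
  h.choose_spec.choose

lemma BasicOpen.Fac.mem {a : BasicOpen U X} (h : a.Fac φ) : x ∈ a.V := h.choose

lemma BasicOpen.comp_lift (a : BasicOpen U X) (h : a.Fac φ) :
    a.n.hom ≫ a.lift h = X.presheaf.germ a.V x h.mem ≫ φ :=
  h.choose_spec.choose_spec

lemma BasicOpen.fac_ofOpens {V : Opens X.carrier} (hV : x ∈ V) (φ : X.presheaf.stalk x ⟶ U.obj c) :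
    (BasicOpen.ofOpens U X V).Fac φ :=
  ⟨hV, X.presheaf.germ V x hV ≫ φ, Category.id_comp _⟩

lemma BasicOpen.lift_ofOpens {V : Opens X.carrier} (hV : x ∈ V)
    (h : (BasicOpen.ofOpens U X V).Fac φ) :
    (BasicOpen.ofOpens U X V).lift h = X.presheaf.germ V x hV ≫ φ :=
  (Category.id_comp _).symm.trans (BasicOpen.comp_lift (BasicOpen.ofOpens U X V) h)

variable {hU : IsRightMultiAdjoint U}

lemma BasicOpen.eq_lift (hD : DiersCondition U hU) (a : BasicOpen U X) (h : a.Fac φ)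
    (m : a.n.right ⟶ U.obj c) (hm : a.n.hom ≫ m = X.presheaf.germ a.V x h.mem ≫ φ) :
    m = a.lift h :=
  hD.fac_unique a.finDiag (hm.trans (a.comp_lift h).symm)

lemma BasicOpen.hom_comp_lift (hD : DiersCondition U hU) {a b : BasicOpen U X} (f : a ⟶ b)
    (ha : a.Fac φ) (hb : b.Fac φ) : BasicOpen.Hom.hom f ≫ b.lift hb = a.lift ha :=
  a.eq_lift hD ha _ (opens_aux (X.presheaf.germ_res (homOfLE (BasicOpen.Hom.le f)) x hb.mem)
    (BasicOpen.Hom.w f) (b.comp_lift hb))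

/-- The codomain of the local unit of a point of the Diers space is the colimit of the
codomains `cod n` for the basic open neighbourhoods `D_(V,n)` of the point: it is that of
the codomains of the objects of `𝒟_b` below the local unit, for `b` the stalk, and each of these
is a pushout of some `n` under the sections over a neighbourhood. -/
lemma BasicOpen.existsUnique_desc (hD : DiersCondition U hU)
    (ξ : LocalUnits hU (X.presheaf.stalk x)) {e : B}
    (t : ∀ a : BasicOpen U X, a.Fac (localUnit hU _ ξ).hom → (a.n.right ⟶ e))
    (ht : ∀ ⦃a b : BasicOpen U X⦄ (f : a ⟶ b) (ha : a.Fac (localUnit hU _ ξ).hom)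
      (hb : b.Fac (localUnit hU _ ξ).hom), BasicOpen.Hom.hom f ≫ t b hb = t a ha) :
    ∃! d : U.obj (localUnit hU (X.presheaf.stalk x) ξ).right ⟶ e,
      ∀ (a : BasicOpen U X) (ha : a.Fac (localUnit hU _ ξ).hom), a.lift ha ≫ d = t a ha := by
  refine existsUnique_of_exists_of_unique ?_ fun d d' h h' ↦ ?_
  · obtain ⟨tx, htx⟩ := exists_stalk_desc X.presheaf x
      (fun V hV ↦ t (BasicOpen.ofOpens U X V) (BasicOpen.fac_ofOpens hV _))
      (fun V W h hV hW ↦ ht (BasicOpen.ofOpensHom U X h) _ _)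
    have htx' (a : BasicOpen U X) (ha : a.Fac (localUnit hU _ ξ).hom) :
        X.presheaf.germ a.V x ha.mem ≫ tx = a.n.hom ≫ t a ha :=
      (htx a.V ha.mem).trans (ht a.fromOfOpens _ ha).symm
    -- the morphism on the codomain of an `n` under the stalk, determined by all the indices which
    -- map to `n`
    have key (n : Under (X.presheaf.stalk x)) (m : n.right ⟶ U.obj (localUnit hU _ ξ).right)
        (hn : FinDiag U n.hom) (hm : n.hom ≫ m = (localUnit hU _ ξ).hom) :
        ∃ τ : n.right ⟶ e, n.hom ≫ τ = tx ∧ ∀ (a' : BasicOpen U X)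
          (ha' : a'.Fac (localUnit hU _ ξ).hom) (h' : a'.n.right ⟶ n.right),
            a'.n.hom ≫ h' = X.presheaf.germ a'.V x ha'.mem ≫ n.hom → h' ≫ τ = t a' ha' := by
      obtain ⟨a, -, hx, g, sq⟩ := BasicOpen.exists_isPushout (Opens.mem_top x) hn
      have mem (b : BasicOpen U X) (hb : x ∈ b.V) (g' : b.n.right ⟶ n.right)
          (hg' : b.n.hom ≫ g' = X.presheaf.germ b.V x hb ≫ n.hom) : b.Fac (localUnit hU _ ξ).hom :=
        ⟨hb, g' ≫ m, by rw [← Category.assoc, hg', Category.assoc, hm]⟩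
      have ha := mem a hx g sq.w.symm
      refine ⟨sq.desc tx (t a ha) (htx' a ha), sq.inl_desc _ _ _, fun a' ha' h' hh' ↦ ?_⟩
      obtain ⟨b, f, f', hb, g', sq', h₁, h₂, h₃⟩ :=
        BasicOpen.exists_hom_stage hx sq ha'.mem h' hh'
      have hb' := mem b hb g' h₃
      have h₄ : g' ≫ sq.desc tx (t a ha) (htx' a ha) = t b hb' := by
        refine sq'.hom_ext ?_ ?_
        · rw [← Category.assoc, h₃, Category.assoc, sq.inl_desc]
          exact htx' b hb'
        · rw [← Category.assoc, h₁, sq.inr_desc]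
          exact (ht f ha hb').symm
      rw [← h₂, Category.assoc, h₄]
      exact ht f' ha' hb'
    choose τ hτ hτ' using key
    obtain ⟨d, hd⟩ := hD.exists_desc ξ τ fun n n' m m' hn hn' hm hm' f ↦ by
      obtain ⟨a, -, hx, g, sq⟩ := BasicOpen.exists_isPushout (Opens.mem_top x) hn
      have ha : a.Fac (localUnit hU _ ξ).hom :=
        ⟨hx, g ≫ m, by rw [← Category.assoc, ← sq.w, Category.assoc, hm]⟩
      refine sq.hom_ext ?_ ?_
      · rw [← Category.assoc, Under.w f, hτ, hτ]
      · rw [← Category.assoc, hτ' n' m' hn' hm' a ha (g ≫ f.right) (by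
          rw [← Category.assoc, ← sq.w, Category.assoc, Under.w f]),
          hτ' n m hn hm a ha g sq.w.symm]
    refine ⟨d, fun a ha ↦ ?_⟩
    have sq := IsPushout.of_hasPushout (X.presheaf.germ a.V x ha.mem) a.n.hom
    let m : pushout (X.presheaf.germ a.V x ha.mem) a.n.hom ⟶ U.obj (localUnit hU _ ξ).right :=
      pushout.desc (localUnit hU _ ξ).hom (a.lift ha) (a.comp_lift ha).symm
    have hn : FinDiag U (Under.mk (pushout.inl (X.presheaf.germ a.V x ha.mem) a.n.hom)).hom :=
      a.finDiag.of_isPushout sq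
    have hm : pushout.inr _ _ ≫ m = a.lift ha := pushout.inr_desc _ _ _
    have hm' : pushout.inl _ _ ≫ m = (localUnit hU _ ξ).hom := pushout.inl_desc _ _ _
    have h₁ := hd (Under.mk (pushout.inl (X.presheaf.germ a.V x ha.mem) a.n.hom)) m hn hm'
    rw [← hm, Category.assoc]
    exact (congrArg (pushout.inr _ _ ≫ ·) h₁).trans (hτ' _ m hn hm' a ha _ sq.w.symm)
  · refine hD.hom_ext ξ fun n m hn hm ↦ ?_
    obtain ⟨a, -, hx, g, sq⟩ := BasicOpen.exists_isPushout (Opens.mem_top x) hn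
    have hm₁ : a.n.hom ≫ g ≫ m = X.presheaf.germ a.V x hx ≫ (localUnit hU _ ξ).hom := by
      rw [← Category.assoc, ← sq.w, Category.assoc, hm]
    have ha : a.Fac (localUnit hU _ ξ).hom := ⟨hx, g ≫ m, hm₁⟩
    have hξ : (localUnit hU _ ξ).hom ≫ d = (localUnit hU _ ξ).hom ≫ d' := by
      refine Presheaf.stalk_hom_ext _ fun V hV ↦ ?_
      have e₁ := BasicOpen.lift_ofOpens hV (BasicOpen.fac_ofOpens hV (localUnit hU _ ξ).hom)
      refine (Category.assoc _ _ _).symm.trans (Eq.trans ?_ (Category.assoc _ _ _))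
      refine (congrArg (· ≫ d) e₁.symm).trans (Eq.trans ?_ (congrArg (· ≫ d') e₁))
      exact (h _ _).trans (h' _ _).symm
    refine sq.hom_ext ?_ ?_
    · rw [← Category.assoc, ← Category.assoc, hm]
      exact hξ
    · rw [← Category.assoc, ← Category.assoc, BasicOpen.eq_lift hD a ha _ hm₁, h, h']

end Lift

/-! ### Existence of the spectrum -/

section StalkOfKan

open TopCat

variable {B : Type u₂} [Category.{v} B] [HasColimits B] {Y : TopCat.{v}}
  {I : Type*} [Category* I] {D : I ⥤ (Opens Y)ᵒᵖ} {F : I ⥤ B} {P S : Y.Presheaf B}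
  (ζ : F ⟶ D ⋙ P) (γ : P ⟶ S)

lemma map_comp_germ (p : Y) {i j : I} (f : i ⟶ j) (hi : p ∈ (D.obj i).unop)
    (hj : p ∈ (D.obj j).unop) :
    F.map f ≫ ζ.app j ≫ γ.app (D.obj j) ≫ S.germ (D.obj j).unop p hj =
      ζ.app i ≫ γ.app (D.obj i) ≫ S.germ (D.obj i).unop p hi := by
  have h₁ := ζ.naturality_assoc f (γ.app (D.obj j) ≫ S.germ (D.obj j).unop p hj)
  have h₂ := γ.naturality_assoc (D.map f) (S.germ (D.obj j).unop p hj)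
  have h₃ : S.map (D.map f) ≫ S.germ (D.obj j).unop p hj = S.germ (D.obj i).unop p hi :=
    S.germ_res (D.map f).unop p hj
  rw [h₃] at h₂
  exact h₁.trans (congrArg (ζ.app i ≫ ·) h₂)

variable [HasTerminal B] [P.IsLeftKanExtension ζ]

/-- The stalk of the sheafification of a left Kan extension along `D` is the colimit of the `F i`
for the `i` such that `D i` contains the point: morphisms out of it are tested on
skyscraper sheaves. -/
lemma existsUnique_stalk_desc (hγ : (Opens.grothendieckTopology Y).W γ) (p : Y) {e : B}
    (t : ∀ i : I, p ∈ (D.obj i).unop → (F.obj i ⟶ e))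
    (ht : ∀ ⦃i j : I⦄ (f : i ⟶ j) (hi : p ∈ (D.obj i).unop) (hj : p ∈ (D.obj j).unop),
      F.map f ≫ t j hj = t i hi) :
    ∃! w : S.stalk p ⟶ e, ∀ (i : I) (hi : p ∈ (D.obj i).unop),
      ζ.app i ≫ γ.app (D.obj i) ≫ S.germ (D.obj i).unop p hi ≫ w = t i hi := by
  classical
  have hW := hγ (skyscraperPresheaf p e) (skyscraperPresheaf_isSheaf p e)
  refine existsUnique_of_exists_of_unique ?_ fun w w' h h' ↦ ?_
  · let β : P ⟶ skyscraperPresheaf p e := P.descOfIsLeftKanExtension ζ _ (skyscraperLift t ht)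
    obtain ⟨α, hα⟩ := hW.2 β
    have hα : γ ≫ α = β := hα
    obtain ⟨w, hw⟩ := exists_stalk_desc S p (fun V hV ↦ α.app (op V) ≫ skyπ p e (op V) hV)
      (fun V V' h hV hV' ↦ by
        rw [← Category.assoc, α.naturality, Category.assoc, map_skyπ])
    refine ⟨w, fun i hi ↦ ?_⟩
    have h₁ := congrArg (ζ.app i ≫ γ.app (D.obj i) ≫ ·) (hw (D.obj i).unop hi)
    refine h₁.trans ?_
    have h₂ : ζ.app i ≫ β.app (D.obj i) = (skyscraperLift t ht).app i :=
      P.descOfIsLeftKanExtension_fac_app ζ _ (skyscraperLift t ht) i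
    have h₃ : γ.app (D.obj i) ≫ α.app (D.obj i) = β.app (D.obj i) :=
      congrArg (fun k ↦ k.app (D.obj i)) hα
    rw [← skyscraperLift_app t ht i hi, ← h₂, ← h₃, Category.assoc, Category.assoc]
  · have hw (w : S.stalk p ⟶ e) : ∃ α : S ⟶ skyscraperPresheaf p e,
        ∀ V (hV : p ∈ V), α.app (op V) ≫ skyπ p e (op V) hV = S.germ V p hV ≫ w :=
      ⟨skyscraperLift (D := 𝟭 _) (fun V hV ↦ S.germ V.unop p hV ≫ w)
        (fun V V' f hV hV' ↦ (Category.assoc _ _ _).symm.trans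
          (congrArg (· ≫ w) (S.germ_res f.unop p hV'))),
        fun V hV ↦ skyscraperLift_app (D := 𝟭 _) _ _ (op V) hV⟩
    obtain ⟨α, hα⟩ := hw w
    obtain ⟨α', hα'⟩ := hw w'
    have e₁ : γ ≫ α = γ ≫ α' := by
      refine P.hom_ext_of_isLeftKanExtension ζ _ _ (skyscraper_natTrans_ext fun i hi ↦ ?_)
      have h₁ := h i hi
      have h₂ := h' i hi
      rw [← hα] at h₁
      rw [← hα'] at h₂
      simpa using h₁.trans h₂.symm
    have e₂ : α = α' := hW.1 e₁
    refine Presheaf.stalk_hom_ext _ fun V hV ↦ ?_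
    rw [← hα, ← hα', e₂]

lemma stalk_hom_ext_of_kan (hγ : (Opens.grothendieckTopology Y).W γ) (p : Y) {e : B}
    {w w' : S.stalk p ⟶ e} (h : ∀ (i : I) (hi : p ∈ (D.obj i).unop),
      (ζ.app i ≫ γ.app (D.obj i) ≫ S.germ (D.obj i).unop p hi) ≫ w =
        (ζ.app i ≫ γ.app (D.obj i) ≫ S.germ (D.obj i).unop p hi) ≫ w') : w = w' := by
  refine (existsUnique_stalk_desc ζ γ hγ p
    (fun i hi ↦ (ζ.app i ≫ γ.app (D.obj i) ≫ S.germ (D.obj i).unop p hi) ≫ w')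
    fun i j f hi hj ↦ ?_).unique (fun i hi ↦ Eq.trans ?_ (h i hi)) (fun i hi ↦ ?_)
  · rw [← Category.assoc, map_comp_germ ζ γ p f hi hj]
  · simp only [Category.assoc]
  · simp only [Category.assoc]

end StalkOfKan

section Existence

variable {A : Type u₁} [Category.{v} A] {B : Type u₂} [Category.{v} B]
  [IsLocallyFinitelyPresentable.{v} B] {U : A ⥤ B} {hU : IsRightMultiAdjoint U}

/-- The spectrum exists. The stalk at `(x, ξ)` and `U(A_ξ)` are both the colimit of the codomains
`cod n` for the `(V, n)` such that `ξ` factorizes through `n`. -/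
lemma exists_spectrumModel (hD : DiersCondition U hU) (X : SheafedSpace.{u₂, v, v} B) :
    Nonempty (SpectrumModel X hU) := by
  have := hasLimits_of_isLocallyFinitelyPresentable B
  have := hasWeakSheafify_of_isLocallyFinitelyPresentable B
    (Opens.grothendieckTopology (diersSpace X hU))
  have := BasicOpen.essentiallySmall (U := U) X
  have : (BasicOpen.D X hU).HasPointwiseLeftKanExtension (BasicOpen.cod U X) := fun V ↦ by
    have := hasColimitsOfShape_of_essentiallySmall.{v} (CostructuredArrow (BasicOpen.D X hU) V) B
    exact inferInstanceAs (HasColimit _)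
  let P : (diersSpace X hU).Presheaf B :=
    (BasicOpen.D X hU).leftKanExtension (BasicOpen.cod U X)
  let ζ : BasicOpen.cod U X ⟶ BasicOpen.D X hU ⋙ P :=
    (BasicOpen.D X hU).leftKanExtensionUnit (BasicOpen.cod U X)
  have hP : P.IsLeftKanExtension ζ := inferInstance
  let J := Opens.grothendieckTopology (diersSpace X hU)
  let S : (diersSpace X hU).Presheaf B := CategoryTheory.sheafify J P
  let γ : P ⟶ S := CategoryTheory.toSheafify J P
  have hγ : J.W γ := J.W_toSheafify P
  have key (p : DiersPoint X hU) : ∃ σ : TopCat.Presheaf.stalk (X := diersSpace X hU) S p ≅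
      U.obj p.localUnit.right, ∀ (a : BasicOpen U X) (hp : p ∈ a.points hU),
        ζ.app a ≫ γ.app (op (a.opens hU)) ≫ TopCat.Presheaf.germ (X := diersSpace X hU)
          S (a.opens hU) p hp ≫ σ.hom = a.lift (φ := p.localUnit.hom) hp := by
    obtain ⟨x, ξ⟩ := p
    let Y : TopCat.{v} := diersSpace X hU
    let p : Y := (⟨x, ξ⟩ : DiersPoint X hU)
    have hterm : HasTerminal B := inferInstance
    let g (a : BasicOpen U X) (ha : p ∈ a.opens hU) :
        a.n.right ⟶ TopCat.Presheaf.stalk (X := Y) S p :=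
      ζ.app a ≫ γ.app (op (a.opens hU)) ≫ TopCat.Presheaf.germ (X := Y) S (a.opens hU) p ha
    obtain ⟨w, hw, -⟩ := existsUnique_stalk_desc ζ γ hγ p
      (fun a ha ↦ a.lift (φ := (localUnit hU _ ξ).hom) ha)
      (fun a b f ha hb ↦ BasicOpen.hom_comp_lift hD f ha hb)
    have hw' (a : BasicOpen U X) (ha : p ∈ a.opens hU) :
        g a ha ≫ w = a.lift (φ := (localUnit hU _ ξ).hom) ha :=
      (Category.assoc _ _ _).trans
        ((congrArg (ζ.app a ≫ ·) (Category.assoc _ _ _)).trans (hw a ha))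
    obtain ⟨d, hd, -⟩ := BasicOpen.existsUnique_desc hD ξ g
      (fun a b f ha hb ↦ map_comp_germ ζ γ p f ha hb)
    refine ⟨⟨w, d, stalk_hom_ext_of_kan ζ γ hγ p fun a ha ↦ ?_, ?_⟩, hw⟩
    · refine (Category.assoc _ _ _).symm.trans ((congrArg (· ≫ d) (hw' a ha)).trans ?_)
      exact (hd a ha).trans (Category.comp_id _).symm
    · refine (BasicOpen.existsUnique_desc hD ξ (fun a ha ↦ a.lift ha)
        fun a b f ha hb ↦ BasicOpen.hom_comp_lift hD f ha hb).unique (fun a ha ↦ ?_)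
          fun a ha ↦ Category.comp_id _
      exact (Category.assoc _ _ _).symm.trans ((congrArg (· ≫ w) (hd a ha)).trans (hw' a ha))
  choose σ hσ using key
  exact ⟨
    { P := P
      ζ := ζ
      isLeftKanExtension := hP
      S := S
      isSheaf := (presheafToSheaf J B).obj P |>.property
      γ := γ
      isSheafification := hγ
      stalkIso := σ
      fac := fun a p hp ↦ (congrArg (a.n.hom ≫ ·) (hσ p a hp)).trans
        (a.comp_lift (φ := p.localUnit.hom) hp) }⟩

end Existence

/-! ### The universal property of the spectrum -/

section UniversalProperty

open TopCat

variable {A : Type u₁} [Category.{v} A] {B : Type u₂} [Category.{v} B]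
  [IsLocallyFinitelyPresentable.{v} B] {U : A ⥤ B} {hU : IsRightMultiAdjoint U}
  {X : SheafedSpace.{u₂, v, v} B}

/-- A morphism from `cod n` to a stalk, compatible with `φ`, is defined on a neighbourhood. -/
lemma BasicOpen.exists_section {T : SheafedSpace.{u₂, v, v} B} (φ : T ⟶ X) (a : BasicOpen U X)
    {y : T.carrier} (hy : φ.hom.base y ∈ a.V) (m : a.n.right ⟶ T.presheaf.stalk y)
    (hm : a.n.hom ≫ m = X.presheaf.germ a.V _ hy ≫ φ.hom.stalkMap y) :
    ∃ (W : Opens T.carrier) (hW : W ≤ (Opens.map φ.hom.base).obj a.V) (hyW : y ∈ W)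
      (q : a.n.right ⟶ T.presheaf.obj (op W)),
        a.n.hom ≫ q = φ.hom.c.app (op a.V) ≫ T.presheaf.map (homOfLE hW).op ∧
          q ≫ T.presheaf.germ W y hyW = m := by
  obtain ⟨k, k', l, f, f', hk, hk', hl, sq⟩ := a.finDiag
  have hy' : y ∈ (Opens.map φ.hom.base).obj a.V := hy
  have h₀ : X.presheaf.germ a.V _ hy ≫ φ.hom.stalkMap y =
    φ.hom.c.app (op a.V) ≫ T.presheaf.germ ((Opens.map φ.hom.base).obj a.V) y hy' :=
      PresheafedSpace.stalkMap_germ φ.hom a.V y hy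
  obtain ⟨W₁, hW₁, hyW₁, q, hq⟩ := exists_germ_eq_of_finitelyPresentable T.presheaf hk'
    (f' ≫ m) _ hy'
  obtain ⟨s, hs'⟩ : ∃ s : X.presheaf.obj (op a.V) ⟶ T.presheaf.obj (op W₁),
    s = φ.hom.c.app (op a.V) ≫ T.presheaf.map (homOfLE hW₁).op := ⟨_, rfl⟩
  have hs : s ≫ T.presheaf.germ W₁ y hyW₁ = a.n.hom ≫ m := by
    rw [hs']
    exact (Category.assoc _ _ _).trans ((congrArg (φ.hom.c.app (op a.V) ≫ ·)
      (T.presheaf.germ_res (homOfLE hW₁) y hyW₁)).trans (h₀.symm.trans hm.symm))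
  obtain ⟨W, hW, hyW, e⟩ := exists_res_eq_of_finitelyPresentable T.presheaf hk hyW₁
    (f ≫ s) (l ≫ q) (by
      rw [Category.assoc, Category.assoc, hq, hs, ← Category.assoc, sq.w, Category.assoc])
  rw [Category.assoc, Category.assoc] at e
  refine ⟨W, hW.trans hW₁, hyW, sq.desc _ _ e, (sq.inl_desc _ _ _).trans ?_, sq.hom_ext ?_ ?_⟩
  · rw [hs']
    exact (Category.assoc _ _ _).trans
      (congrArg (φ.hom.c.app (op a.V) ≫ ·) (T.presheaf.map_comp _ _).symm)
  · rw [sq.inl_desc_assoc, Category.assoc, T.presheaf.germ_res, hs]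
  · rw [sq.inr_desc_assoc, Category.assoc, T.presheaf.germ_res, hq]

/-- A morphism to `U(c)` factorizes through `(V, n)` if and only if the local unit through which it
factorizes does. -/
lemma BasicOpen.fac_comp_iff {x : X.carrier} {c c' : A} (a : BasicOpen U X)
    (φ : X.presheaf.stalk x ⟶ U.obj c) (u : c ⟶ c') : a.Fac (φ ≫ U.map u) ↔ a.Fac φ := by
  refine ⟨fun ⟨hx, m, hm⟩ ↦ ?_, fun ⟨hx, m, hm⟩ ↦ ⟨hx, m ≫ U.map u, ?_⟩⟩
  · obtain ⟨d, ⟨hd, -⟩, -⟩ := a.finDiag.diagonallyUniversal u (X.presheaf.germ a.V x hx ≫ φ) m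
      ((Category.assoc _ _ _).trans hm.symm)
    exact ⟨hx, d, hd⟩
  · rw [← Category.assoc, hm, Category.assoc]

namespace SpectrumModel

variable (M : SpectrumModel X hU)

/-- The morphism from `cod n` to the stalk of the structural sheaf at a point of `D_(V,n)`. -/
def toStalk (a : BasicOpen U X) (p : diersSpace X hU) (hp : p ∈ a.opens hU) :
    a.n.right ⟶ M.S.stalk p :=
  M.ζ.app a ≫ M.γ.app (op (a.opens hU)) ≫ M.S.germ (a.opens hU) p hp

lemma toStalk_stalkIso (hD : DiersCondition U hU) (a : BasicOpen U X) (p : DiersPoint X hU)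
    (hp : p ∈ a.points hU) :
    M.toStalk a p hp ≫ (M.stalkIso p).hom = a.lift (φ := p.localUnit.hom) hp := by
  refine BasicOpen.eq_lift hD a (φ := p.localUnit.hom) hp _ (Eq.trans ?_ (M.fac a p hp))
  exact congrArg (a.n.hom ≫ ·) ((Category.assoc _ _ _).trans
    (congrArg (M.ζ.app a ≫ ·) (Category.assoc _ _ _)))

lemma stalk_hom_ext {p : diersSpace X hU} {e : B} {w w' : M.S.stalk p ⟶ e}
    (h : ∀ (a : BasicOpen U X) (hp : p ∈ a.opens hU),
      M.toStalk a p hp ≫ w = M.toStalk a p hp ≫ w') : w = w' := by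
  have := M.isLeftKanExtension
  have := hasLimits_of_isLocallyFinitelyPresentable B
  exact stalk_hom_ext_of_kan M.ζ M.γ M.isSheafification p h

variable {T : USpace U}

/-- The effect on stalks of a morphism to the spectrum, in terms of sections. -/
lemma toStalk_stalkMap (χ : T.toSheafedSpace ⟶ M.toUSpace.toSheafedSpace) (a : BasicOpen U X)
    (y : T.carrier) (hy : χ.hom.base y ∈ a.opens hU) :
    M.toStalk a (χ.hom.base y) hy ≫ χ.hom.stalkMap y =
      (M.ζ.app a ≫ M.γ.app (op (a.opens hU)) ≫ χ.hom.c.app (op (a.opens hU))) ≫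
        T.presheaf.germ ((Opens.map χ.hom.base).obj (a.opens hU)) y hy := by
  have h : M.S.germ (a.opens hU) (χ.hom.base y) hy ≫ χ.hom.stalkMap y =
      χ.hom.c.app (op (a.opens hU)) ≫
        T.presheaf.germ ((Opens.map χ.hom.base).obj (a.opens hU)) y hy :=
    PresheafedSpace.stalkMap_germ χ.hom (a.opens hU) y hy
  refine Eq.trans ?_ ((congrArg (fun k ↦ M.ζ.app a ≫ M.γ.app (op (a.opens hU)) ≫ k) h).trans ?_)
  · exact (Category.assoc _ _ _).trans (congrArg (M.ζ.app a ≫ ·) (Category.assoc _ _ _))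
  · exact (congrArg (M.ζ.app a ≫ ·) (Category.assoc _ _ _).symm).trans (Category.assoc _ _ _).symm

/-- Morphisms of `U`-spaces to the spectrum are determined by their effect on the points and on the
local objects. -/
lemma hom_ext {χ χ' : M.toUSpace ⟶ T}
    (h : ∀ y : T.carrier, (⟨χ.toHom.hom.base y, χ.loc y⟩ :
      Σ p : DiersPoint X hU, (p.localUnit.right ⟶ T.loc y)) = ⟨χ'.toHom.hom.base y, χ'.loc y⟩) :
    χ = χ' := by
  obtain ⟨⟨⟨g, c⟩⟩, l, hl⟩ := χ
  obtain ⟨⟨⟨g', c'⟩⟩, l', hl'⟩ := χ'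
  obtain rfl : g = g' := by
    ext y
    exact congrArg Sigma.fst (h y)
  obtain rfl : l = l' := funext fun y ↦ eq_of_heq (Sigma.mk.inj (h y)).2
  have h₁ : c = c' := by
    refine (M.isSheafification _ (Sheaf.pushforward_sheaf_of_sheaf g T.IsSheaf)).1 ?_
    have := M.isLeftKanExtension
    refine M.P.hom_ext_of_isLeftKanExtension M.ζ _ _ (NatTrans.ext (funext fun a ↦ ?_))
    refine hom_ext_of_germ_eq T.IsSheaf fun y hy ↦ ?_
    have e := M.toStalk_stalkMap (InducedCategory.homMk ⟨g, c⟩) a y hy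
    have e' := M.toStalk_stalkMap (InducedCategory.homMk ⟨g, c'⟩) a y hy
    refine e.symm.trans (Eq.trans ?_ e')
    refine congrArg (M.toStalk a (g y) hy ≫ ·) ?_
    exact (cancel_mono (T.stalkIso y).hom).1 ((hl y).trans (hl' y).symm)
  subst h₁
  rfl

lemma unitApp_germ (V : Opens X.carrier) (p : diersSpace X hU)
    (hp : p ∈ (Opens.map (diersProj X hU)).obj V) :
    M.unitApp V ≫ M.S.germ ((Opens.map (diersProj X hU)).obj V) p hp =
      M.toStalk (BasicOpen.ofOpens U X V) p (mem_ofOpens X hU hp) := by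
  let i : (Opens.map (diersProj X hU)).obj V ⟶ (BasicOpen.ofOpens U X V).opens hU :=
    homOfLE fun p hp ↦ mem_ofOpens X hU (p := p) hp
  have h₁ : M.P.map i.op ≫ M.γ.app _ = M.γ.app _ ≫ M.S.map i.op := M.γ.naturality i.op
  have h₂ := M.S.germ_res i p hp
  refine (Category.assoc _ _ _).trans (congrArg (M.ζ.app (BasicOpen.ofOpens U X V) ≫ ·) ?_)
  exact (congrArg (· ≫ _) h₁).trans ((Category.assoc _ _ _).trans (congrArg (_ ≫ ·) h₂))

/-- The unit induces on the stalks the local units. -/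
lemma stalkMap_unit (p : DiersPoint X hU) :
    M.unit.unop.hom.stalkMap p ≫ (M.stalkIso p).hom = p.localUnit.hom := by
  refine Presheaf.stalk_hom_ext _ fun V hV ↦ ?_
  have hV' : p ∈ (Opens.map (diersProj X hU)).obj V := hV
  have hp : p ∈ (BasicOpen.ofOpens U X V).points hU := mem_ofOpens X hU hV
  have h₁ : X.presheaf.germ V p.1 hV ≫ M.unit.unop.hom.stalkMap p =
      M.unitApp V ≫ M.S.germ ((Opens.map (diersProj X hU)).obj V) p hV' :=
    PresheafedSpace.stalkMap_germ M.unit.unop.hom V p hV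
  have h₂ : M.unitApp V ≫ M.S.germ ((Opens.map (diersProj X hU)).obj V) p hV' =
      M.toStalk (BasicOpen.ofOpens U X V) p hp := M.unitApp_germ V p hV
  have h₃ := M.fac (BasicOpen.ofOpens U X V) p hp
  refine (Category.assoc _ _ _).symm.trans
    ((congrArg (· ≫ (M.stalkIso p).hom) (h₁.trans h₂)).trans ?_)
  refine Eq.trans ?_ h₃
  refine Eq.trans ?_ (Category.id_comp _).symm
  exact (Category.assoc _ _ _).trans (congrArg (_ ≫ ·) (Category.assoc _ _ _))

/-- The points and the morphisms of local objects given by a morphism of `U`-spaces to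
the spectrum are determined by the underlying morphism to `X`. -/
lemma point_eq {φ : T.toSheafedSpace ⟶ X} {χ : M.toUSpace ⟶ T}
    (h : χ.toHom ≫ M.unit.unop = φ) (y : T.carrier)
    (ξ : LocalUnits hU (X.presheaf.stalk (φ.hom.base y)))
    (u : (SpectralDualities.localUnit hU _ ξ).right ⟶ T.loc y)
    (hu : (SpectralDualities.localUnit hU _ ξ).hom ≫ U.map u =
      φ.hom.stalkMap y ≫ (T.stalkIso y).hom) :
    (⟨χ.toHom.hom.base y, χ.loc y⟩ : Σ p : DiersPoint X hU, (p.localUnit.right ⟶ T.loc y)) =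
      ⟨⟨φ.hom.base y, ξ⟩, u⟩ := by
  subst h
  let p : DiersPoint X hU := χ.toHom.hom.base y
  have h₁ : (χ.toHom ≫ M.unit.unop).hom.stalkMap y =
      M.unit.unop.hom.stalkMap p ≫ χ.toHom.hom.stalkMap y :=
    PresheafedSpace.stalkMap.comp χ.toHom.hom M.unit.unop.hom y
  have h₂ : χ.toHom.hom.stalkMap y ≫ (T.stalkIso y).hom =
      (M.stalkIso p).hom ≫ U.map (χ.loc y) := χ.comm y
  have h₃ : (χ.toHom ≫ M.unit.unop).hom.stalkMap y ≫ (T.stalkIso y).hom =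
      p.localUnit.hom ≫ U.map (χ.loc y) := by
    refine (congrArg (· ≫ _) h₁).trans ((Category.assoc _ _ _).trans ?_)
    refine (congrArg (_ ≫ ·) h₂).trans ((Category.assoc _ _ _).symm.trans ?_)
    exact congrArg (· ≫ U.map (χ.loc y)) (M.stalkMap_unit p)
  have h₄ := localUnit_fac_unique hU (χ.loc y) u (h₃.symm.trans hu.symm)
  exact congrArg (fun t : (Σ i, ((SpectralDualities.localUnit hU
    (X.presheaf.stalk p.1) i).right ⟶ T.loc y)) ↦ (⟨⟨p.1, t.1⟩, t.2⟩ :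
      Σ p : DiersPoint X hU, (p.localUnit.right ⟶ T.loc y))) h₄

end SpectrumModel

end UniversalProperty

/-! ### Morphisms to the spectrum from a morphism of `B`-spaces -/

section ExistsUniqueHom

open TopCat

variable {A : Type u₁} [Category.{v} A] {B : Type u₂} [Category.{v} B]
  [IsLocallyFinitelyPresentable.{v} B] {U : A ⥤ B} {hU : IsRightMultiAdjoint U}
  {X : SheafedSpace.{u₂, v, v} B} {T : USpace U}

/-- The morphism to a local object of a `U`-space induced on the stalks by a morphism
of `B`-spaces. -/
def USpace.toLoc (φ : T.toSheafedSpace ⟶ X) (y : T.carrier) :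
    X.presheaf.stalk (φ.hom.base y) ⟶ U.obj (T.loc y) :=
  φ.hom.stalkMap y ≫ (T.stalkIso y).hom

lemma USpace.toLoc_inv (φ : T.toSheafedSpace ⟶ X) (y : T.carrier) :
    USpace.toLoc φ y ≫ (T.stalkIso y).inv = φ.hom.stalkMap y :=
  (Category.assoc _ _ _).trans
    ((congrArg (_ ≫ ·) (T.stalkIso y).hom_inv_id).trans (Category.comp_id _))

/-- The factorization through `n` at a point `y` is, up to the stalk isomorphism, the germ of
a morphism to sections, whose germs at the nearby points give the factorizations there. -/
lemma BasicOpen.exists_section_lift (hD : DiersCondition U hU) (φ : T.toSheafedSpace ⟶ X)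
    (a : BasicOpen U X) {y : T.carrier} (h : a.Fac (USpace.toLoc φ y)) :
    ∃ (W : Opens T.carrier) (_ : y ∈ W) (q : a.n.right ⟶ T.presheaf.obj (op W)),
      ∀ (z : T.carrier) (hz : z ∈ W), ∃ h : a.Fac (USpace.toLoc φ z),
        q ≫ T.presheaf.germ W z hz = a.lift h ≫ (T.stalkIso z).inv := by
  have hm : a.n.hom ≫ a.lift h ≫ (T.stalkIso y).inv =
      X.presheaf.germ a.V (φ.hom.base y) h.mem ≫ φ.hom.stalkMap y := by
    rw [← Category.assoc, a.comp_lift h, Category.assoc, USpace.toLoc_inv]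
  obtain ⟨W, hW, hyW, q, hq, -⟩ := BasicOpen.exists_section φ a h.mem _ hm
  refine ⟨W, hyW, q, fun z hz ↦ ?_⟩
  have hz' : z ∈ (Opens.map φ.hom.base).obj a.V := hW hz
  have h₁ : a.n.hom ≫ q ≫ T.presheaf.germ W z hz ≫ (T.stalkIso z).hom =
      X.presheaf.germ a.V (φ.hom.base z) hz' ≫ USpace.toLoc φ z := by
    have h₀ : X.presheaf.germ a.V (φ.hom.base z) hz' ≫ φ.hom.stalkMap z =
      φ.hom.c.app (op a.V) ≫ T.presheaf.germ ((Opens.map φ.hom.base).obj a.V) z hz' :=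
        PresheafedSpace.stalkMap_germ φ.hom a.V z hz'
    have h₂ := T.presheaf.germ_res (homOfLE hW) z hz
    refine Eq.trans ?_ (Category.assoc _ _ _)
    refine Eq.trans ?_ (congrArg (· ≫ (T.stalkIso z).hom) h₀.symm)
    rw [← h₂, ← Category.assoc, hq]
    simp only [Category.assoc]
  refine ⟨⟨hz', _, h₁⟩, (Iso.eq_comp_inv _).2 ((Category.assoc _ _ _).trans ?_)⟩
  exact a.eq_lift hD _ _ h₁

lemma BasicOpen.isOpen_fac (hD : DiersCondition U hU) (φ : T.toSheafedSpace ⟶ X)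
    (a : BasicOpen U X) : IsOpen {y | a.Fac (USpace.toLoc φ y)} :=
  isOpen_iff_forall_mem_open.2 fun _ hy ↦
    have ⟨W, hyW, _, h⟩ := a.exists_section_lift hD φ hy
    ⟨W, fun z hz ↦ (h z hz).choose, W.2, hyW⟩

/-- The factorizations through `n` of the morphisms to the local objects glue to a morphism
from `cod n` to the sections. -/
lemma BasicOpen.exists_glued_section (hD : DiersCondition U hU) (φ : T.toSheafedSpace ⟶ X)
    (a : BasicOpen U X) {W : Opens T.carrier} (hW : ∀ y ∈ W, a.Fac (USpace.toLoc φ y)) :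
    ∃ s : a.n.right ⟶ T.presheaf.obj (op W), ∀ (y : T.carrier) (hy : y ∈ W),
      s ≫ T.presheaf.germ W y hy = a.lift (hW y hy) ≫ (T.stalkIso y).inv := by
  refine exists_hom_germ_eq T.IsSheaf (fun V s t h ↦ hom_ext_of_germ_eq T.IsSheaf h)
    (fun y hy ↦ a.lift (hW y hy) ≫ (T.stalkIso y).inv) fun y hy ↦ ?_
  obtain ⟨V, hyV, q, h⟩ := a.exists_section_lift hD φ (hW y hy)
  refine ⟨V ⊓ W, inf_le_right, ⟨hyV, hy⟩, q ≫ T.presheaf.map (homOfLE inf_le_left).op,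
    fun z hz ↦ ?_⟩
  obtain ⟨_, hz'⟩ := h z hz.1
  rw [Category.assoc, T.presheaf.germ_res, hz']

namespace SpectrumModel

variable (M : SpectrumModel X hU)

/-- Existence in the universal property of the spectrum. The continuous map sends `y` to the local
unit `ξ y` through which the morphism induced by `φ` at `y` factorizes, and the morphism of sheaves
is glued from the factorizations through the `n`. -/
lemma exists_hom (hD : DiersCondition U hU) (φ : T.toSheafedSpace ⟶ X)
    (ξ : ∀ y, LocalUnits hU (X.presheaf.stalk (φ.hom.base y)))
    (u : ∀ y, (SpectralDualities.localUnit hU _ (ξ y)).right ⟶ T.loc y)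
    (hu : ∀ y, (SpectralDualities.localUnit hU _ (ξ y)).hom ≫ U.map (u y) =
      USpace.toLoc φ y) :
    ∃ χ : M.toUSpace ⟶ T, χ.toHom ≫ M.unit.unop = φ ∧
      ∀ y, (⟨χ.toHom.hom.base y, χ.loc y⟩ : Σ p : DiersPoint X hU, (p.localUnit.right ⟶ T.loc y)) =
        ⟨⟨φ.hom.base y, ξ y⟩, u y⟩ := by
  have hu' (y : T.carrier) :
      (SpectralDualities.localUnit hU _ (ξ y)).hom ≫ U.map (u y) = USpace.toLoc φ y := hu y
  have hfac (a : BasicOpen U X) (y : T.carrier) :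
      a.Fac (SpectralDualities.localUnit hU _ (ξ y)).hom ↔ a.Fac (USpace.toLoc φ y) := by
    rw [← hu' y, a.fac_comp_iff]
  let g : T.carrier ⟶ diersSpace X hU := TopCat.ofHom
    { toFun := fun y ↦ (⟨φ.hom.base y, ξ y⟩ : DiersPoint X hU)
      continuous_toFun := continuous_generateFrom_iff.2 <| by
        rintro _ ⟨a, rfl⟩
        have e : {y | a.Fac (SpectralDualities.localUnit hU _ (ξ y)).hom} =
          {y | a.Fac (USpace.toLoc φ y)} := Set.ext fun y ↦ hfac a y
        exact (congrArg IsOpen e).mpr (a.isOpen_fac hD φ) }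
  have hg (a : BasicOpen U X) (y : T.carrier) (hy : y ∈ (Opens.map g).obj (a.opens hU)) :
      a.Fac (USpace.toLoc φ y) := (hfac a y).1 hy
  choose s hs using fun a : BasicOpen U X ↦ a.exists_glued_section hD φ (hg a)
  let σ : BasicOpen.cod U X ⟶ BasicOpen.D X hU ⋙ g _* T.presheaf :=
    { app := s
      naturality := fun a b f ↦ hom_ext_of_germ_eq T.IsSheaf fun y hy ↦ by
        have hy' : y ∈ (Opens.map g).obj (a.opens hU) := BasicOpen.opens_le X hU f hy
        have h₁ := T.presheaf.germ_res ((Opens.map g).map ((BasicOpen.D X hU).map f).unop) y hy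
        have h₂ := congrArg (· ≫ (T.stalkIso y).inv)
          (BasicOpen.hom_comp_lift hD f (hg a y hy') (hg b y hy))
        refine (Category.assoc _ _ _).trans ((congrArg (_ ≫ ·) (hs b y hy)).trans ?_)
        refine (Category.assoc _ _ _).symm.trans (h₂.trans ((hs a y hy').symm.trans ?_))
        exact (congrArg (s a ≫ ·) h₁.symm).trans (Category.assoc _ _ _).symm }
  have := M.isLeftKanExtension
  obtain ⟨α, hα⟩ := (M.isSheafification _ (Sheaf.pushforward_sheaf_of_sheaf g T.IsSheaf)).2
    (M.P.descOfIsLeftKanExtension M.ζ _ σ)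
  have hα : M.γ ≫ α = M.P.descOfIsLeftKanExtension M.ζ _ σ := hα
  have hs' (a : BasicOpen U X) :
      M.ζ.app a ≫ M.γ.app (op (a.opens hU)) ≫ α.app (op (a.opens hU)) = s a :=
    (congrArg (fun k ↦ M.ζ.app a ≫ k.app (op (a.opens hU))) hα).trans
      (M.P.descOfIsLeftKanExtension_fac_app M.ζ _ σ a)
  -- the glued sections extend along the Kan extension and the sheafification
  let ψ : T.toSheafedSpace ⟶ M.toUSpace.toSheafedSpace := InducedCategory.homMk ⟨g, α⟩
  have hψ (a : BasicOpen U X) (y : T.carrier) (hy : y ∈ (Opens.map g).obj (a.opens hU)) :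
      M.toStalk a (g y) hy ≫ ψ.hom.stalkMap y = a.lift (hg a y hy) ≫ (T.stalkIso y).inv :=
    (M.toStalk_stalkMap ψ a y hy).trans ((congrArg (· ≫ _) (hs' a)).trans (hs a y hy))
  let χ : M.toUSpace ⟶ T :=
    { toHom := ψ
      loc := u
      comm := fun y ↦ by
        refine M.stalk_hom_ext fun a hy ↦ ?_
        have h₁ := M.toStalk_stalkIso hD a (g y) hy
        have hy' : a.Fac (SpectralDualities.localUnit hU _ (ξ y)).hom := hy
        have h₂ : a.lift hy' ≫ U.map (u y) = a.lift (hg a y hy) := a.eq_lift hD _ _ (by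
          rw [← Category.assoc, a.comp_lift, Category.assoc, hu' y])
        refine Eq.trans ?_ (Category.assoc _ _ _)
        refine Eq.trans ?_ (congrArg (· ≫ U.map (u y)) h₁.symm)
        refine Eq.trans ?_ h₂.symm
        refine (Category.assoc _ _ _).symm.trans ((congrArg (· ≫ _) (hψ a y hy)).trans ?_)
        exact (Category.assoc _ _ _).trans
          ((congrArg (_ ≫ ·) (T.stalkIso y).inv_hom_id).trans (Category.comp_id _)) }
  refine ⟨χ, InducedCategory.hom_ext (PresheafedSpace.hext _ _ rfl (heq_of_eq
    (NatTrans.ext (funext fun V ↦ hom_ext_of_germ_eq T.IsSheaf fun y hy ↦ ?_)))), fun y ↦ rfl⟩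
  obtain ⟨V⟩ := V
  have hV : φ.hom.base y ∈ V := hy
  have hp := mem_ofOpens X hU (p := g y) hV
  have h₁ : M.S.germ ((Opens.map (diersProj X hU)).obj V) (g y) hV ≫ ψ.hom.stalkMap y =
      α.app (op ((Opens.map (diersProj X hU)).obj V)) ≫ T.presheaf.germ _ y hy :=
    PresheafedSpace.stalkMap_germ ψ.hom ((Opens.map (diersProj X hU)).obj V) y hV
  have h₂ : X.presheaf.germ V (φ.hom.base y) hV ≫ φ.hom.stalkMap y =
      φ.hom.c.app (op V) ≫ T.presheaf.germ ((Opens.map φ.hom.base).obj V) y hy :=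
    PresheafedSpace.stalkMap_germ φ.hom V y hV
  have h₃ := M.unitApp_germ V (g y) hV
  have h₄ := hψ (BasicOpen.ofOpens U X V) y hp
  refine Eq.trans ?_ h₂
  refine (Category.assoc _ _ _).trans ((congrArg (M.unitApp V ≫ ·) h₁.symm).trans ?_)
  refine (Category.assoc _ _ _).symm.trans ((congrArg (· ≫ ψ.hom.stalkMap y) h₃).trans ?_)
  refine h₄.trans ((congrArg (· ≫ _) (BasicOpen.lift_ofOpens hV (hg _ y hp))).trans ?_)
  exact (Category.assoc _ _ _).trans (congrArg (_ ≫ ·) (USpace.toLoc_inv φ y))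

/-- The universal property of the unit of the spectrum. -/
lemma existsUnique_hom (hD : DiersCondition U hU) (φ : T.toSheafedSpace ⟶ X) :
    ∃! χ : M.toUSpace ⟶ T, χ.toHom ≫ M.unit.unop = φ := by
  choose ξ u hu using fun y : T.carrier ↦
    exists_localUnit_fac hU (φ.hom.stalkMap y ≫ (T.stalkIso y).hom)
  obtain ⟨χ, hχ, h⟩ := M.exists_hom hD φ ξ u hu
  exact ⟨χ, hχ, fun χ' hχ' ↦ M.hom_ext fun y ↦
    (M.point_eq hχ' y (ξ y) (u y) (hu y)).trans (h y).symm⟩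

end SpectrumModel

end ExistsUniqueHom

/-! ### The spectrum functor -/

section SpecFunctor

variable {A : Type u₁} [Category.{v} A] {B : Type u₂} [Category.{v} B]
  [IsLocallyFinitelyPresentable.{v} B] {U : A ⥤ B} {hU : IsRightMultiAdjoint U}

/-- A choice of a spectrum for every `B`-space. -/
def chosenSpectrum (hD : DiersCondition U hU) (X : SheafedSpace.{u₂, v, v} B) :
    SpectrumModel X hU :=
  (exists_spectrumModel hD X).some

/-- The bijection between the morphisms from the spectrum of `X` to a `U`-space and the morphisms
from `X` to its underlying `B`-space. -/
def specHomEquiv (hD : DiersCondition U hU) (X : BSpace B) (T : USpace U) :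
    ((chosenSpectrum hD X.unop).toUSpace ⟶ T) ≃ (X ⟶ (USpace.ι U).obj T) :=
  Equiv.ofBijective (fun χ ↦ (chosenSpectrum hD X.unop).unit ≫ (USpace.ι U).map χ) <|
    (Function.bijective_iff_existsUnique _).2 fun φ ↦ by
      obtain ⟨χ, hχ, h⟩ := (chosenSpectrum hD X.unop).existsUnique_hom hD φ.unop
      exact ⟨χ, congrArg Quiver.Hom.op hχ, fun χ' hχ' ↦ h χ' (congrArg Quiver.Hom.unop hχ')⟩

lemma specHomEquiv_comp (hD : DiersCondition U hU) (X : BSpace B) (T T' : USpace U) (g : T ⟶ T')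
    (χ : (chosenSpectrum hD X.unop).toUSpace ⟶ T) :
    specHomEquiv hD X T' (χ ≫ g) = specHomEquiv hD X T χ ≫ (USpace.ι U).map g :=
  (congrArg (_ ≫ ·) ((USpace.ι U).map_comp χ g)).trans (Category.assoc _ _ _).symm

/-- The spectrum functor. -/
def spec (hD : DiersCondition U hU) : BSpace B ⥤ USpace U :=
  Adjunction.leftAdjointOfEquiv (specHomEquiv hD) (specHomEquiv_comp hD)

/-- The spectrum functor is left adjoint to the forgetful functor. -/
def specAdjunction (hD : DiersCondition U hU) : spec hD ⊣ USpace.ι U :=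
  Adjunction.adjunctionOfEquivLeft (specHomEquiv hD) (specHomEquiv_comp hD)

lemma specAdjunction_unit (hD : DiersCondition U hU) (X : BSpace B) :
    (specAdjunction hD).unit.app X = (chosenSpectrum hD X.unop).unit :=
  (congrArg (_ ≫ ·) ((USpace.ι U).map_id _)).trans (Category.comp_id _)

end SpecFunctor

/-- The spectral duality given by a Diers context. -/
def specDuality (C : DiersContext.{v, u₁, u₂}) : SpecDuality C :=
  have := C.lfp
  { fibered_p := USpace.isFibered
    fibered_q := BSpace.isFibered
    opfibered_q := BSpace.isOpfibered
    isFibMorphism := USpace.isFibMorphism_ι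
    𝔖 := spec C.diers
    adj := specAdjunction C.diers }

end

end SpectralDualities

theorem mainTheorem6 :
    ∃ (D : ∀ C : DiersContext.{v, u₁, u₂}, SpecDuality C)
      (H : ∀ {C E : DiersContext.{v, u₁, u₂}} (f : C ⟶ E), PushIsFibMorphism f),
      (∀ (C : DiersContext.{v, u₁, u₂}) (X : SheafedSpace.{u₂, v, v} C.ℬ),
        ∃ (M : SpectrumModel X C.multi) (e : (D C).𝔖.obj (op X) ≅ M.toUSpace),
          (D C).adj.unit.app (op X) ≫ (USpace.ι C.U).map e.hom = M.unit) ∧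
      ∃ Φ : StrictPseudofunctor DiersContext.{v, u₁, u₂}
          SpectralDuality.{v, max (v + 1) u₁ u₂, max (v + 1) u₂},
        Φ.toPrelaxFunctorStruct = specData D H := by
  refine ⟨specDuality, pushIsFibMorphism, fun C X ↦ ?_,
    StrictPseudofunctor.mk'' (specPreCore specDuality pushIsFibMorphism), rfl⟩
  have := C.lfp
  refine ⟨chosenSpectrum C.diers X, Iso.refl _, ?_⟩
  exact (congrArg (_ ≫ ·) ((USpace.ι C.U).map_id _)).trans
    ((Category.comp_id _).trans (specAdjunction_unit C.diers (op X)))
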